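/- Let $(\Omega,\mathcal F,\mathbb P)$ be a probability space, $H\in(0,1)$, $\nu>0$. Let $V$ be the Hilbert space of complex-valued functions in $L^2(\mathbb T^2)$, $\mathbb T^2=\mathbb R^2/\mathbb Z^2$, with mean zero, with orthonormal basis $e_k(x)=e^{i\langle k,x\rangle}$, $k\in K:=2\pi\mathbb Z^2\setminus\{0\}$. Let $(\alpha_k)_{k\in K}\subset[c,\infty)$ with $c>0$, $\alpha_{-k}=\alpha_k$ and $\alpha_k\to\infty$ as $|k|\to\infty$, and let $A$ be the operator $Ae_k=-\alpha_ke_k$ with domain $\{f\in V:\sum_k\alpha_k^2|\langle f,e_k\rangle|^2<\infty\}$; let $(S(t))_{t\ge0}$ be the strongly continuous semigroup generated by $\nu A$. Let $Q^{1/2}$ be a bounded linear operator on $V$ with $Q^{1/2}e_k=\sqrt{\lambda_k}\,e_k$, where $\lambda_k=\lambda_{-k}\ge0$. Let $B^H=\sum_k\beta^H_ke_k$ (formal series) be an infinite-dimensional fractional Brownian motion: $\beta^H_k=\frac1{\sqrt2}(X_k+iY_k)$ on $\mathbb R$, where $X_k,Y_k$ are independent normalized real two-sided fractional Brownian motions with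 Hurst parameter $H$, $\beta^H_{-k}=\overline{\beta^H_k}$, and the $\beta^H_k$ are otherwise independent. Integrals of deterministic functions against $\beta_k^H$ are Wiener integrals (mean-square limits of Riemann–Stieltjes sums; $\int_{-\infty}^t$ is the $L^2(\Omega)$-limit of $\int_a^t$ as $a\to-\infty$). Consider $$d\psi=\nu A\psi\,dt+\nu^HQ^{1/2}\,dB^H,\qquad t\ge 0.\tag{1}$$ A $V$-valued process $(\psi(t))_{t\ge0}$ is a mild solution if for every $T>0$ it is $\mathcal B([0,T])\otimes\mathcal F$-measurable on $[0,T]$ and, for every $t\in[0,T]$, almost surely $$\psi(t)=S(t)\psi(0)+\sum_{k\in K}\sqrt{\lambda_k}\,\nu^H\int_0^te^{-(t-s)\nu\alpha_k}\,d\beta^H_k(s)\,e_k,$$ the series converging in $L^2(\Omega,V)$. It is strictly stationary if for all $n$, $t_1,\dots,t_n\ge0$ and $r\ge0$ the law of $(\psi(t_1+r),\dots,\psi(t_n+r))$ is that of $(\psi(t_1),\dots,\psi(t_n))$. A strictly stationary solution is ergodic if for every measurable $\rho:V\to\mathbb R$ with $\mathbb E|\rho(\psi(0))|<\infty$, almost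 surely $\frac1T\int_0^T\rho(\psi(t))\,dt\to\mathbb E\,\rho(\psi(0))$ as $T\to\infty$. Theorem. Assume that $\sum_{k\in K}\lambda_k\alpha_k^{2(\varepsilon-H)}<\infty$ for some $\varepsilon>0$. Then there is a process $(\psi(t))_{t\in\mathbb R}$ with values in $V$ such that, for every $t\in\mathbb R$, almost surely $$\psi(t)=\sum_{k\in K}\sqrt{\lambda_k}\,\nu^H\int_{-\infty}^te^{-(t-u)\nu\alpha_k}\,d\beta^H_k(u)\,e_k\qquad(\text{convergence in }L^2(\Omega,V)),$$ and such that $(\psi(t))_{t\ge0}$ is a strictly stationary and ergodic mild solution of (1), adapted, up to null sets, to the natural filtration $\sigma(\beta_k^H(s):s\le t,\ k\in K)$ of the two-sided $B^H$. It is unique: every strictly stationary mild solution of (1) on the same probability space that is adapted in this sense has the same (finite-dimensional) distributions as $(\psi(t))_{t\ge0}$. -/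

import Mathlib

open MeasureTheory ProbabilityTheory Filter Topology Set
open scoped ENNReal InnerProductSpace

noncomputable section

namespace FractionalSPDE

/-! ### The state space: mean-zero square-integrable functions on the torus `ℝ² / ℤ²` -/

/-- Lebesgue measure on the torus `ℝ² / ℤ²` (total mass one). -/
abbrev torusMeasure : Measure (UnitAddTorus (Fin 2)) :=
  Measure.pi fun _ => AddCircle.haarAddCircle

/-- Complex-valued square-integrable functions on the torus. -/
abbrev L2Torus : Type := Lp ℂ 2 torusMeasure

/-- The exponential `x ↦ exp (i ⟨2 π n, x⟩)`, as an element of `L²`. -/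
def fourierMode (n : Fin 2 → ℤ) : L2Torus :=
  ContinuousMap.toLp (E := ℂ) 2 torusMeasure ℂ (UnitAddTorus.mFourier n)

lemma orthonormal_fourierMode : Orthonormal ℂ fourierMode :=
  UnitAddTorus.orthonormal_mFourier (d := Fin 2)

lemma inner_fourierMode_zero (f : L2Torus) : ⟪fourierMode 0, f⟫_ℂ = ∫ x, f x ∂torusMeasure := by
  rw [L2.inner_def]
  refine integral_congr_ae ?_
  filter_upwards [ContinuousMap.coeFn_toLp (E := ℂ) (p := 2) (𝕜 := ℂ) torusMeasure
    (UnitAddTorus.mFourier (0 : Fin 2 → ℤ))] with x hx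
  rw [fourierMode, hx]
  simp [UnitAddTorus.mFourier_zero]

/-- The space of square-integrable functions of mean zero, as a subspace of `L²`. -/
def meanZero : Submodule ℂ L2Torus where
  carrier := {f | ∫ x, f x ∂torusMeasure = 0}
  add_mem' {f g} hf hg := by
    simp only [mem_ofPred_eq, ← inner_fourierMode_zero, inner_add_right] at *
    rw [hf, hg, add_zero]
  zero_mem' := by
    simp only [mem_ofPred_eq, ← inner_fourierMode_zero, inner_zero_right]
  smul_mem' c f hf := by
    simp only [mem_ofPred_eq, ← inner_fourierMode_zero, inner_smul_right] at *
    rw [hf, mul_zero]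

/-- The Hilbert space `V` of square-integrable functions of mean zero on the torus. -/
abbrev V : Type := meanZero

instance : MeasurableSpace V := borel V

instance : BorelSpace V := ⟨rfl⟩

lemma isClosed_meanZero : IsClosed (meanZero : Set L2Torus) := by
  have h : (meanZero : Set L2Torus) = {f | ⟪fourierMode 0, f⟫_ℂ = 0} := by
    ext f
    rw [mem_ofPred_eq, inner_fourierMode_zero]
    rfl
  rw [h]
  exact isClosed_eq (by fun_prop) continuous_const

instance : CompleteSpace V := isClosed_meanZero.completeSpace_coe

/-- The index set: `n : Mode` stands for the wave vector `k = 2 π n ∈ 2 π ℤ² \ {0}`. -/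
abbrev Mode : Type := {n : Fin 2 → ℤ // n ≠ 0}

/-- The index of the wave vector `-k`. -/
instance : Neg Mode := ⟨fun k => ⟨-k.1, neg_ne_zero.2 k.2⟩⟩

/-- The basis function `e_k = exp (i ⟨k, ·⟩)` of `V`. -/
def e (k : Mode) : V :=
  ⟨fourierMode k.1, by
    change ∫ x, fourierMode k.1 x ∂torusMeasure = 0
    rw [← inner_fourierMode_zero]
    exact orthonormal_fourierMode.2 (Ne.symm k.2)⟩

lemma orthonormal_e : Orthonormal ℂ e := by
  rw [orthonormal_iff_ite]
  intro k l
  have h := orthonormal_iff_ite.1 orthonormal_fourierMode k.1 l.1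
  simpa only [e, Submodule.coe_inner, Subtype.ext_iff] using h

/-! ### The operator `A` and the semigroup generated by `ν A` -/

/-- The domain `{f ∈ V | ∑ α_k² |⟨f, e_k⟩|² < ∞}` of `A`. -/
def domainA (α : Mode → ℝ) : Submodule ℂ V where
  carrier := {f | Summable fun k => α k ^ 2 * ‖⟪e k, f⟫_ℂ‖ ^ 2}
  add_mem' {f g} hf hg := by
    refine Summable.of_nonneg_of_le (fun k => by positivity) (fun k => ?_)
      ((hf.add hg).mul_left 2)
    have h1 : ‖⟪e k, f + g⟫_ℂ‖ ≤ ‖⟪e k, f⟫_ℂ‖ + ‖⟪e k, g⟫_ℂ‖ := by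
      rw [inner_add_right]
      exact norm_add_le _ _
    have h2 : ‖⟪e k, f + g⟫_ℂ‖ ^ 2 ≤ 2 * (‖⟪e k, f⟫_ℂ‖ ^ 2 + ‖⟪e k, g⟫_ℂ‖ ^ 2) :=
      (pow_le_pow_left₀ (norm_nonneg _) h1 2).trans add_sq_le
    calc α k ^ 2 * ‖⟪e k, f + g⟫_ℂ‖ ^ 2
        ≤ α k ^ 2 * (2 * (‖⟪e k, f⟫_ℂ‖ ^ 2 + ‖⟪e k, g⟫_ℂ‖ ^ 2)) := by gcongr
      _ = _ := by ring
  zero_mem' := by simp [summable_zero]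
  smul_mem' c f hf := by
    refine (hf.mul_left (‖c‖ ^ 2)).congr fun k => ?_
    rw [inner_smul_right, norm_mul]
    ring

lemma summable_A {α : Mode → ℝ} {f : V} (hf : f ∈ domainA α) :
    Summable fun k => (-(α k : ℂ) * ⟪e k, f⟫_ℂ) • e k := by
  have h := (orthonormal_e.orthogonalFamily.summable_iff_norm_sq_summable
    (fun k => -(α k : ℂ) * ⟪e k, f⟫_ℂ)).2 (hf.congr fun k => by
      rw [norm_mul, norm_neg, Complex.norm_real, mul_pow, Real.norm_eq_abs, sq_abs])
  simpa using h

/-- The operator `A` with `A e_k = -α_k e_k`, on its domain `domainA α`. -/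
def opA (α : Mode → ℝ) : V →ₗ.[ℂ] V where
  domain := domainA α
  toFun :=
    { toFun := fun f => ∑' k, (-(α k : ℂ) * ⟪e k, (f : V)⟫_ℂ) • e k
      map_add' := fun f g => by
        rw [← (summable_A f.2).tsum_add (summable_A g.2)]
        refine tsum_congr fun k => ?_
        rw [Submodule.coe_add, inner_add_right, mul_add, add_smul]
      map_smul' := fun c f => by
        rw [RingHom.id_apply, ← (summable_A f.2).tsum_const_smul c]
        refine tsum_congr fun k => ?_
        rw [Submodule.coe_smul, inner_smul_right, smul_smul]
        ring_nf }

/-- `S` is a strongly continuous semigroup on `[0, ∞)` whose infinitesimal generator is exactly the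
unbounded operator `L`. -/
structure IsSemigroupGeneratedBy (S : ℝ → V →L[ℂ] V) (L : V →ₗ.[ℂ] V) : Prop where
  map_zero : S 0 = ContinuousLinearMap.id ℂ V
  map_add : ∀ s t : ℝ, 0 ≤ s → 0 ≤ t → S (s + t) = (S s).comp (S t)
  continuousOn : ∀ f : V, ContinuousOn (fun t => S t f) (Ici 0)
  generator : ∀ f g : V, (f, g) ∈ L.graph ↔
    Tendsto (fun h : ℝ => ((h⁻¹ : ℝ) : ℂ) • (S h f - f)) (𝓝[>] 0) (𝓝 g)

/-! ### Fractional Brownian motion -/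

variable {Ω : Type*} [MeasurableSpace Ω]

/-- `X` is a normalized real fractional Brownian motion on `ℝ` with Hurst parameter `H`. -/
structure IsFractionalBM (H : ℝ) (X : ℝ → Ω → ℝ) (P : Measure Ω) : Prop where
  measurable : ∀ t, Measurable (X t)
  gaussian : IsGaussianProcess X P
  zero : ∀ᵐ ω ∂P, X 0 ω = 0
  mean : ∀ t, ∫ ω, X t ω ∂P = 0
  cov : ∀ t s, ∫ ω, X t ω * X s ω ∂P =
    (1 / 2) * (|t| ^ (2 * H) + |s| ^ (2 * H) - |t - s| ^ (2 * H))
  continuous : ∀ᵐ ω ∂P, Continuous fun t => X t ω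

/-- `b = (X + i Y) / √2` with `X`, `Y` independent normalized real fractional Brownian motions. -/
structure IsComplexFractionalBM (H : ℝ) (b : ℝ → Ω → ℂ) (P : Measure Ω) : Prop where
  re : IsFractionalBM H (fun t ω => √2 * (b t ω).re) P
  im : IsFractionalBM H (fun t ω => √2 * (b t ω).im) P
  indep : IndepFun (fun ω t => (b t ω).re) (fun ω t => (b t ω).im) P

/-- The coordinates `β_k`, `k ∈ 2 π ℤ² \ {0}`, of an infinite-dimensional fractional Brownian
motion `∑ β_k e_k`: complex fractional Brownian motions with `β_{-k}` the conjugate of `β_k`, and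
otherwise independent, that is, any family containing at most one of `β_k`, `β_{-k}` for each `k`
is independent. -/
structure IsInfiniteDimFractionalBM (H : ℝ) (β : Mode → ℝ → Ω → ℂ) (P : Measure Ω) : Prop where
  complexFBM : ∀ k, IsComplexFractionalBM H (β k) P
  conj : ∀ k t, ∀ᵐ ω ∂P, β (-k) t ω = (starRingEnd ℂ) (β k t ω)
  indep : ∀ J : Set Mode, (∀ k ∈ J, -k ∉ J) →
    iIndepFun (fun (k : J) (ω : Ω) (t : ℝ) => β k t ω) P

/-- The natural filtration at time `t` of the two-sided infinite-dimensional process. -/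
@[reducible] def naturalFiltration (β : Mode → ℝ → Ω → ℂ) (t : ℝ) : MeasurableSpace Ω :=
  ⨆ (k : Mode) (s : ℝ) (_ : s ≤ t), MeasurableSpace.comap (β k s) inferInstance

/-- `Y = ∫_a^b f(s) dβ(s)` for a deterministic (continuous) integrand `f`: the mean-square
Riemann-Stieltjes integral, i.e. the Riemann-Stieltjes sums over tagged partitions of `[a, b]`
converge to `Y` in `L²(Ω)` as the mesh tends to zero. -/
def IsWienerIntegral (P : Measure Ω) (f : ℝ → ℝ) (b : ℝ → Ω → ℂ) (a c : ℝ) (Y : Ω → ℂ) : Prop :=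
  MemLp Y 2 P ∧
  ∀ ε : ℝ, 0 < ε → ∃ δ : ℝ, 0 < δ ∧
    ∀ (n : ℕ) (p : ℕ → ℝ) (ξ : ℕ → ℝ), Monotone p → p 0 = a → p n = c →
      (∀ i < n, p (i + 1) - p i < δ ∧ ξ i ∈ Icc (p i) (p (i + 1))) →
      eLpNorm (fun ω => (∑ i ∈ Finset.range n, (f (ξ i) : ℂ) * (b (p (i + 1)) ω - b (p i) ω)) - Y ω)
        2 P ≤ ENNReal.ofReal ε

/-- `Y = ∫_{-∞}^c f(s) dβ(s)`, the limit in `L²(Ω)` of `∫_a^c f(s) dβ(s)` as `a → -∞`. -/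
def IsWienerIntegralIic (P : Measure Ω) (f : ℝ → ℝ) (b : ℝ → Ω → ℂ) (c : ℝ) (Y : Ω → ℂ) : Prop :=
  MemLp Y 2 P ∧ ∃ J : ℝ → Ω → ℂ, (∀ a ≤ c, IsWienerIntegral P f b a c (J a)) ∧
    Tendsto (fun a => eLpNorm (fun ω => J a ω - Y ω) 2 P) atBot (𝓝 0)

/-- `Z = ∑ c_k Y_k e_k`, the series converging in `L²(Ω, V)`. -/
def IsSeriesL2 (P : Measure Ω) (c : Mode → ℝ) (Y : Mode → Ω → ℂ) (Z : Ω → V) : Prop :=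
  MemLp Z 2 P ∧
  Tendsto (fun F : Finset Mode => eLpNorm (fun ω => (∑ k ∈ F, ((c k : ℂ) * Y k ω) • e k) - Z ω) 2 P)
    atTop (𝓝 0)

/-! ### The equation `dψ = ν A ψ dt + ν^H Q^{1/2} dB^H` -/

/-- `Z = ∫_0^t S(t-s) Q^{1/2} dB^H(s)`, i.e.
`Z = ∑ √λ_k ν^H (∫_0^t exp (-(t-s) ν α_k) dβ_k(s)) e_k` with convergence in `L²(Ω, V)`. -/
def IsStochasticConvolution (P : Measure Ω) (H ν : ℝ) (α lam : Mode → ℝ) (β : Mode → ℝ → Ω → ℂ)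
    (t : ℝ) (Z : Ω → V) : Prop :=
  ∃ Y : Mode → Ω → ℂ,
    (∀ k, IsWienerIntegral P (fun s => Real.exp (-(t - s) * ν * α k)) (β k) 0 t (Y k)) ∧
    IsSeriesL2 P (fun k => √(lam k) * ν ^ H) Y Z

/-- `Z = ∑ √λ_k ν^H (∫_{-∞}^t exp (-(t-u) ν α_k) dβ_k(u)) e_k`, with convergence in
`L²(Ω, V)`. -/
def IsStationarySeries (P : Measure Ω) (H ν : ℝ) (α lam : Mode → ℝ) (β : Mode → ℝ → Ω → ℂ)
    (t : ℝ) (Z : Ω → V) : Prop :=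
  ∃ Y : Mode → Ω → ℂ,
    (∀ k, IsWienerIntegralIic P (fun u => Real.exp (-(t - u) * ν * α k)) (β k) t (Y k)) ∧
    IsSeriesL2 P (fun k => √(lam k) * ν ^ H) Y Z

/-- `ψ` is a mild solution: on every `[0, T]` it is a jointly measurable `V`-valued process with
`ψ(t) = S(t) ψ(0) + ∫_0^t S(t-s) Q^{1/2} dB^H(s)` almost surely for every `t ∈ [0, T]`, where `S` is
the semigroup generated by `ν A`. Only the values `ψ t` with `t ≥ 0` matter. -/
def IsMildSolution (P : Measure Ω) (H ν : ℝ) (α lam : Mode → ℝ) (β : Mode → ℝ → Ω → ℂ)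
    (ψ : ℝ → Ω → V) : Prop :=
  ∀ T : ℝ, 0 < T →
    Measurable (fun p : Icc (0 : ℝ) T × Ω => ψ p.1 p.2) ∧
    ∃ S : ℝ → V →L[ℂ] V, IsSemigroupGeneratedBy S ((ν : ℂ) • opA α) ∧
      ∀ t ∈ Icc (0 : ℝ) T, ∃ Z : Ω → V, IsStochasticConvolution P H ν α lam β t Z ∧
        ∀ᵐ ω ∂P, ψ t ω = S t (ψ 0 ω) + Z ω

/-- Strict stationarity of `(ψ(t))_{t ≥ 0}`. -/
def IsStrictlyStationary (P : Measure Ω) (ψ : ℝ → Ω → V) : Prop :=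
  ∀ (n : ℕ) (t : Fin n → ℝ) (r : ℝ), (∀ i, 0 ≤ t i) → 0 ≤ r →
    IdentDistrib (fun ω i => ψ (t i + r) ω) (fun ω i => ψ (t i) ω) P P

/-- Ergodicity of a stationary process: for all measurable `ρ : V → ℝ` with `E|ρ(ψ(0))| < ∞`, almost
surely the time averages `(1/T) ∫_0^T ρ(ψ(t)) dt` exist and converge to `E ρ(ψ(0))`. -/
def IsErgodic (P : Measure Ω) (ψ : ℝ → Ω → V) : Prop :=
  ∀ ρ : V → ℝ, Measurable ρ → Integrable (fun ω => ρ (ψ 0 ω)) P →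
    ∀ᵐ ω ∂P, (∀ T : ℝ, 0 < T → IntervalIntegrable (fun t => ρ (ψ t ω)) volume 0 T) ∧
      Tendsto (fun T : ℝ => (1 / T) * ∫ t in (0 : ℝ)..T, ρ (ψ t ω)) atTop
        (𝓝 (∫ ω', ρ (ψ 0 ω') ∂P))

/-- `(ψ(t))_{t ≥ 0}` is adapted to the natural filtration of `B^H`, up to null sets. -/
def IsAdapted (P : Measure Ω) (β : Mode → ℝ → Ω → ℂ) (ψ : ℝ → Ω → V) : Prop :=
  ∀ t : ℝ, 0 ≤ t → AEStronglyMeasurable[naturalFiltration β t] (ψ t) P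

/-- `(φ(t))_{t ≥ 0}` and `(ψ(t))_{t ≥ 0}` have the same distribution, i.e. the same
finite-dimensional distributions. -/
def SameDistribution (P : Measure Ω) (φ ψ : ℝ → Ω → V) : Prop :=
  ∀ (n : ℕ) (t : Fin n → ℝ), (∀ i, 0 ≤ t i) →
    IdentDistrib (fun ω i => φ (t i) ω) (fun ω i => ψ (t i) ω) P P

end FractionalSPDE

end

open FractionalSPDE

open MeasureTheory ProbabilityTheory Filter Topology Set
open scoped ENNReal InnerProductSpace

noncomputable section

set_option linter.unusedSectionVars false

namespace FractionalSPDE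

/-! Read as a curve in `L²(Ω)`, each coordinate of the noise is Hölder of exponent `H`, because its
increments have norm exactly `|t - s|^H`. Integration by parts then turns `∫_{-∞}^t e^{-κ(t-u)}
dβ(u)` into the absolutely convergent Bochner integral `ouFilter`, that is `∫_0^∞ κ e^{-κr} (β(t) -
β(t-r)) dr`, of norm at most `Γ(H+1) κ^{-H}`. With `κ = ν α_k` and weight `√λ_k ν^H` the powers of
`ν` cancel, so the modes are square summable as soon as `∑ λ_k α_k^{-2H} < ∞`, which follows from
the assumption because `α_k ≥ c > 0`. Distinct modes are orthogonal in `L²(Ω, V)`, so the series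
converges and is continuous in `t`; a continuous curve in `L²` has a jointly measurable version, and
this version is the process. The identity `ouFilter_eq` is the Ornstein-Uhlenbeck equation for each
mode, and summing it gives the mild equation.

Bochner integrals and convergent series do not leave closed subspaces. This one principle
(`ouSeries_mem`) shows that every real functional of the process lies in the closed Gaussian span of
the noise, that the process is adapted, and that it decorrelates from distant increments. On the
Gaussian span the characteristic function is `exp(-‖Z‖²/2)` (`charFun_gaussianSpace`), so laws
reduce to covariances. These depend on the noise through its increments, whose covariances are shift
invariant: hence stationarity (`identDistrib_version`). The second differences of `|t|^{2H}` tend to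
zero because `H < 1`: hence `tendsto_inner_ouSeries`, and with it mixing for the functions `exp(i L
x)`.

For ergodicity, orthogonality at large lags gives convergence in mean of the averages of `exp(i L
ψ)` along integer times. These functions span a dense subspace of `L¹` of the stationary law, so the
same holds for every integrable observable. Integrals over unit time blocks inherit it and form a
stationary sequence; the maximal ergodic theorem upgrades convergence in mean to a constant into
almost sure convergence (`ae_tendsto_birkhoffAverage`), and the incomplete last block is negligible.

For uniqueness, the semigroup and the stochastic convolution are determined by the data, so two mild
solutions differ by `S(t)(φ(0) - ψ(0))`, of norm at most `e^{-νct} ‖φ(0) - ψ(0)‖`. If both are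
stationary, shifting time to infinity identifies their finite-dimensional laws
(`IsMildSolution.sameDistribution`). -/

section

/-! ### Riemann-Stieltjes integrals along curves in a Banach space -/

section Curves

variable {E : Type*} [NormedAddCommGroup E] [NormedSpace ℝ E]

/-- The curve `b` is globally Hölder continuous with constant `C` and exponent `H`. -/
def IsHolderCurve (C H : ℝ) (b : ℝ → E) : Prop := ∀ t s, ‖b t - b s‖ ≤ C * |t - s| ^ H

lemma IsHolderCurve.continuous {C H : ℝ} {b : ℝ → E} (hb : IsHolderCurve C H b) (hH : 0 < H) :
    Continuous b := by
  rw [continuous_iff_continuousAt]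
  intro s
  rw [ContinuousAt, tendsto_iff_norm_sub_tendsto_zero]
  refine squeeze_zero (fun _ => norm_nonneg _) (fun t => hb t s) ?_
  have : Continuous fun t : ℝ => C * |t - s| ^ H :=
    continuous_const.mul ((continuous_abs.comp (continuous_id.sub continuous_const)).rpow_const
      fun _ => Or.inr hH.le)
  simpa [Real.zero_rpow hH.ne'] using this.tendsto s

/-- The integral `∫_a^c f db`, defined by integration by parts; `f'` is the derivative of `f`. -/
def stieltjes (f f' : ℝ → ℝ) (b : ℝ → E) (a c : ℝ) : E :=
  f c • b c - f a • b a - ∫ s in a..c, f' s • b s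

lemma stieltjes_self (f f' : ℝ → ℝ) (b : ℝ → E) (a : ℝ) : stieltjes f f' b a a = 0 := by
  simp [stieltjes]

lemma stieltjes_add {f f' : ℝ → ℝ} {b : ℝ → E} (hf' : Continuous f') (hb : Continuous b)
    (a c d : ℝ) : stieltjes f f' b a c + stieltjes f f' b c d = stieltjes f f' b a d := by
  have hi : ∀ x y, IntervalIntegrable (fun s => f' s • b s) volume x y :=
    fun x y => (hf'.smul hb).intervalIntegrable x y
  rw [stieltjes, stieltjes, stieltjes, ← intervalIntegral.integral_add_adjacent_intervals
    (hi a c) (hi c d)]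
  abel

variable [CompleteSpace E]

/-- Splitting at the tag `ξ`, integration by parts writes the error as integrals of `f'` against `b
q - b s` on `[ξ, q]` and against `b p - b s` on `[p, ξ]`. Only the oscillation of `b` enters, so no
bounded variation is needed. -/
lemma norm_smul_sub_stieltjes_le {f f' : ℝ → ℝ} {b : ℝ → E}
    (hf : ∀ s, HasDerivAt f (f' s) s) (hf' : Continuous f') (hb : Continuous b)
    {p q ξ M η : ℝ} (hξ : ξ ∈ Icc p q) (hM : ∀ s ∈ Icc p q, |f' s| ≤ M)
    (hη : ∀ s ∈ Icc p q, ∀ r ∈ Icc p q, ‖b s - b r‖ ≤ η) :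
    ‖f ξ • (b q - b p) - stieltjes f f' b p q‖ ≤ M * η * (q - p) := by
  have hi : ∀ x y, IntervalIntegrable (fun s => f' s • b s) volume x y :=
    fun x y => (hf'.smul hb).intervalIntegrable x y
  have hi1 : ∀ (v : E) x y, IntervalIntegrable (fun s => f' s • v) volume x y :=
    fun v x y => (hf'.smul continuous_const).intervalIntegrable x y
  have key : ∀ (v : E) x y, ∫ s in x..y, f' s • (v - b s) =
      (f y - f x) • v - ∫ s in x..y, f' s • b s := by
    intro v x y
    simp_rw [smul_sub]
    rw [intervalIntegral.integral_sub (hi1 v x y) (hi x y), intervalIntegral.integral_smul_const,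
      intervalIntegral.integral_eq_sub_of_hasDerivAt (fun s _ => hf s) (hf'.intervalIntegrable x y)]
  have h1 : f ξ • (b q - b p) - stieltjes f f' b p q =
      -((∫ s in ξ..q, f' s • (b q - b s)) + ∫ s in p..ξ, f' s • (b p - b s)) := by
    rw [key, key, stieltjes, ← intervalIntegral.integral_add_adjacent_intervals (hi p ξ) (hi ξ q)]
    module
  have hpq : p ≤ q := hξ.1.trans hξ.2
  have hM0 : 0 ≤ M := (abs_nonneg _).trans (hM p ⟨le_rfl, hpq⟩)
  have bound : ∀ v ∈ Icc p q, ∀ x y, p ≤ x → x ≤ y → y ≤ q →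
      ‖∫ s in x..y, f' s • (b v - b s)‖ ≤ M * η * (y - x) := by
    intro v hv x y hx hxy hy
    refine (intervalIntegral.norm_integral_le_of_norm_le_const (C := M * η) fun s hs => ?_).trans
      (by rw [abs_of_nonneg (sub_nonneg.2 hxy)])
    rw [uIoc_of_le hxy] at hs
    have hs' : s ∈ Icc p q := ⟨hx.trans hs.1.le, hs.2.trans hy⟩
    rw [norm_smul, Real.norm_eq_abs]
    exact mul_le_mul (hM s hs') (hη v hv s hs') (norm_nonneg _) hM0
  rw [h1, norm_neg]
  refine (norm_add_le _ _).trans ((add_le_add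
    (bound q ⟨hpq, le_rfl⟩ ξ q hξ.1 hξ.2 le_rfl)
    (bound p ⟨le_rfl, hpq⟩ p ξ le_rfl hξ.1 hξ.2)).trans (le_of_eq (by ring)))

/-- Riemann-Stieltjes sums converge to the Stieltjes integral as the mesh tends to zero. -/
lemma norm_sum_sub_stieltjes_le {f f' : ℝ → ℝ} {b : ℝ → E}
    (hf : ∀ s, HasDerivAt f (f' s) s) (hf' : Continuous f') (hb : Continuous b)
    {a c M η δ : ℝ} (hM : ∀ s ∈ Icc a c, |f' s| ≤ M)
    (hη : ∀ s ∈ Icc a c, ∀ r ∈ Icc a c, |s - r| < δ → ‖b s - b r‖ ≤ η)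
    (n : ℕ) (p ξ : ℕ → ℝ) (hp : Monotone p) (hp0 : p 0 = a) (hpn : p n = c)
    (hmesh : ∀ i < n, p (i + 1) - p i < δ ∧ ξ i ∈ Icc (p i) (p (i + 1))) :
    ‖(∑ i ∈ Finset.range n, f (ξ i) • (b (p (i + 1)) - b (p i))) - stieltjes f f' b a c‖
      ≤ M * η * (c - a) := by
  -- Induction over initial pieces of the partition: local errors are proportional to interval
  -- lengths, so they add up to a multiple of `c - a`.
  have key : ∀ m ≤ n,
      ‖(∑ i ∈ Finset.range m, f (ξ i) • (b (p (i + 1)) - b (p i))) - stieltjes f f' b a (p m)‖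
        ≤ M * η * (p m - a) := by
    intro m
    induction m with
    | zero => intro _; simp [hp0, stieltjes_self]
    | succ m ih =>
      intro hm
      have h1 := ih (by omega)
      have hsub : Icc (p m) (p (m + 1)) ⊆ Icc a c :=
        Icc_subset_Icc (hp0 ▸ hp (Nat.zero_le m)) (hpn ▸ hp hm)
      have h2 := norm_smul_sub_stieltjes_le hf hf' hb (hmesh m (by omega)).2
        (fun s hs => hM s (hsub hs)) (η := η) (fun s hs r hr => hη s (hsub hs) r (hsub hr) (by
          have := (hmesh m (by omega)).1
          rw [abs_lt]; constructor <;> linarith [hs.1, hs.2, hr.1, hr.2]))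
      rw [Finset.sum_range_succ, ← stieltjes_add hf' hb a (p m) (p (m + 1))]
      calc _ = ‖((∑ i ∈ Finset.range m, f (ξ i) • (b (p (i + 1)) - b (p i)))
              - stieltjes f f' b a (p m)) + (f (ξ m) • (b (p (m + 1)) - b (p m))
              - stieltjes f f' b (p m) (p (m + 1)))‖ := by congr 1; abel
        _ ≤ _ := (norm_add_le _ _).trans ((add_le_add h1 h2).trans (le_of_eq (by ring)))
  simpa [hpn] using key n le_rfl

/-! ### Exponentially weighted moving averages of a Hölder curve -/

/-- The moving average `∫_0^∞ κ e^{-κ r} (b t - b (t - r)) dr`, which is the value of the integral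
`∫_{-∞}^t e^{-κ (t - u)} db(u)`. -/
def ouFilter (κ : ℝ) (b : ℝ → E) (t : ℝ) : E :=
  ∫ r in Ioi (0 : ℝ), (κ * Real.exp (-(κ * r))) • (b t - b (t - r))

/-- The integral `∫_a^c e^{-κ (c - s)} db(s)`. -/
def ouIntegral (κ : ℝ) (b : ℝ → E) (a c : ℝ) : E :=
  stieltjes (fun s => Real.exp (-(κ * (c - s)))) (fun s => κ * Real.exp (-(κ * (c - s)))) b a c

lemma integrableOn_exp_mul_rpow {κ H : ℝ} (hκ : 0 < κ) (hH : 0 < H) :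
    IntegrableOn (fun r : ℝ => κ * Real.exp (-(κ * r)) * r ^ H) (Ioi 0) := by
  have h := integrableOn_rpow_mul_exp_neg_mul_rpow (s := H) (p := 1) (b := κ) (by linarith)
    one_pos hκ
  refine Integrable.congr (h.const_mul κ) (ae_of_all _ fun r => ?_)
  simp only [Real.rpow_one, neg_mul]
  ring

lemma integral_exp_mul_rpow {κ H : ℝ} (hκ : 0 < κ) (hH : 0 < H) :
    ∫ r in Ioi (0 : ℝ), κ * Real.exp (-(κ * r)) * r ^ H = Real.Gamma (H + 1) * κ ^ (-H) := by
  have h := Real.integral_rpow_mul_exp_neg_mul_Ioi (a := H + 1) (r := κ) (by linarith) hκ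
  have h2 : ∫ r in Ioi (0 : ℝ), κ * Real.exp (-(κ * r)) * r ^ H =
      κ * ∫ r in Ioi (0 : ℝ), r ^ (H + 1 - 1) * Real.exp (-(κ * r)) := by
    rw [← integral_const_mul]
    refine setIntegral_congr_fun measurableSet_Ioi fun r _ => ?_
    simp only [add_sub_cancel_right]
    ring
  rw [h2, h, one_div, Real.inv_rpow hκ.le, ← Real.rpow_neg hκ.le, ← mul_assoc]
  nth_rewrite 1 [← Real.rpow_one κ]
  rw [← Real.rpow_add hκ, mul_comm]
  congr 2
  ring

lemma integrableOn_exp {κ : ℝ} (hκ : 0 < κ) :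
    IntegrableOn (fun r : ℝ => κ * Real.exp (-(κ * r))) (Ioi 0) := by
  have := (integrableOn_exp_mul_Ioi (neg_neg_of_pos hκ) 0).const_mul κ
  simp only [neg_mul] at this
  exact this

lemma integral_exp {κ : ℝ} (hκ : 0 < κ) :
    ∫ r in Ioi (0 : ℝ), κ * Real.exp (-(κ * r)) = 1 := by
  have := integral_exp_mul_Ioi (neg_neg_of_pos hκ) 0
  rw [integral_const_mul]
  simp only [neg_mul] at this
  rw [this]
  simp [hκ.ne']

variable {C H κ : ℝ} {b : ℝ → E}

lemma IsHolderCurve.norm_ouKernel_le (hb : IsHolderCurve C H b) (hκ : 0 < κ) (t : ℝ) {r : ℝ}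
    (hr : 0 < r) : ‖(κ * Real.exp (-(κ * r))) • (b t - b (t - r))‖ ≤
      C * (κ * Real.exp (-(κ * r)) * r ^ H) := by
  have h1 := hb t (t - r)
  rw [sub_sub_cancel, abs_of_pos hr] at h1
  rw [norm_smul, Real.norm_of_nonneg (by positivity)]
  calc _ ≤ κ * Real.exp (-(κ * r)) * (C * r ^ H) := by gcongr
    _ = _ := by ring

lemma IsHolderCurve.integrableOn_ouKernel (hb : IsHolderCurve C H b) (hκ : 0 < κ) (hH : 0 < H)
    (t : ℝ) : IntegrableOn (fun r => (κ * Real.exp (-(κ * r))) • (b t - b (t - r))) (Ioi 0) := by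
  have hc := hb.continuous hH
  refine Integrable.mono' ((integrableOn_exp_mul_rpow hκ hH).const_mul C)
    (Continuous.aestronglyMeasurable (by fun_prop)) ?_
  filter_upwards [ae_restrict_mem measurableSet_Ioi] with r hr
  exact hb.norm_ouKernel_le hκ t hr

/-- Uniform in `t`; the factor `κ ^ (-H)` is the source of the weight `α_k^{-2H}` in the summability
condition. -/
lemma IsHolderCurve.norm_ouFilter_le (hb : IsHolderCurve C H b) (hκ : 0 < κ) (hH : 0 < H)
    (t : ℝ) : ‖ouFilter κ b t‖ ≤ C * (Real.Gamma (H + 1) * κ ^ (-H)) := by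
  rw [ouFilter, ← integral_exp_mul_rpow hκ hH, ← integral_const_mul]
  refine norm_integral_le_of_norm_le ((integrableOn_exp_mul_rpow hκ hH).const_mul C) ?_
  filter_upwards [ae_restrict_mem measurableSet_Ioi] with r hr
  exact hb.norm_ouKernel_le hκ t hr

/-- The kernel is a probability density, and a time change alters `b t - b (t - r)` by two
increments over the same lag `t - s`. The Hölder constant therefore does not depend on `κ`. -/
lemma IsHolderCurve.norm_ouFilter_sub_le (hb : IsHolderCurve C H b) (hκ : 0 < κ) (hH : 0 < H)
    (t s : ℝ) : ‖ouFilter κ b t - ouFilter κ b s‖ ≤ 2 * C * |t - s| ^ H := by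
  rw [ouFilter, ouFilter, ← integral_sub (hb.integrableOn_ouKernel hκ hH t)
    (hb.integrableOn_ouKernel hκ hH s)]
  have : 2 * C * |t - s| ^ H =
      ∫ r in Ioi (0 : ℝ), κ * Real.exp (-(κ * r)) * (2 * C * |t - s| ^ H) := by
    rw [integral_mul_const, integral_exp hκ, one_mul]
  rw [this]
  refine norm_integral_le_of_norm_le ((integrableOn_exp hκ).mul_const _) (ae_of_all _ fun r => ?_)
  rw [← smul_sub, norm_smul, Real.norm_of_nonneg (by positivity)]
  gcongr
  have h1 := hb t s
  have h2 := hb (t - r) (s - r)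
  rw [sub_sub_sub_cancel_right] at h2
  calc _ = ‖(b t - b s) - (b (t - r) - b (s - r))‖ := by congr 1; abel
    _ ≤ _ := (norm_sub_le _ _).trans (by linarith)

lemma IsHolderCurve.continuous_ouFilter (hb : IsHolderCurve C H b) (hκ : 0 < κ) (hH : 0 < H) :
    Continuous (ouFilter κ b) :=
  IsHolderCurve.continuous (C := 2 * C) (fun t s => hb.norm_ouFilter_sub_le hκ hH t s) hH

lemma IsHolderCurve.map_ouFilter {F : Type*} [NormedAddCommGroup F] [NormedSpace ℝ F]
    [CompleteSpace F] (hb : IsHolderCurve C H b) (hκ : 0 < κ) (hH : 0 < H) (L : E →L[ℝ] F)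
    (t : ℝ) : L (ouFilter κ b t) = ouFilter κ (fun s => L (b s)) t := by
  rw [ouFilter, ← L.integral_comp_comm (hb.integrableOn_ouKernel hκ hH t)]
  simp [ouFilter]

/-- The moving average satisfies the Ornstein-Uhlenbeck equation driven by `b`. -/
lemma IsHolderCurve.ouFilter_eq (hb : IsHolderCurve C H b) (hκ : 0 < κ) (hH : 0 < H) {a c : ℝ}
    (hac : a ≤ c) : ouFilter κ b c = Real.exp (-(κ * (c - a))) • ouFilter κ b a + ouIntegral κ b a c := by
  have hc := hb.continuous hH
  have hint : ∀ t, IntegrableOn (fun r => (κ * Real.exp (-(κ * r))) • b (t - r)) (Ioi 0) := by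
    intro t
    have h := (((integrableOn_exp hκ).smul_const (b t))).sub (hb.integrableOn_ouKernel hκ hH t)
    refine h.congr (ae_of_all _ fun r => ?_)
    simp [smul_sub]
  have hY : ∀ t, ouFilter κ b t = b t - ∫ r in Ioi (0 : ℝ), (κ * Real.exp (-(κ * r))) • b (t - r) := by
    intro t
    simp only [ouFilter, smul_sub]
    rw [integral_sub ((integrableOn_exp hκ).smul_const (b t)) (hint t), integral_smul_const,
      integral_exp hκ, one_smul]
  have hker : Continuous fun r => (κ * Real.exp (-(κ * r))) • b (c - r) := by fun_prop
  -- Cut the past of `c` at time `a`: lags below `c - a` give the integral over `[a, c]`, and the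
  -- remaining lags, translated by `c - a`, give the past of `a` damped by `e^{-κ(c-a)}`.
  have hsplit : ∫ r in Ioi (0 : ℝ), (κ * Real.exp (-(κ * r))) • b (c - r) =
      (∫ r in (0 : ℝ)..(c - a), (κ * Real.exp (-(κ * r))) • b (c - r)) +
        ∫ r in Ioi (c - a), (κ * Real.exp (-(κ * r))) • b (c - r) :=
    (intervalIntegral.integral_interval_add_Ioi' (hker.intervalIntegrable _ _) ((hint c).mono_set
      (Ioi_subset_Ioi (sub_nonneg.2 hac)))).symm
  have htail : ∫ r in Ioi (c - a), (κ * Real.exp (-(κ * r))) • b (c - r) =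
      Real.exp (-(κ * (c - a))) • ∫ r in Ioi (0 : ℝ), (κ * Real.exp (-(κ * r))) • b (a - r) := by
    rw [← integral_smul, ← integral_indicator measurableSet_Ioi,
      ← integral_add_right_eq_self _ (c - a), ← integral_indicator measurableSet_Ioi]
    refine integral_congr_ae (ae_of_all _ fun r => ?_)
    by_cases hr : 0 < r
    · have : Real.exp (-(κ * (r + (c - a)))) = Real.exp (-(κ * (c - a))) * Real.exp (-(κ * r)) := by
        rw [← Real.exp_add]; ring_nf
      simp only [indicator, mem_Ioi, lt_add_iff_pos_left, hr, if_true, this, smul_smul]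
      congr 1
      · ring
      · congr 1; ring
    · simp [indicator, hr]
  have hmid : ∫ r in (0 : ℝ)..(c - a), (κ * Real.exp (-(κ * r))) • b (c - r) =
      ∫ s in a..c, (κ * Real.exp (-(κ * (c - s)))) • b s := by
    have := intervalIntegral.integral_comp_sub_left (a := 0) (b := c - a)
      (fun s => (κ * Real.exp (-(κ * (c - s)))) • b s) c
    simpa using this
  rw [hY, hY, hsplit, htail, hmid, ouIntegral, stieltjes]
  simp only [sub_self, mul_zero, neg_zero, Real.exp_zero]
  module

end Curves

end

/-! ### Stability of moving averages: closed subspaces, decay, bilinear forms -/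

section

section CurvesMore

variable {E : Type*} [NormedAddCommGroup E] [NormedSpace ℝ E] [CompleteSpace E]
variable {F : Type*} [NormedAddCommGroup F] [NormedSpace ℝ F] [CompleteSpace F]

/-- The integral of a function with values in a closed subspace belongs to the subspace. -/
lemma integral_mem_of_isClosed {X : Type*} [MeasurableSpace X] {μ : Measure X}
    {S : Submodule ℝ E} (hS : IsClosed (S : Set E)) {f : X → E} (hf : ∀ᵐ x ∂μ, f x ∈ S)
    (hfi : Integrable f μ) : ∫ x, f x ∂μ ∈ S := by
  have : IsClosed (S : Set E) := hS
  -- Since `S` is closed, the quotient is a normed space and the quotient map is continuous, so it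
  -- commutes with the integral and sends it to zero.
  let q : E →L[ℝ] E ⧸ S := S.mkQL
  have h0 : q (∫ x, f x ∂μ) = 0 := by
    rw [← q.integral_comp_comm hfi]
    refine integral_eq_zero_of_ae ?_
    filter_upwards [hf] with x hx
    exact (Submodule.Quotient.mk_eq_zero S).2 hx
  exact (Submodule.Quotient.mk_eq_zero S).1 h0

variable {C H κ : ℝ} {b : ℝ → E}

lemma IsHolderCurve.ouFilter_mem (hb : IsHolderCurve C H b) (hκ : 0 < κ) (hH : 0 < H)
    {S : Submodule ℝ E} (hS : IsClosed (S : Set E)) {t : ℝ} (h : ∀ s ≤ t, b s ∈ S) :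
    ouFilter κ b t ∈ S := by
  refine integral_mem_of_isClosed hS ?_ (hb.integrableOn_ouKernel hκ hH t)
  filter_upwards [ae_restrict_mem measurableSet_Ioi] with r hr
  exact S.smul_mem _ (S.sub_mem (h t le_rfl) (h _ (by linarith [mem_Ioi.1 hr])))

/-- Dominated convergence: the Hölder bound gives a majorant in `r` that is independent of `t`. It
is applied to scalar curves obtained by pairing the noise with a fixed vector. -/
lemma IsHolderCurve.tendsto_ouFilter (hb : IsHolderCurve C H b) (hκ : 0 < κ) (hH : 0 < H)
    (h : ∀ r, Tendsto (fun t => b t - b (t - r)) atTop (𝓝 0)) :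
    Tendsto (ouFilter κ b) atTop (𝓝 0) := by
  have h0 : (0 : E) = ∫ r in Ioi (0 : ℝ), (κ * Real.exp (-(κ * r))) • (0 : E) := by simp
  rw [h0]
  refine tendsto_integral_filter_of_dominated_convergence
    (fun r => C * (κ * Real.exp (-(κ * r)) * r ^ H))
    (Eventually.of_forall fun t => (hb.integrableOn_ouKernel hκ hH t).1)
    (Eventually.of_forall fun t => ?_) ((integrableOn_exp_mul_rpow hκ hH).const_mul C)
    (ae_of_all _ fun r => (h r).const_smul _)
  filter_upwards [ae_restrict_mem measurableSet_Ioi] with r hr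
  exact hb.norm_ouKernel_le hκ t hr

lemma IsHolderCurve.comp_clm (hb : IsHolderCurve C H b) (L : E →L[ℝ] F) :
    IsHolderCurve (‖L‖ * C) H fun t => L (b t) := by
  intro t s
  rw [← map_sub, mul_assoc]
  exact (L.le_opNorm _).trans (mul_le_mul_of_nonneg_left (hb t s) (norm_nonneg _))

/-- If a bilinear form of the increments of two curves is invariant under time shifts, then so is
the bilinear form of the moving averages. -/
lemma IsHolderCurve.bilin_ouFilter_shift {C' κ' : ℝ} {d : ℝ → F} (hb : IsHolderCurve C H b)
    (hd : IsHolderCurve C' H d) (hκ : 0 < κ) (hκ' : 0 < κ') (hH : 0 < H) (B : E →L[ℝ] F →L[ℝ] ℝ)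
    (t s h : ℝ) (hB : ∀ r q, B (b (t + h) - b (t + h - r)) (d (s + h) - d (s + h - q)) =
      B (b t - b (t - r)) (d s - d (s - q))) :
    B (ouFilter κ b (t + h)) (ouFilter κ' d (s + h)) = B (ouFilter κ b t) (ouFilter κ' d s) := by
  -- With one argument frozen, `B` is a continuous linear map and passes under the integral; the two
  -- arguments are unfolded in turn, which avoids a double integral.
  have h1 : ∀ y t, B (ouFilter κ b t) y =
      ∫ r in Ioi (0 : ℝ), (κ * Real.exp (-(κ * r))) • B (b t - b (t - r)) y := by
    intro y t
    rw [← B.flip_apply, hb.map_ouFilter hκ hH (B.flip y) t]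
    simp [ouFilter]
  have h2 : ∀ x s, B x (ouFilter κ' d s) =
      ∫ q in Ioi (0 : ℝ), (κ' * Real.exp (-(κ' * q))) • B x (d s - d (s - q)) := by
    intro x s
    rw [hd.map_ouFilter hκ' hH (B x) s]
    simp [ouFilter]
  rw [h1, h1]
  refine integral_congr_ae (ae_of_all _ fun r => ?_)
  simp only
  rw [h2, h2]
  simp only [hB]

end CurvesMore

/-! ### Jointly measurable versions of curves in `L²` -/

section Modification

variable {Ω : Type*} [MeasurableSpace Ω] {P : Measure Ω}
variable {E : Type*} [NormedAddCommGroup E] [CompleteSpace E]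

/-- The errors have summable `L¹` norms, so their pointwise sum is almost surely finite and its
terms tend to zero. -/
lemma ae_tendsto_of_eLpNorm_one_le_pow {f : ℕ → Ω → E} {g : Ω → E}
    (hf : ∀ n, AEStronglyMeasurable (f n) P) (hg : AEStronglyMeasurable g P)
    (h : ∀ n, eLpNorm (fun ω => f n ω - g ω) 1 P ≤ ENNReal.ofReal ((1 / 2) ^ n)) :
    ∀ᵐ ω ∂P, Tendsto (fun n => f n ω) atTop (𝓝 (g ω)) := by
  have hm : ∀ n, AEMeasurable (fun ω => ‖f n ω - g ω‖ₑ) P := fun n => ((hf n).sub hg).enorm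
  have hsum : ∫⁻ ω, ∑' n, ‖f n ω - g ω‖ₑ ∂P ≠ ∞ := by
    rw [lintegral_tsum hm]
    refine ne_top_of_le_ne_top ?_ (ENNReal.tsum_le_tsum fun n =>
      (eLpNorm_one_eq_lintegral_enorm (μ := P) (f := fun ω => f n ω - g ω)).symm.le.trans (h n))
    exact (summable_geometric_of_lt_one (by norm_num) (by norm_num)).tsum_ofReal_ne_top
  filter_upwards [ae_lt_top' (AEMeasurable.tsum hm) hsum]
    with ω hω
  have := ENNReal.tendsto_atTop_zero_of_tsum_ne_top hω.ne
  rw [tendsto_iff_edist_tendsto_0]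
  simpa only [edist_eq_enorm_sub] using this

/-- A strongly measurable family of `L²` random variables has a jointly measurable version. -/
lemma exists_jointly_measurable_version [IsProbabilityMeasure P] {x : ℝ → Lp E 2 P}
    (hx : StronglyMeasurable x) :
    ∃ Ψ : ℝ → Ω → E, StronglyMeasurable (Function.uncurry Ψ) ∧ ∀ t, Ψ t =ᵐ[P] x t := by
  have happrox : ∀ n : ℕ, ∃ Φ : ℝ → Ω → E, StronglyMeasurable (Function.uncurry Φ) ∧
      ∀ t, eLpNorm (fun ω => Φ t ω - x t ω) 1 P ≤ ENNReal.ofReal ((1 / 2) ^ n) := by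
    intro n
    obtain ⟨D, hDc, hD⟩ := hx.isSeparable_range
    have hDne : D.Nonempty := by
      by_contra hne
      rw [not_nonempty_iff_eq_empty] at hne
      simpa [hne] using hD (mem_range_self (0 : ℝ))
    obtain ⟨u, rfl⟩ := hDc.exists_eq_range hDne
    have hex : ∀ t, ∃ j, dist (x t) (u j) < (1 / 2) ^ n := by
      intro t
      obtain ⟨y, ⟨j, rfl⟩, hj⟩ := Metric.mem_closure_iff.1 (hD (mem_range_self t)) ((1 / 2) ^ n)
        (by positivity)
      exact ⟨j, hj⟩
    classical
    -- Choosing the first member of a countable dense set within `2^{-n}` of `x t` makes the choice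
    -- measurable in `t`. The approximant then takes countably many values in `L²`, which is what
    -- makes it jointly measurable.
    have hN : Measurable fun t => Nat.find (hex t) := by
      refine measurable_find hex fun j => ?_
      exact (hx.dist stronglyMeasurable_const).measurable measurableSet_Iio
    refine ⟨fun t ω => u (Nat.find (hex t)) ω, ?_, fun t => ?_⟩
    · have hu : StronglyMeasurable fun p : ℕ × Ω => u p.1 p.2 := by
        borelize E
        rw [stronglyMeasurable_iff_measurable_separable]
        refine ⟨measurable_from_prod_countable_right fun j => (Lp.stronglyMeasurable (u j)).measurable,
          ?_⟩
        refine (TopologicalSpace.IsSeparable.iUnion fun j =>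
          (Lp.stronglyMeasurable (u j)).isSeparable_range).mono ?_
        rintro _ ⟨p, rfl⟩
        exact mem_iUnion.2 ⟨p.1, mem_range_self p.2⟩
      exact hu.comp_measurable ((hN.comp measurable_fst).prodMk measurable_snd)
    · refine (eLpNorm_le_eLpNorm_of_exponent_le (by norm_num : (1 : ℝ≥0∞) ≤ 2)
        ((Lp.aestronglyMeasurable _).sub (Lp.aestronglyMeasurable _))).trans ?_
      have h1 := (Nat.find_spec (hex t)).le
      rw [dist_comm, dist_eq_norm, Lp.norm_def] at h1
      rw [← eLpNorm_congr_ae (Lp.coeFn_sub _ _)]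
      exact (ENNReal.le_ofReal_iff_toReal_le (Lp.eLpNorm_ne_top _) (by positivity)).2 h1
  choose Φ hΦ hΦx using happrox
  -- `limUnder` has a value even where the sequence diverges, so joint measurability holds
  -- everywhere, while identification with `x t` is needed only almost surely for each fixed `t`.
  refine ⟨fun t ω => limUnder atTop fun n => Φ n t ω, StronglyMeasurable.limUnder (l := atTop) hΦ, fun t => ?_⟩
  filter_upwards [ae_tendsto_of_eLpNorm_one_le_pow (fun n => ((hΦ n).comp_measurable
    measurable_prodMk_left).aestronglyMeasurable) (Lp.aestronglyMeasurable (x t))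
    fun n => hΦx n t] with ω hω
  exact hω.limUnder_eq

end Modification

end

section

/-! ### The pointwise ergodic theorem with constant limit -/

section Birkhoff

variable {X : Type*} [MeasurableSpace X] {μ : Measure X} {T : X → X}

/-- The maximum of `0` and the first `n` Birkhoff sums of `g`. -/
def maxBirkhoffSum (T : X → X) (g : X → ℝ) : ℕ → X → ℝ
  | 0 => fun _ => 0
  | n + 1 => fun x => max 0 (g x + maxBirkhoffSum T g n (T x))

lemma maxBirkhoffSum_nonneg (g : X → ℝ) (n : ℕ) (x : X) : 0 ≤ maxBirkhoffSum T g n x := by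
  cases n with
  | zero => exact le_rfl
  | succ n => exact le_max_left _ _

lemma maxBirkhoffSum_le_succ (g : X → ℝ) (n : ℕ) (x : X) :
    maxBirkhoffSum T g n x ≤ maxBirkhoffSum T g (n + 1) x := by
  induction n generalizing x with
  | zero => exact le_max_left _ _
  | succ n ih => exact max_le_max le_rfl (add_le_add le_rfl (ih (T x)))

lemma birkhoffSum_le_maxBirkhoffSum (g : X → ℝ) {k n : ℕ} (hkn : k ≤ n) (x : X) :
    birkhoffSum T g k x ≤ maxBirkhoffSum T g n x := by
  induction n generalizing k x with
  | zero => simp [Nat.le_zero.1 hkn, maxBirkhoffSum]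
  | succ n ih =>
    cases k with
    | zero => simpa using maxBirkhoffSum_nonneg g (n + 1) x
    | succ k =>
      rw [birkhoffSum_succ']
      exact (add_le_add le_rfl (ih (Nat.le_of_succ_le_succ hkn) (T x))).trans (le_max_right _ _)

lemma integrable_maxBirkhoffSum (hT : MeasurePreserving T μ μ) {g : X → ℝ} (hg : Integrable g μ)
    (n : ℕ) : Integrable (maxBirkhoffSum T g n) μ := by
  induction n with
  | zero => exact integrable_zero _ _ _
  | succ n ih =>
    exact (integrable_zero _ _ _).sup (hg.add ((hT.integrable_comp ih.1).2 ih))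

lemma measurable_maxBirkhoffSum (hT : Measurable T) {g : X → ℝ} (hg : Measurable g) (n : ℕ) :
    Measurable (maxBirkhoffSum T g n) := by
  induction n with
  | zero => exact measurable_const
  | succ n ih => exact measurable_const.max (hg.add (ih.comp hT))

/-- The maximal ergodic theorem. -/
lemma setIntegral_maxBirkhoffSum_nonneg (hT : MeasurePreserving T μ μ) {g : X → ℝ}
    (hgm : Measurable g) (hg : Integrable g μ) (n : ℕ) :
    0 ≤ ∫ x in {x | 0 < maxBirkhoffSum T g n x}, g x ∂μ := by
  cases n with
  | zero => simp [maxBirkhoffSum]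
  | succ n =>
    set A : Set X := {x | 0 < maxBirkhoffSum T g (n + 1) x} with hA
    have hAm : MeasurableSet A :=
      measurableSet_lt measurable_const (measurable_maxBirkhoffSum hT.measurable hgm (n + 1))
    have hM := integrable_maxBirkhoffSum hT hg (n + 1)
    have hMn := integrable_maxBirkhoffSum hT hg n
    have hMT : Integrable (fun x => maxBirkhoffSum T g n (T x)) μ :=
      (hT.integrable_comp hMn.1).2 hMn
    -- Garsia's argument: where the new maximum is positive it equals `g` plus the old maximum along
    -- the shifted orbit. Integrating, invariance of `μ` and monotonicity in `n` give the sign.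
    have h1 : ∫ x in A, g x ∂μ =
        ∫ x in A, maxBirkhoffSum T g (n + 1) x ∂μ - ∫ x in A, maxBirkhoffSum T g n (T x) ∂μ := by
      rw [← integral_sub hM.integrableOn hMT.integrableOn]
      refine setIntegral_congr_fun hAm fun x hx => ?_
      have hx' : 0 < maxBirkhoffSum T g (n + 1) x := hx
      simp only [maxBirkhoffSum, lt_max_iff, lt_irrefl, false_or] at hx' ⊢
      rw [max_eq_right hx'.le]
      ring
    have h2 : ∫ x in A, maxBirkhoffSum T g (n + 1) x ∂μ = ∫ x, maxBirkhoffSum T g (n + 1) x ∂μ := by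
      refine setIntegral_eq_integral_of_forall_compl_eq_zero fun x hx => ?_
      exact le_antisymm (not_lt.1 hx) (maxBirkhoffSum_nonneg g _ x)
    have h3 : ∫ x in A, maxBirkhoffSum T g n (T x) ∂μ ≤ ∫ x, maxBirkhoffSum T g n x ∂μ := by
      refine (setIntegral_le_integral hMT
        (ae_of_all _ fun x => maxBirkhoffSum_nonneg g n (T x))).trans (le_of_eq ?_)
      rw [← integral_map hT.aemeasurable (by rw [hT.map_eq]; exact hMn.1), hT.map_eq]
    have h4 := integral_mono hMn hM (maxBirkhoffSum_le_succ (T := T) g n)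
    linarith

/-- The weak type maximal inequality. -/
lemma measure_exists_birkhoffSum_gt_le [IsFiniteMeasure μ] (hT : MeasurePreserving T μ μ)
    {g : X → ℝ} (hgm : Measurable g) (hg : Integrable g μ) {a : ℝ} (ha : 0 < a) :
    μ {x | ∃ k, a * k < birkhoffSum T g k x} ≤ ENNReal.ofReal ((∫ x, |g x| ∂μ) / a) := by
  -- Subtracting the level turns `a k < S_k g` into positivity of a Birkhoff sum of `h`.
  set h : X → ℝ := fun x => g x - a with hh
  have hhm : Measurable h := hgm.sub measurable_const
  have hhi : Integrable h μ := hg.sub (integrable_const a)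
  have hsub : {x | ∃ k, a * k < birkhoffSum T g k x} ⊆ ⋃ n, {x | 0 < maxBirkhoffSum T h n x} := by
    rintro x ⟨k, hk⟩
    refine mem_iUnion.2 ⟨k, lt_of_lt_of_le ?_ (birkhoffSum_le_maxBirkhoffSum h le_rfl x)⟩
    have : birkhoffSum T h k x = birkhoffSum T g k x - a * k := by
      simp [birkhoffSum, hh, mul_comm]
    rw [this]
    linarith
  have hmono : Monotone fun n => {x | 0 < maxBirkhoffSum T h n x} :=
    monotone_nat_of_le_succ fun n x hx => lt_of_lt_of_le hx (maxBirkhoffSum_le_succ h n x)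
  refine (measure_mono hsub).trans ?_
  rw [hmono.measure_iUnion]
  refine iSup_le fun n => ?_
  set A : Set X := {x | 0 < maxBirkhoffSum T h n x}
  have h1 := setIntegral_maxBirkhoffSum_nonneg hT hhm hhi n
  rw [integral_sub hg.integrableOn (integrable_const a).integrableOn, setIntegral_const,
    smul_eq_mul] at h1
  have h2 : ∫ x in A, g x ∂μ ≤ ∫ x, |g x| ∂μ :=
    (integral_mono hg.integrableOn hg.abs.integrableOn fun x => le_abs_self (g x)).trans
      (setIntegral_le_integral hg.abs (ae_of_all _ fun x => abs_nonneg _))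
  rw [← ofReal_measureReal (μ := μ) (s := A)]
  refine ENNReal.ofReal_le_ofReal ?_
  rw [le_div_iff₀ ha]
  linarith

/-- An integrable function grows sublinearly along almost every orbit. -/
lemma ae_tendsto_inv_mul_iterate [IsProbabilityMeasure μ] (hT : MeasurePreserving T μ μ)
    {f : X → ℝ} (hfm : Measurable f) (hf : Integrable f μ) :
    ∀ᵐ x ∂μ, Tendsto (fun n : ℕ => (n : ℝ)⁻¹ * f (T^[n] x)) atTop (𝓝 0) := by
  have key : ∀ m : ℕ, ∀ᵐ x ∂μ, ∀ᶠ n : ℕ in atTop, (m + 1) * |f (T^[n] x)| ≤ n := by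
    intro m
    -- Borel-Cantelli: the tail probabilities of an integrable variable are summable, and invariance
    -- lets the `j`-th event be evaluated at `T^[j] x`.
    have h1 : ∑' j : ℕ, μ {x | (m + 1) * |f x| ∈ Ioi (j : ℝ)} < ∞ :=
      @tsum_prob_mem_Ioi_lt_top X ⟨μ⟩ ‹_› _ (hf.abs.const_mul _) (fun x => by positivity)
    have h2 : ∀ j : ℕ, μ {x | (m + 1) * |f x| ∈ Ioi (j : ℝ)} =
        μ {x | (m + 1) * |f (T^[j] x)| ∈ Ioi (j : ℝ)} := by
      intro j
      have hm : MeasurableSet {x | (m + 1) * |f x| ∈ Ioi (j : ℝ)} :=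
        measurableSet_lt measurable_const (measurable_const.mul hfm.abs)
      rw [← (hT.iterate j).measure_preimage hm.nullMeasurableSet]
      rfl
    simp_rw [h2] at h1
    filter_upwards [ae_eventually_notMem h1.ne] with x hx
    filter_upwards [hx] with n hn
    simpa using hn
  filter_upwards [ae_all_iff.2 key] with x hx
  rw [Metric.tendsto_atTop]
  intro ε hε
  obtain ⟨m, hm⟩ := exists_nat_gt (1 / ε)
  obtain ⟨N, hN⟩ := eventually_atTop.1 (hx m)
  refine ⟨N + 1, fun n hn => ?_⟩
  have hn0 : (0 : ℝ) < n := by exact_mod_cast (by omega : 0 < n)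
  have h1 := hN n (by omega)
  rw [dist_zero_right, Real.norm_eq_abs, abs_mul, abs_of_pos (inv_pos.2 hn0), inv_mul_lt_iff₀ hn0]
  have hm' : 1 < m * ε := by rwa [div_lt_iff₀ hε] at hm
  have : 0 ≤ |f (T^[n] x)| := abs_nonneg _
  by_contra hcon
  push Not at hcon
  nlinarith

/-- One application of `T` changes the average only by the boundary terms `(f (T^n x) - f x) / n`,
which vanish by sublinear growth along orbits. -/
lemma ae_tendsto_birkhoffAverage_sub [IsProbabilityMeasure μ] (hT : MeasurePreserving T μ μ)
    {f : X → ℝ} (hfm : Measurable f) (hf : Integrable f μ) :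
    ∀ᵐ x ∂μ, ∀ i : ℕ, Tendsto (fun n : ℕ => birkhoffAverage ℝ T f n (T^[i] x) -
      birkhoffAverage ℝ T f n x) atTop (𝓝 0) := by
  have h0 : ∀ i : ℕ, ∀ᵐ x ∂μ, Tendsto (fun n : ℕ => (n : ℝ)⁻¹ * f (T^[n] (T^[i] x))) atTop (𝓝 0) :=
    fun i => (hT.iterate i).quasiMeasurePreserving.ae (ae_tendsto_inv_mul_iterate hT hfm hf)
  filter_upwards [ae_all_iff.2 h0] with x hx i
  induction i with
  | zero => simp
  | succ i ih =>
    have h1 : Tendsto (fun n : ℕ => (n : ℝ)⁻¹ • (f (T^[n] (T^[i] x)) - f (T^[i] x))) atTop (𝓝 0) := by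
      have := (hx i).sub ((tendsto_inv_atTop_nhds_zero_nat (𝕜 := ℝ)).mul_const (f (T^[i] x)))
      simpa [mul_sub] using this
    have := h1.add ih
    rw [zero_add] at this
    refine this.congr fun n => ?_
    rw [Function.iterate_succ_apply', ← birkhoffAverage_apply_sub_birkhoffAverage]
    ring

/-- If the Birkhoff averages converge in mean to a constant, they converge almost surely. -/
theorem ae_tendsto_birkhoffAverage [IsProbabilityMeasure μ] (hT : MeasurePreserving T μ μ)
    {f : X → ℝ} (hfm : Measurable f) (hf : Integrable f μ) {m : ℝ}
    (hmean : Tendsto (fun n => ∫ x, |birkhoffAverage ℝ T f n x - m| ∂μ) atTop (𝓝 0)) :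
    ∀ᵐ x ∂μ, Tendsto (fun n => birkhoffAverage ℝ T f n x) atTop (𝓝 m) := by
  have hfi : ∀ i, Integrable (fun x => f (T^[i] x)) μ := fun i =>
    ((hT.iterate i).integrable_comp hf.1).2 hf
  have key : ∀ a : ℝ, 0 < a → ∀ᵐ x ∂μ, ∀ᶠ n in atTop, |birkhoffAverage ℝ T f n x - m| ≤ 2 * a := by
    intro a ha
    -- The exceptional set does not depend on `δ`, so a bound `δ / a` for every `δ` makes it null.
    -- Here `δ` bounds the `L¹` distance of one long average of length `M` from `m`.
    have hsmall : ∀ δ : ℝ, 0 < δ →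
        μ {x | ¬ ∀ᶠ n in atTop, |birkhoffAverage ℝ T f n x - m| ≤ 2 * a} ≤
          ENNReal.ofReal (δ / a) := by
      intro δ hδ
      obtain ⟨M, hM, hM1⟩ := ((hmean.eventually (gt_mem_nhds hδ)).and (eventually_ge_atTop 1)).exists
      set g : X → ℝ := fun x => birkhoffAverage ℝ T f M x - m with hg
      have hgm : Measurable g := by
        refine Measurable.sub_const ?_ m
        exact (Finset.measurable_fun_sum _ fun i _ =>
          hfm.comp (hT.iterate i).measurable).const_smul (M : ℝ)⁻¹
      have hgi : Integrable g μ := by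
        refine Integrable.sub ?_ (integrable_const m)
        exact (integrable_finsetSum _ fun i _ => hfi i).smul (M : ℝ)⁻¹
      have hmax := measure_exists_birkhoffSum_gt_le hT hgm.abs hgi.abs ha
      simp only [abs_abs] at hmax
      refine (measure_mono_ae ?_).trans (hmax.trans
        (ENNReal.ofReal_le_ofReal (div_le_div_of_nonneg_right hM.le ha.le)))
      filter_upwards [ae_tendsto_birkhoffAverage_sub hT hfm hf] with x hx hbad
      by_contra hgood
      have hgood' : ∀ k : ℕ, birkhoffSum T (fun x => |g x|) k x ≤ a * k := fun k => by
        by_contra h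
        exact hgood ⟨k, not_le.1 h⟩
      refine hbad ?_
      -- Averaging the `M`-step average `g` along the orbit reproduces the `n`-average of `f`, up to
      -- the shifts by `i < M`, which are asymptotically negligible. The maximal inequality
      -- contributes one `a` and the shifts another, whence `2 * a`. The case `n = 0` is set apart
      -- because the average is then zero by convention.
      have hblock : ∀ n : ℕ, birkhoffAverage ℝ T f n x - m =
          birkhoffAverage ℝ T g n x - (M : ℝ)⁻¹ * ∑ i ∈ Finset.range M,
            (birkhoffAverage ℝ T f n (T^[i] x) - birkhoffAverage ℝ T f n x) ∨ n = 0 := by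
        intro n
        rcases Nat.eq_zero_or_pos n with hn | hn
        · exact Or.inr hn
        refine Or.inl ?_
        have hn0 : (n : ℝ) ≠ 0 := by positivity
        have hM0 : (M : ℝ) ≠ 0 := by positivity
        have h1 : birkhoffAverage ℝ T g n x =
            (M : ℝ)⁻¹ * (∑ i ∈ Finset.range M, birkhoffAverage ℝ T f n (T^[i] x)) - m := by
          simp only [hg, birkhoffAverage, birkhoffSum, smul_eq_mul, Finset.sum_sub_distrib,
            Finset.sum_const, Finset.card_range, nsmul_eq_mul, ← Finset.mul_sum, mul_sub]
          rw [inv_mul_cancel_left₀ hn0, Finset.sum_comm]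
          simp only [← Function.iterate_add_apply, add_comm]
          ring
        rw [h1, Finset.sum_sub_distrib, Finset.sum_const, Finset.card_range, nsmul_eq_mul, mul_sub,
          inv_mul_cancel_left₀ hM0]
        ring
      have hlim : Tendsto (fun n => (M : ℝ)⁻¹ * ∑ i ∈ Finset.range M,
            (birkhoffAverage ℝ T f n (T^[i] x) - birkhoffAverage ℝ T f n x)) atTop (𝓝 0) := by
        have := (tendsto_finsetSum (Finset.range M) fun i _ => hx i).const_mul (M : ℝ)⁻¹
        simpa using this
      have hlim' := (Metric.tendsto_atTop.1 hlim a ha)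
      obtain ⟨N, hN⟩ := hlim'
      filter_upwards [eventually_ge_atTop (N + 1)] with n hn
      have hn0 : (0 : ℝ) < n := by exact_mod_cast (by omega : 0 < n)
      have h1 := hN n (by omega)
      rw [dist_zero_right, Real.norm_eq_abs] at h1
      have h2 : |birkhoffAverage ℝ T g n x| ≤ a := by
        rw [birkhoffAverage, smul_eq_mul, abs_mul, abs_of_pos (inv_pos.2 hn0),
          inv_mul_le_iff₀ hn0, mul_comm]
        exact (Finset.abs_sum_le_sum_abs _ _).trans (hgood' n)
      rcases hblock n with h | h
      · rw [h]
        refine (abs_sub _ _).trans ?_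
        linarith
      · omega
    have hz : μ {x | ¬ ∀ᶠ n in atTop, |birkhoffAverage ℝ T f n x - m| ≤ 2 * a} ≤ 0 := by
      refine ge_of_tendsto (x := 𝓝[>] (0 : ℝ)) (f := fun δ => ENNReal.ofReal (δ / a)) ?_ ?_
      · have : Tendsto (fun δ : ℝ => ENNReal.ofReal (δ / a)) (𝓝 0) (𝓝 (ENNReal.ofReal (0 / a))) :=
          (ENNReal.continuous_ofReal.comp (continuous_id.div_const a)).tendsto 0
        simp only [zero_div, ENNReal.ofReal_zero] at this
        exact this.mono_left nhdsWithin_le_nhds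
      · filter_upwards [self_mem_nhdsWithin] with δ hδ using hsmall δ hδ
    exact le_antisymm hz bot_le
  have hall : ∀ᵐ x ∂μ, ∀ j : ℕ, ∀ᶠ n in atTop,
      |birkhoffAverage ℝ T f n x - m| ≤ 2 * (1 / ((j : ℝ) + 1)) :=
    ae_all_iff.2 fun j => key _ (by positivity)
  filter_upwards [hall] with x hx
  rw [Metric.tendsto_atTop]
  intro ε hε
  obtain ⟨j, hj⟩ := exists_nat_one_div_lt (half_pos hε)
  obtain ⟨N, hN⟩ := eventually_atTop.1 (hx j)
  refine ⟨N, fun n hn => ?_⟩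
  rw [Real.dist_eq]
  linarith [hN n hn]

end Birkhoff

end

/-! ### Approximation on dense sets and trigonometric functions -/

section

/-- For a bounded family of continuous linear maps, the points at which the family tends to zero
form a closed subspace. -/
def tendstoZeroSubmodule {𝕜 E F ι : Type*} [NontriviallyNormedField 𝕜] [NormedAddCommGroup E]
    [NormedSpace 𝕜 E] [NormedAddCommGroup F] [NormedSpace 𝕜 F] (R : ι → E →L[𝕜] F)
    (l : Filter ι) : Submodule 𝕜 E where
  carrier := {x | Tendsto (fun i => R i x) l (𝓝 0)}
  add_mem' {x y} hx hy := by
    have := Tendsto.add hx hy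
    simpa using this
  zero_mem' := by simp [tendsto_const_nhds]
  smul_mem' c x hx := by
    have := Tendsto.const_smul hx c
    simpa using this

lemma mem_tendstoZeroSubmodule {𝕜 E F ι : Type*} [NontriviallyNormedField 𝕜]
    [NormedAddCommGroup E] [NormedSpace 𝕜 E] [NormedAddCommGroup F] [NormedSpace 𝕜 F]
    {R : ι → E →L[𝕜] F} {l : Filter ι} {x : E} :
    x ∈ tendstoZeroSubmodule R l ↔ Tendsto (fun i => R i x) l (𝓝 0) := Iff.rfl

/-- The usual `ε/2` argument with a uniform operator bound. It reduces each later limit theorem to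
its verification on a set with dense span. -/
lemma isClosed_tendstoZeroSubmodule {𝕜 E F ι : Type*} [NontriviallyNormedField 𝕜]
    [NormedAddCommGroup E] [NormedSpace 𝕜 E] [NormedAddCommGroup F] [NormedSpace 𝕜 F]
    {R : ι → E →L[𝕜] F} {l : Filter ι} {C : ℝ} (hR : ∀ i, ‖R i‖ ≤ C) :
    IsClosed (tendstoZeroSubmodule R l : Set E) := by
  refine isClosed_of_closure_subset fun x hx => ?_
  change Tendsto (fun i => R i x) l (𝓝 0)
  rw [Metric.tendsto_nhds]
  intro ε hε
  have hC : 0 < |C| + 1 := by positivity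
  obtain ⟨y, hy, hxy⟩ := Metric.mem_closure_iff.1 hx (ε / 2 / (|C| + 1)) (by positivity)
  have hy' : Tendsto (fun i => R i y) l (𝓝 0) := hy
  filter_upwards [Metric.tendsto_nhds.1 hy' (ε / 2) (half_pos hε)] with i hi
  rw [dist_zero_right] at hi ⊢
  rw [dist_eq_norm] at hxy
  have h1 : ‖R i (x - y)‖ ≤ (|C| + 1) * ‖x - y‖ :=
    (R i).le_of_opNorm_le (((hR i).trans (le_abs_self C)).trans (by linarith)) _
  have h2 : (|C| + 1) * ‖x - y‖ < ε / 2 := by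
    rw [lt_div_iff₀ hC] at hxy
    linarith
  calc ‖R i x‖ = ‖R i (x - y) + R i y‖ := by rw [← map_add, sub_add_cancel]
    _ ≤ ‖R i (x - y)‖ + ‖R i y‖ := norm_add_le _ _
    _ < ε := by linarith

/-! ### Density of trigonometric functions -/

section Density

variable {W : Type*} [NormedAddCommGroup W] [NormedSpace ℝ W] [CompleteSpace W]
  [SecondCountableTopology W] [MeasurableSpace W] [BorelSpace W]

/-- The trigonometric function `x ↦ exp (i L x)`. -/
def trig (L : StrongDual ℝ W) (x : W) : ℂ := Complex.exp (L x * Complex.I)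

lemma norm_trig (L : StrongDual ℝ W) (x : W) : ‖trig L x‖ = 1 := Complex.norm_exp_ofReal_mul_I _

lemma continuous_trig (L : StrongDual ℝ W) : Continuous (trig L) := by
  unfold trig; fun_prop

lemma norm_trig_sub_le (L : StrongDual ℝ W) (x y : W) :
    ‖trig L x - trig L y‖ ≤ |L x - L y| := by
  have h : trig L x - trig L y = trig L y * (Complex.exp (Complex.I * (L x - L y : ℝ)) - 1) := by
    rw [trig, trig, mul_sub, ← Complex.exp_add, mul_one]
    congr 2
    push_cast
    ring
  rw [h, norm_mul, norm_trig, one_mul]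
  exact Real.norm_exp_I_mul_ofReal_sub_one_le

lemma conj_trig (L : StrongDual ℝ W) (x : W) : (starRingEnd ℂ) (trig L x) = trig (-L) x := by
  rw [trig, trig, ← Complex.exp_conj]
  simp

variable (μ : Measure W) [IsFiniteMeasure μ]

lemma memLp_trig (L : StrongDual ℝ W) (p : ℝ≥0∞) : MemLp (trig L) p μ :=
  MemLp.of_bound (continuous_trig L).aestronglyMeasurable 1 (ae_of_all _ fun x => (norm_trig L x).le)

variable {μ}

/-- The positive and negative parts of `h` are densities of two finite measures with the same
characteristic functional; hence the measures, and so the densities, agree. -/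
lemma ae_eq_zero_of_integral_trig_real {h : W → ℝ} (hh : Integrable h μ)
    (h0 : ∀ L : StrongDual ℝ W, ∫ x, trig L x * h x ∂μ = 0) : h =ᵐ[μ] 0 := by
  have hm := hh.1.aemeasurable
  have hm' : AEMeasurable (fun x => -h x) μ := hm.neg
  have hfin : ∀ g : W → ℝ, Integrable g μ →
      IsFiniteMeasure (μ.withDensity fun x => ENNReal.ofReal (g x)) := fun g hg =>
    isFiniteMeasure_withDensity_ofReal hg.2
  have hh' : Integrable (fun x => -h x) μ := hh.neg
  have := hfin h hh
  have := hfin (fun x => -h x) hh'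
  have hpos : ∀ g : W → ℝ, AEMeasurable g μ → ∀ L : StrongDual ℝ W,
      charFunDual (μ.withDensity fun x => ENNReal.ofReal (g x)) L =
        ∫ x, trig L x * (max (g x) 0 : ℝ) ∂μ := by
    intro g hg L
    rw [charFunDual_apply, integral_withDensity_eq_integral_toReal_smul₀ hg.ennreal_ofReal
      (ae_of_all _ fun x => ENNReal.ofReal_lt_top)]
    refine integral_congr_ae (ae_of_all _ fun x => ?_)
    simp only [ENNReal.toReal_ofReal', Complex.real_smul, trig]
    ring
  have hint : ∀ g : W → ℝ, Integrable g μ → ∀ L : StrongDual ℝ W,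
      Integrable (fun x => trig L x * (max (g x) 0 : ℝ)) μ := by
    intro g hg L
    refine Integrable.bdd_mul (c := 1) ?_ (continuous_trig L).aestronglyMeasurable
      (ae_of_all _ fun x => (norm_trig L x).le)
    exact (hg.pos_part).ofReal
  have heq : (μ.withDensity fun x => ENNReal.ofReal (h x)) =
      μ.withDensity fun x => ENNReal.ofReal (-h x) := by
    refine Measure.ext_of_charFunDual (funext fun L => ?_)
    rw [hpos h hm L, hpos _ hm' L, ← sub_eq_zero, ← integral_sub (hint h hh L)
      (hint _ hh' L), ← h0 L]
    refine integral_congr_ae (ae_of_all _ fun x => ?_)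
    simp only [← mul_sub, ← Complex.ofReal_sub]
    congr 2
    rcases le_total 0 (h x) with hx | hx
    · rw [max_eq_left hx, max_eq_right (neg_nonpos.2 hx), sub_zero]
    · rw [max_eq_right hx, max_eq_left (neg_nonneg.2 hx)]; ring
  rw [withDensity_eq_iff_of_sigmaFinite hm.ennreal_ofReal hm'.ennreal_ofReal] at heq
  filter_upwards [heq] with x hx
  rcases le_total 0 (h x) with h1 | h1
  · rw [ENNReal.ofReal_of_nonpos (neg_nonpos.2 h1)] at hx
    exact le_antisymm (ENNReal.ofReal_eq_zero.1 hx) h1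
  · rw [ENNReal.ofReal_of_nonpos h1] at hx
    have := ENNReal.ofReal_eq_zero.1 hx.symm
    exact le_antisymm h1 (by simpa using this)

lemma ae_eq_zero_of_integral_trig {g : W → ℂ} (hg : Integrable g μ)
    (h0 : ∀ L : StrongDual ℝ W, ∫ x, trig L x * g x ∂μ = 0) : g =ᵐ[μ] 0 := by
  -- Conjugation exchanges `L` and `-L`, so the conjugate of `g` satisfies the same hypothesis and
  -- the real and imaginary parts can be treated separately.
  have h1 : ∀ L : StrongDual ℝ W, ∫ x, trig L x * (starRingEnd ℂ) (g x) ∂μ = 0 := by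
    intro L
    have := congrArg (starRingEnd ℂ) (h0 (-L))
    rw [← integral_conj, map_zero] at this
    rw [← this]
    refine integral_congr_ae (ae_of_all _ fun x => ?_)
    simp only [map_mul, conj_trig, neg_neg]
  have hI : ∀ (f : W → ℂ), Integrable f μ → ∀ L : StrongDual ℝ W,
      Integrable (fun x => trig L x * f x) μ := fun f hf L =>
    hf.bdd_mul (c := 1) (continuous_trig L).aestronglyMeasurable
      (ae_of_all _ fun x => (norm_trig L x).le)
  have hgc : Integrable (fun x => (starRingEnd ℂ) (g x)) μ := by
    simpa using (Complex.conjCLE.toContinuousLinearMap.integrable_comp hg)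
  have hre := ae_eq_zero_of_integral_trig_real (μ := μ) hg.re fun L => by
    have : ∀ x, trig L x * ((RCLike.re (g x) : ℝ) : ℂ) =
        (1 / 2) * (trig L x * g x + trig L x * (starRingEnd ℂ) (g x)) := by
      intro x
      rw [← mul_add, Complex.add_conj]
      simp only [RCLike.re_eq_complex_re]
      push_cast
      ring
    simp_rw [this]
    rw [integral_const_mul, integral_add (hI g hg L) (hI _ hgc L), h0, h1]
    simp
  have him := ae_eq_zero_of_integral_trig_real (μ := μ) hg.im fun L => by
    have : ∀ x, trig L x * ((RCLike.im (g x) : ℝ) : ℂ) =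
        (-Complex.I / 2) * (trig L x * g x - trig L x * (starRingEnd ℂ) (g x)) := by
      intro x
      rw [← mul_sub, Complex.sub_conj]
      simp only [RCLike.im_eq_complex_im]
      push_cast
      linear_combination (trig L x * (g x).im) * Complex.I_mul_I
    simp_rw [this]
    rw [integral_const_mul, integral_sub (hI g hg L) (hI _ hgc L), h0, h1]
    simp
  filter_upwards [hre, him] with x hx hy
  exact Complex.ext hx hy

/-- A closed subspace of `L²` containing the trigonometric functions is everything. -/
lemma trig_dense_L2 {S : Submodule ℂ (Lp ℂ 2 μ)} (hS : IsClosed (S : Set (Lp ℂ 2 μ)))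
    (h : ∀ L, (memLp_trig μ L 2).toLp ∈ S) : S = ⊤ := by
  rw [← hS.submodule_topologicalClosure_eq, Submodule.topologicalClosure_eq_top_iff,
    Submodule.eq_bot_iff]
  intro g hg
  rw [Lp.eq_zero_iff_ae_eq_zero]
  refine ae_eq_zero_of_integral_trig ((Lp.memLp g).integrable (by norm_num)) fun L => ?_
  have := (Submodule.mem_orthogonal S g).1 hg _ (h (-L))
  rw [L2.inner_def] at this
  rw [← this]
  refine integral_congr_ae ?_
  filter_upwards [(memLp_trig μ (-L) 2).coeFn_toLp] with x hx
  rw [hx, RCLike.inner_apply, conj_trig, neg_neg, mul_comm]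

/-- A closed subspace of `L¹` containing the trigonometric functions is everything. -/
lemma trig_dense_L1 {S : Submodule ℂ (Lp ℂ 1 μ)} (hS : IsClosed (S : Set (Lp ℂ 1 μ)))
    (h : ∀ L, (memLp_trig μ L 1).toLp ∈ S) : S = ⊤ := by
  have hmem : ∀ f : Lp ℂ 2 μ, MemLp f 1 μ := fun f => (Lp.memLp f).mono_exponent (by norm_num)
  let J₀ : Lp ℂ 2 μ →ₗ[ℂ] Lp ℂ 1 μ :=
    { toFun := fun f => (hmem f).toLp
      map_add' := fun f g => by
        rw [← MemLp.toLp_add]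
        exact MemLp.toLp_congr _ _ (Lp.coeFn_add f g)
      map_smul' := fun c f => by
        rw [RingHom.id_apply, ← MemLp.toLp_const_smul]
        exact MemLp.toLp_congr _ _ (Lp.coeFn_smul c f) }
  have hJ : Continuous J₀ := by
    set D : ℝ≥0∞ := μ Set.univ ^ (1 / (1 : ℝ≥0∞).toReal - 1 / (2 : ℝ≥0∞).toReal) with hD
    have hDtop : D ≠ ∞ := ENNReal.rpow_ne_top_of_nonneg (by norm_num) (measure_ne_top _ _)
    refine AddMonoidHomClass.continuous_of_bound J₀ D.toReal fun f => ?_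
    rw [Lp.norm_def, Lp.norm_def, mul_comm, ← ENNReal.toReal_mul]
    refine ENNReal.toReal_mono (ENNReal.mul_ne_top (Lp.eLpNorm_ne_top f) hDtop) ?_
    rw [show J₀ f = (hmem f).toLp from rfl, eLpNorm_congr_ae (hmem f).coeFn_toLp]
    exact eLpNorm_le_eLpNorm_mul_rpow_measure_univ (by norm_num) (Lp.aestronglyMeasurable f)
  -- On a finite measure space `L²` embeds continuously in `L¹`, so the `L²` statement applies to
  -- the preimage of `S`. Hence `S` contains all indicators, and these generate `L¹`.
  have htop : S.comap J₀ = ⊤ := by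
    refine trig_dense_L2 (hS.preimage hJ) fun L => ?_
    have : J₀ (memLp_trig μ L 2).toLp = (memLp_trig μ L 1).toLp :=
      MemLp.toLp_congr (hmem _) _ (memLp_trig μ L 2).coeFn_toLp
    rw [Submodule.mem_comap, this]
    exact h L
  rw [eq_top_iff]
  rintro f -
  refine Lp.induction ENNReal.one_ne_top (motive := fun f => f ∈ S) (fun c s hs hμs => ?_)
    (fun f g hf hg _ h1 h2 => S.add_mem h1 h2) hS f
  have h2 := Submodule.mem_comap.1 (htop ▸ Submodule.mem_top :
    indicatorConstLp 2 hs hμs.ne c ∈ S.comap J₀)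
  convert h2 using 1
  rw [Lp.simpleFunc.coe_indicatorConst]
  exact MemLp.toLp_congr (memLp_indicator_const 1 hs c (Or.inr hμs.ne)) (hmem _)
    indicatorConstLp_coeFn.symm

end Density

end

section

/-! ### Averages of asymptotically orthogonal vectors -/

/-- Adding `v n` costs its cross terms with the earlier vectors, which involve each lag `1, …, n`
once, plus the diagonal term of lag `0`. -/
lemma norm_sum_sq_le_of_inner_le {E : Type*} [NormedAddCommGroup E] [InnerProductSpace ℂ E]
    {v : ℕ → E} {c : ℕ → ℝ} (hv : ∀ j d, ‖⟪v j, v (j + d)⟫_ℂ‖ ≤ c d) (n : ℕ) :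
    ‖∑ j ∈ Finset.range n, v j‖ ^ 2 ≤ 2 * n * ∑ d ∈ Finset.range n, c d := by
  have hc : ∀ d, 0 ≤ c d := fun d => (norm_nonneg _).trans (hv 0 d)
  induction n with
  | zero => simp
  | succ n ih =>
    set S := ∑ j ∈ Finset.range n, v j
    have h1 : ‖S + v n‖ ^ 2 = ‖S‖ ^ 2 + 2 * RCLike.re ⟪S, v n⟫_ℂ + ‖v n‖ ^ 2 := norm_add_sq S (v n)
    have h2 : RCLike.re ⟪S, v n⟫_ℂ ≤ ∑ j ∈ Finset.range n, c (n - j) := by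
      refine (RCLike.re_le_norm _).trans ?_
      rw [sum_inner]
      refine (norm_sum_le _ _).trans (Finset.sum_le_sum fun j hj => ?_)
      have := hv j (n - j)
      rwa [Nat.add_sub_cancel' (Finset.mem_range.1 hj).le] at this
    have h3 : ‖v n‖ ^ 2 ≤ c 0 := by
      have := hv n 0
      rwa [add_zero, inner_self_eq_norm_sq_to_K, norm_pow, RCLike.norm_ofReal, abs_norm] at this
    have h4 : (∑ j ∈ Finset.range n, c (n - j)) + c 0 = ∑ d ∈ Finset.range (n + 1), c d := by
      rw [← Finset.sum_range_reflect c (n + 1), Finset.sum_range_succ]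
      simp
    have h5 : ∑ d ∈ Finset.range n, c d ≤ ∑ d ∈ Finset.range (n + 1), c d := by
      rw [Finset.sum_range_succ]
      linarith [hc n]
    have h6 : 2 * (n : ℝ) * ∑ d ∈ Finset.range n, c d ≤
        2 * n * ∑ d ∈ Finset.range (n + 1), c d := by gcongr
    rw [Finset.sum_range_succ, h1]
    push_cast
    linarith [hc 0]

lemma tendsto_average_zero_of_inner_le {E : Type*} [NormedAddCommGroup E] [InnerProductSpace ℂ E]
    {v : ℕ → E} {c : ℕ → ℝ} (hv : ∀ j d, ‖⟪v j, v (j + d)⟫_ℂ‖ ≤ c d)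
    (hc : Tendsto c atTop (𝓝 0)) :
    Tendsto (fun n : ℕ => ‖((n : ℂ))⁻¹ • ∑ j ∈ Finset.range n, v j‖) atTop (𝓝 0) := by
  have h1 : Tendsto (fun n : ℕ => √(2 * ((n : ℝ)⁻¹ * ∑ d ∈ Finset.range n, c d))) atTop (𝓝 0) := by
    simpa using (hc.cesaro.const_mul 2).sqrt
  refine squeeze_zero (fun _ => norm_nonneg _) (fun n => ?_) h1
  refine Real.le_sqrt_of_sq_le ?_
  rw [norm_smul, norm_inv, Complex.norm_natCast, mul_pow]
  rcases Nat.eq_zero_or_pos n with rfl | hn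
  · simp
  have hn0 : (0 : ℝ) < n := by exact_mod_cast hn
  calc ((n : ℝ)⁻¹) ^ 2 * ‖∑ j ∈ Finset.range n, v j‖ ^ 2
      ≤ ((n : ℝ)⁻¹) ^ 2 * (2 * n * ∑ d ∈ Finset.range n, c d) := by
        gcongr; exact norm_sum_sq_le_of_inner_le hv n
    _ = 2 * ((n : ℝ)⁻¹ * ∑ d ∈ Finset.range n, c d) := by field_simp

/-! ### Stationary mixing processes -/

section Mixing

variable {Ω : Type*} [MeasurableSpace Ω] {W : Type*} [NormedAddCommGroup W] [NormedSpace ℝ W]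
  [CompleteSpace W] [SecondCountableTopology W] [MeasurableSpace W] [BorelSpace W]

/-- A jointly measurable, stochastically continuous, strictly stationary process indexed by `ℝ`,
which is mixing in the sense that the correlations of trigonometric functions tend to zero. -/
structure IsMixingProcess (P : Measure Ω) (ψ : ℝ → Ω → W) : Prop where
  measurable : Measurable (Function.uncurry ψ)
  stationary : ∀ (n : ℕ) (t : Fin n → ℝ) (r : ℝ),
    IdentDistrib (fun ω i => ψ (t i + r) ω) (fun ω i => ψ (t i) ω) P P
  continuity : ∀ (L : StrongDual ℝ W) (s : ℝ),
    Tendsto (fun t => ∫ ω, ‖trig L (ψ t ω) - trig L (ψ s ω)‖ ∂P) (𝓝 s) (𝓝 0)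
  mixing : ∀ L : StrongDual ℝ W,
    Tendsto (fun d : ℕ => ∫ ω, (starRingEnd ℂ) (trig L (ψ 0 ω)) * trig L (ψ d ω) ∂P) atTop
      (𝓝 ((starRingEnd ℂ) (∫ ω, trig L (ψ 0 ω) ∂P) * ∫ ω, trig L (ψ 0 ω) ∂P))

variable {P : Measure Ω} [IsProbabilityMeasure P] {ψ : ℝ → Ω → W}

namespace IsMixingProcess

lemma measurable_apply (h : IsMixingProcess P ψ) (t : ℝ) : Measurable (ψ t) :=
  h.measurable.comp measurable_prodMk_left

lemma identDistrib (h : IsMixingProcess P ψ) (t s : ℝ) : IdentDistrib (ψ t) (ψ s) P P := by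
  have := (h.stationary 1 (fun _ => s) (t - s)).comp (measurable_pi_apply 0)
  simpa [Function.comp_def] using this

lemma measurePreserving (h : IsMixingProcess P ψ) (t : ℝ) :
    MeasurePreserving (ψ t) P (P.map (ψ 0)) :=
  ⟨h.measurable_apply t, (h.identDistrib t 0).map_eq⟩

lemma isProbabilityMeasure_map (h : IsMixingProcess P ψ) : IsProbabilityMeasure (P.map (ψ 0)) :=
  Measure.isProbabilityMeasure_map (h.measurable_apply 0).aemeasurable

/-- The isometry `f ↦ f ∘ ψ t` from `L¹` of the stationary law. -/
def evalLp (h : IsMixingProcess P ψ) (t : ℝ) : Lp ℂ 1 (P.map (ψ 0)) →L[ℂ] Lp ℂ 1 P :=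
  (Lp.compMeasurePreservingₗᵢ ℂ (ψ t) (h.measurePreserving t)).toContinuousLinearMap

lemma norm_evalLp_apply (h : IsMixingProcess P ψ) (t : ℝ) (f : Lp ℂ 1 (P.map (ψ 0))) :
    ‖h.evalLp t f‖ = ‖f‖ :=
  (Lp.compMeasurePreservingₗᵢ ℂ (ψ t) (h.measurePreserving t)).norm_map f

lemma norm_evalLp_le (h : IsMixingProcess P ψ) (t : ℝ) : ‖h.evalLp t‖ ≤ 1 :=
  ContinuousLinearMap.opNorm_le_bound _ zero_le_one fun f => by rw [h.norm_evalLp_apply, one_mul]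

lemma evalLp_toLp (h : IsMixingProcess P ψ) (t : ℝ) {f : W → ℂ} (hf : MemLp f 1 (P.map (ψ 0))) :
    h.evalLp t hf.toLp =ᵐ[P] fun ω => f (ψ t ω) :=
  (hf.comp_measurePreserving (h.measurePreserving t)).coeFn_toLp

lemma integrable_trig (h : IsMixingProcess P ψ) (L : StrongDual ℝ W) (t : ℝ) :
    Integrable (fun ω => trig L (ψ t ω)) P :=
  Integrable.of_bound ((continuous_trig L).measurable.comp (h.measurable_apply t)).aestronglyMeasurable
    1 (ae_of_all _ fun _ => (norm_trig L _).le)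

/-- By stationarity the evaluation maps are isometries, so continuity need only be known for
trigonometric functions, where it is part of `IsMixingProcess`. -/
lemma tendsto_evalLp (h : IsMixingProcess P ψ) (f : Lp ℂ 1 (P.map (ψ 0))) (s : ℝ) :
    Tendsto (fun t => h.evalLp t f - h.evalLp s f) (𝓝 s) (𝓝 0) := by
  have := h.isProbabilityMeasure_map
  have hcl := isClosed_tendstoZeroSubmodule (R := fun t => h.evalLp t - h.evalLp s) (l := 𝓝 s)
    (C := 1 + 1) fun t =>
      (norm_sub_le _ _).trans (add_le_add (h.norm_evalLp_le t) (h.norm_evalLp_le s))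
  have htop := trig_dense_L1 hcl fun L => by
    rw [mem_tendstoZeroSubmodule, tendsto_zero_iff_norm_tendsto_zero]
    refine (h.continuity L s).congr fun t => ?_
    rw [sub_apply, L1.norm_eq_integral_norm]
    refine integral_congr_ae ?_
    filter_upwards [Lp.coeFn_sub (h.evalLp t (memLp_trig (P.map (ψ 0)) L 1).toLp)
      (h.evalLp s (memLp_trig (P.map (ψ 0)) L 1).toLp), h.evalLp_toLp t (memLp_trig _ L 1),
      h.evalLp_toLp s (memLp_trig _ L 1)] with ω h1 h2 h3
    rw [h1, Pi.sub_apply, h2, h3]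
  exact mem_tendstoZeroSubmodule.1 (htop ▸ Submodule.mem_top :
    f ∈ tendstoZeroSubmodule (fun t => h.evalLp t - h.evalLp s) (𝓝 s))

lemma continuous_evalLp (h : IsMixingProcess P ψ) (f : Lp ℂ 1 (P.map (ψ 0))) :
    Continuous fun t => h.evalLp t f :=
  continuous_iff_continuousAt.2 fun s => tendsto_sub_nhds_zero_iff.1 (h.tendsto_evalLp f s)

/-- The mean ergodic theorem for trigonometric functions. -/
lemma tendsto_average_trig (h : IsMixingProcess P ψ) (L : StrongDual ℝ W) :
    Tendsto (fun n : ℕ => ∫ ω, ‖(n : ℂ)⁻¹ * (∑ j ∈ Finset.range n, trig L (ψ j ω)) -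
      ∫ ω, trig L (ψ 0 ω) ∂P‖ ∂P) atTop (𝓝 0) := by
  set m : ℂ := ∫ ω, trig L (ψ 0 ω) ∂P with hm
  set g : ℕ → Ω → ℂ := fun j ω => trig L (ψ j ω) - m with hg
  have hgm : ∀ j, Measurable (g j) := fun j =>
    ((continuous_trig L).measurable.comp (h.measurable_apply j)).sub_const m
  have hgL : ∀ j, MemLp (g j) 2 P := fun j =>
    MemLp.of_bound (hgm j).aestronglyMeasurable (1 + ‖m‖)
      (ae_of_all _ fun ω => (norm_sub_le _ _).trans (by rw [norm_trig]))
  have hmean : ∀ t : ℝ, ∫ ω, trig L (ψ t ω) ∂P = m := fun t =>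
    ((h.identDistrib t 0).comp (continuous_trig L).measurable).integral_eq
  set v : ℕ → Lp ℂ 2 P := fun j => (hgL j).toLp with hv
  -- Stationarity makes the Gram matrix of the centred variables depend on the lag alone, and mixing
  -- makes it vanish at large lags.
  have hinner : ∀ j d : ℕ, ⟪v j, v (j + d)⟫_ℂ =
      (∫ ω, (starRingEnd ℂ) (trig L (ψ 0 ω)) * trig L (ψ d ω) ∂P) - (starRingEnd ℂ) m * m := by
    intro j d
    have hsh : ∫ ω, (starRingEnd ℂ) (trig L (ψ j ω)) * trig L (ψ (j + d : ℕ) ω) ∂P =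
        ∫ ω, (starRingEnd ℂ) (trig L (ψ 0 ω)) * trig L (ψ d ω) ∂P := by
      have hme : Measurable fun x : Fin 2 → W => (starRingEnd ℂ) (trig L (x 0)) * trig L (x 1) :=
        (Continuous.mul (Complex.continuous_conj.comp ((continuous_trig L).comp
          (continuous_apply 0))) ((continuous_trig L).comp (continuous_apply 1))).measurable
      have := ((h.stationary 2 ![0, (d : ℝ)] j).comp hme).integral_eq
      simp only [Function.comp_def, Matrix.cons_val_zero, Matrix.cons_val_one, zero_add] at this
      rw [← this]
      push_cast
      simp_rw [add_comm (d : ℝ)]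
    have hI : ∀ s t : ℝ, Integrable (fun ω => (starRingEnd ℂ) (trig L (ψ s ω)) * trig L (ψ t ω)) P :=
      fun s t => (h.integrable_trig L t).bdd_mul (c := 1)
        ((Complex.continuous_conj.comp (continuous_trig L)).measurable.comp
          (h.measurable_apply s)).aestronglyMeasurable
        (ae_of_all _ fun ω => by simp [norm_trig])
    have hI2 : ∀ s : ℝ, Integrable (fun ω => (starRingEnd ℂ) (trig L (ψ s ω))) P := fun s => by
      simpa [conj_trig] using h.integrable_trig (-L) s
    rw [L2.inner_def]
    have h1 : ∀ᵐ ω ∂P, ⟪v j ω, v (j + d) ω⟫_ℂ =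
        (starRingEnd ℂ) (trig L (ψ j ω)) * trig L (ψ (j + d : ℕ) ω)
        - (starRingEnd ℂ) (trig L (ψ j ω)) * m - (starRingEnd ℂ) m * trig L (ψ (j + d : ℕ) ω)
        + (starRingEnd ℂ) m * m := by
      filter_upwards [(hgL j).coeFn_toLp, (hgL (j + d)).coeFn_toLp] with ω h1 h2
      rw [hv]
      simp only
      rw [h1, h2, RCLike.inner_apply]
      simp only [hg, map_sub]
      ring
    have e1 := hI j (j + d : ℕ)
    have e2 := (hI2 j).mul_const m
    have e3 := (h.integrable_trig L (j + d : ℕ)).const_mul ((starRingEnd ℂ) m)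
    rw [integral_congr_ae h1, integral_add (by exact (e1.sub e2).sub e3) (integrable_const _),
      integral_sub (by exact e1.sub e2) e3, integral_sub e1 e2, integral_mul_const,
      integral_const_mul, integral_conj, hmean, hmean, hsh]
    simp
  have hc : Tendsto (fun d : ℕ => ‖(∫ ω, (starRingEnd ℂ) (trig L (ψ 0 ω)) * trig L (ψ d ω) ∂P) -
      (starRingEnd ℂ) m * m‖) atTop (𝓝 0) :=
    tendsto_zero_iff_norm_tendsto_zero.1 (tendsto_sub_nhds_zero_iff.2 (h.mixing L))
  have hav := tendsto_average_zero_of_inner_le (fun j d => (hinner j d ▸ le_rfl :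
    ‖⟪v j, v (j + d)⟫_ℂ‖ ≤ _)) hc
  refine squeeze_zero' (Eventually.of_forall fun n => integral_nonneg fun ω => norm_nonneg _) ?_ hav
  filter_upwards [eventually_ge_atTop 1] with n hn
  have hn0 : (n : ℂ) ≠ 0 := by exact_mod_cast (by omega : n ≠ 0)
  have hae : (fun ω => (n : ℂ)⁻¹ * (∑ j ∈ Finset.range n, trig L (ψ j ω)) - m) =ᵐ[P]
      ((n : ℂ)⁻¹ • ∑ j ∈ Finset.range n, v j : Lp ℂ 2 P) := by
    have hall : ∀ᵐ ω ∂P, ∀ j, v j ω = g j ω := ae_all_iff.2 fun j => (hgL j).coeFn_toLp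
    filter_upwards [hall, Lp.coeFn_smul (n : ℂ)⁻¹ (∑ j ∈ Finset.range n, v j),
      Lp.coeFn_finsetSum (Finset.range n) v] with ω h1 h2 h3
    rw [h2, Pi.smul_apply, h3, Finset.sum_apply]
    simp only [h1, hg, Finset.sum_sub_distrib, Finset.sum_const, Finset.card_range, nsmul_eq_mul,
      smul_eq_mul, mul_sub]
    rw [inv_mul_cancel_left₀ hn0]
  have hae' : (fun ω => ‖(n : ℂ)⁻¹ * (∑ j ∈ Finset.range n, trig L (ψ j ω)) - m‖) =ᵐ[P]
      fun ω => ‖((n : ℂ)⁻¹ • ∑ j ∈ Finset.range n, v j : Lp ℂ 2 P) ω‖ := by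
    filter_upwards [hae] with ω hω
    rw [hω]
  rw [integral_congr_ae hae', Lp.norm_def]
  have hL := Lp.memLp ((n : ℂ)⁻¹ • ∑ j ∈ Finset.range n, v j : Lp ℂ 2 P)
  rw [integral_norm_eq_lintegral_enorm hL.1, ← eLpNorm_one_eq_lintegral_enorm]
  exact ENNReal.toReal_mono hL.2.ne (eLpNorm_le_eLpNorm_of_exponent_le (by norm_num) hL.1)

end IsMixingProcess

end Mixing

end

section

/-! ### Bochner integrals in `L¹` versus pathwise time integrals -/

section PathIntegral

variable {Ω : Type*} [MeasurableSpace Ω] {P : Measure Ω} [IsProbabilityMeasure P]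

lemma integrable_uncurry_of_continuous_Lp {f : ℝ → Ω → ℝ} (hf : Measurable (Function.uncurry f))
    {x : ℝ → Lp ℝ 1 P} (hx : Continuous x) (hfx : ∀ t, x t =ᵐ[P] f t) (a b : ℝ) :
    Integrable (Function.uncurry f) ((volume.restrict (Ioc a b)).prod P) := by
  rw [integrable_prod_iff hf.aestronglyMeasurable]
  refine ⟨ae_of_all _ fun t => (L1.integrable_coeFn (x t)).congr (hfx t), ?_⟩
  have : ∀ t, ∫ ω, ‖Function.uncurry f (t, ω)‖ ∂P = ‖x t‖ := fun t => by
    rw [L1.norm_eq_integral_norm]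
    refine integral_congr_ae ?_
    filter_upwards [hfx t] with ω hω
    rw [hω, Function.uncurry_apply_pair]
  simp_rw [this]
  exact hx.norm.integrableOn_Ioc

/-- The Bochner integral of a continuous curve in `L¹` is represented by the pathwise integral. -/
lemma coeFn_intervalIntegral_Lp {f : ℝ → Ω → ℝ} (hf : Measurable (Function.uncurry f))
    {x : ℝ → Lp ℝ 1 P} (hx : Continuous x) (hfx : ∀ t, x t =ᵐ[P] f t) {a b : ℝ} (hab : a ≤ b) :
    (∫ t in a..b, x t : Lp ℝ 1 P) =ᵐ[P] fun ω => ∫ t in a..b, f t ω := by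
  have hint := integrable_uncurry_of_continuous_Lp hf hx hfx a b
  have hint' : Integrable (fun ω => ∫ t in a..b, f t ω) P := by
    simp_rw [intervalIntegral.integral_of_le hab]
    exact hint.integral_prod_right
  -- Compare integrals over every measurable `s`. Integration over `s` is a continuous functional on
  -- `L¹`, so it commutes with the Bochner integral; on the pathwise side Fubini gives the same
  -- double integral.
  refine Integrable.ae_eq_of_forall_setIntegral_eq _ _ (L1.integrable_coeFn _) hint'
    fun s hs _ => ?_
  let Λ : Lp ℝ 1 P →L[ℝ] ℝ :=
    (L1.integralCLM (α := Ω) (E := ℝ) (μ := P.restrict s)).comp (LpToLpRestrictCLM Ω ℝ ℝ P 1 s)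
  have hΛ : ∀ y : Lp ℝ 1 P, Λ y = ∫ ω in s, y ω ∂P := by
    intro y
    change L1.integralCLM _ = _
    rw [← L1.integral_def, L1.integral_eq_integral]
    exact integral_congr_ae (LpToLpRestrictCLM_coeFn ℝ s y)
  have h1 : ∀ t, Λ (x t) = ∫ ω in s, f t ω ∂P := fun t => by
    rw [hΛ]
    exact integral_congr_ae (ae_restrict_of_ae (hfx t))
  rw [← hΛ, intervalIntegral.integral_of_le hab, ← Λ.integral_comp_comm hx.integrableOn_Ioc]
  simp_rw [h1, intervalIntegral.integral_of_le hab]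
  refine integral_integral_swap ?_
  refine hint.mono_measure ?_
  exact Measure.prod_mono le_rfl Measure.restrict_le_self

end PathIntegral

/-! ### Mean ergodic theorem for integrable observables -/

namespace IsMixingProcess

variable {Ω : Type*} [MeasurableSpace Ω] {W : Type*} [NormedAddCommGroup W] [NormedSpace ℝ W]
  [CompleteSpace W] [SecondCountableTopology W] [MeasurableSpace W] [BorelSpace W]
  {P : Measure Ω} [IsProbabilityMeasure P] {ψ : ℝ → Ω → W} {ρ : W → ℝ}

lemma memLp_obs (h : IsMixingProcess P ψ) (hρ : Measurable ρ)
    (hi : Integrable (fun ω => ρ (ψ 0 ω)) P) (t : ℝ) : MemLp (fun ω => ρ (ψ t ω)) 1 P :=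
  memLp_one_iff_integrable.2 (((h.identDistrib t 0).comp hρ).integrable_iff.2 hi)

/-- The observable `ρ (ψ t)` as an element of `L¹`. -/
def obs (h : IsMixingProcess P ψ) (hρ : Measurable ρ) (hi : Integrable (fun ω => ρ (ψ 0 ω)) P)
    (t : ℝ) : Lp ℝ 1 P := (h.memLp_obs hρ hi t).toLp

lemma coeFn_obs (h : IsMixingProcess P ψ) (hρ : Measurable ρ)
    (hi : Integrable (fun ω => ρ (ψ 0 ω)) P) (t : ℝ) :
    h.obs hρ hi t =ᵐ[P] fun ω => ρ (ψ t ω) := (h.memLp_obs hρ hi t).coeFn_toLp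

lemma memLp_ofReal (h : IsMixingProcess P ψ) (hρ : Measurable ρ)
    (hi : Integrable (fun ω => ρ (ψ 0 ω)) P) :
    MemLp (fun x => (ρ x : ℂ)) 1 (P.map (ψ 0)) := by
  have hm : Measurable fun x => (ρ x : ℂ) := Complex.measurable_ofReal.comp hρ
  rw [memLp_map_measure_iff hm.aestronglyMeasurable (h.measurable_apply 0).aemeasurable]
  exact memLp_one_iff_integrable.2 hi.ofReal

lemma re_evalLp (h : IsMixingProcess P ψ) (hρ : Measurable ρ)
    (hi : Integrable (fun ω => ρ (ψ 0 ω)) P) (t : ℝ) :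
    Complex.reCLM.compLpL 1 P (h.evalLp t (h.memLp_ofReal hρ hi).toLp) = h.obs hρ hi t := by
  refine Lp.ext ?_
  filter_upwards [Complex.reCLM.coeFn_compLpL (h.evalLp t (h.memLp_ofReal hρ hi).toLp),
    h.evalLp_toLp t (h.memLp_ofReal hρ hi), h.coeFn_obs hρ hi t] with ω h1 h2 h3
  rw [h1, h2, h3]
  simp

lemma continuous_obs (h : IsMixingProcess P ψ) (hρ : Measurable ρ)
    (hi : Integrable (fun ω => ρ (ψ 0 ω)) P) : Continuous (h.obs hρ hi) := by
  have : h.obs hρ hi = fun t => Complex.reCLM.compLpL 1 P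
      (h.evalLp t (h.memLp_ofReal hρ hi).toLp) := funext fun t => (h.re_evalLp hρ hi t).symm
  rw [this]
  exact (Complex.reCLM.compLpL 1 P).continuous.comp (h.continuous_evalLp _)

/-- The mean ergodic theorem for complex observables. -/
lemma tendsto_average_evalLp (h : IsMixingProcess P ψ) (f : Lp ℂ 1 (P.map (ψ 0))) :
    Tendsto (fun n : ℕ => (n : ℝ)⁻¹ • (∑ j ∈ Finset.range n, h.evalLp j f) -
      Lp.const 1 P (∫ ω, h.evalLp 0 f ω ∂P)) atTop (𝓝 0) := by
  have := h.isProbabilityMeasure_map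
  let M : Lp ℂ 1 (P.map (ψ 0)) →L[ℂ] Lp ℂ 1 P :=
    ((Lp.constL 1 P ℂ).comp (L1.integralCLM' (α := Ω) (E := ℂ) (μ := P) ℂ)).comp (h.evalLp 0)
  have hM : ∀ f, M f = Lp.const 1 P (∫ ω, h.evalLp 0 f ω ∂P) := by
    intro f
    rw [← L1.integral_eq_integral, L1.integral_eq' ℂ]
    rfl
  have hMn : ∀ f, ‖M f‖ ≤ ‖f‖ := by
    intro f
    rw [hM, Lp.norm_const' _ _ _ one_ne_zero ENNReal.one_ne_top]
    simp only [probReal_univ, Real.one_rpow, mul_one]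
    refine (norm_integral_le_integral_norm _).trans ?_
    rw [← L1.norm_eq_integral_norm, h.norm_evalLp_apply]
  -- Average minus candidate limit `M`, as an operator of norm at most `2`; density of trigonometric
  -- functions then suffices.
  let R : ℕ → Lp ℂ 1 (P.map (ψ 0)) →L[ℂ] Lp ℂ 1 P := fun n =>
    (n : ℝ)⁻¹ • (∑ j ∈ Finset.range n, h.evalLp j) - M
  have hR : ∀ n f, R n f = (n : ℝ)⁻¹ • (∑ j ∈ Finset.range n, h.evalLp j f) -
      Lp.const 1 P (∫ ω, h.evalLp 0 f ω ∂P) := by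
    intro n f
    rw [← hM]
    simp [R]
  have hRn : ∀ n, ‖R n‖ ≤ 2 := by
    intro n
    refine ContinuousLinearMap.opNorm_le_bound _ zero_le_two fun f => ?_
    rw [hR, ← hM]
    refine (norm_sub_le _ _).trans ?_
    rw [two_mul]
    refine add_le_add ?_ (hMn f)
    rw [norm_smul, norm_inv, Real.norm_natCast]
    have : ‖∑ j ∈ Finset.range n, h.evalLp j f‖ ≤ n * ‖f‖ := by
      refine (norm_sum_le _ _).trans ?_
      simp [h.norm_evalLp_apply]
    rcases Nat.eq_zero_or_pos n with rfl | hn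
    · simp
    · rwa [inv_mul_le_iff₀ (by positivity)]
  have htop := trig_dense_L1 (isClosed_tendstoZeroSubmodule (R := R) (l := atTop) hRn) fun L => by
    rw [mem_tendstoZeroSubmodule, tendsto_zero_iff_norm_tendsto_zero]
    refine (h.tendsto_average_trig L).congr fun n => ?_
    rw [L1.norm_eq_integral_norm]
    refine integral_congr_ae ?_
    have hall : ∀ᵐ ω ∂P, ∀ j : ℕ, h.evalLp j (memLp_trig (P.map (ψ 0)) L 1).toLp ω =
      trig L (ψ j ω) := ae_all_iff.2 fun j => h.evalLp_toLp j (memLp_trig (P.map (ψ 0)) L 1)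
    have hm : ∫ ω, h.evalLp 0 (memLp_trig (P.map (ψ 0)) L 1).toLp ω ∂P =
        ∫ ω, trig L (ψ 0 ω) ∂P :=
      integral_congr_ae (h.evalLp_toLp 0 (memLp_trig (P.map (ψ 0)) L 1))
    rw [hR]
    filter_upwards [hall, Lp.coeFn_sub ((n : ℝ)⁻¹ • (∑ j ∈ Finset.range n,
        h.evalLp j (memLp_trig (P.map (ψ 0)) L 1).toLp)) (Lp.const 1 P
        (∫ ω, h.evalLp 0 (memLp_trig (P.map (ψ 0)) L 1).toLp ω ∂P)),
      Lp.coeFn_smul (n : ℝ)⁻¹ (∑ j ∈ Finset.range n,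
        h.evalLp j (memLp_trig (P.map (ψ 0)) L 1).toLp),
      Lp.coeFn_finsetSum (Finset.range n) (fun j : ℕ => h.evalLp j
        (memLp_trig (P.map (ψ 0)) L 1).toLp),
      Lp.coeFn_const (p := 1) (μ := P)
        (∫ ω, h.evalLp 0 (memLp_trig (P.map (ψ 0)) L 1).toLp ω ∂P)] with ω h1 h2 h3 h4 h5
    rw [h2, Pi.sub_apply, h3, Pi.smul_apply, h4, Finset.sum_apply, h5, hm]
    simp [h1]
  have := mem_tendstoZeroSubmodule.1 (htop ▸ Submodule.mem_top : f ∈ tendstoZeroSubmodule R atTop)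
  simpa only [hR] using this

/-- The mean ergodic theorem for real observables. -/
lemma tendsto_average_obs (h : IsMixingProcess P ψ) (hρ : Measurable ρ)
    (hi : Integrable (fun ω => ρ (ψ 0 ω)) P) :
    Tendsto (fun n : ℕ => ‖(n : ℝ)⁻¹ • (∑ j ∈ Finset.range n, h.obs hρ hi j) -
      Lp.const 1 P (∫ ω, ρ (ψ 0 ω) ∂P)‖) atTop (𝓝 0) := by
  have h1 := ((Complex.reCLM.compLpL 1 P).continuous.tendsto 0).comp
    (h.tendsto_average_evalLp (h.memLp_ofReal hρ hi).toLp)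
  rw [map_zero] at h1
  refine (tendsto_zero_iff_norm_tendsto_zero.1 h1).congr fun n => ?_
  simp only [Function.comp_def, map_sub, map_smul, map_sum, h.re_evalLp hρ hi]
  congr 2
  have hm : ∫ ω, h.evalLp 0 (h.memLp_ofReal hρ hi).toLp ω ∂P =
      ((∫ ω, ρ (ψ 0 ω) ∂P : ℝ) : ℂ) := by
    rw [integral_congr_ae (h.evalLp_toLp 0 (h.memLp_ofReal hρ hi)), integral_complex_ofReal]
  rw [hm]
  refine Lp.ext ?_
  filter_upwards [Complex.reCLM.coeFn_compLpL (Lp.const 1 P ((∫ ω, ρ (ψ 0 ω) ∂P : ℝ) : ℂ)),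
    Lp.coeFn_const (p := 1) (μ := P) ((∫ ω, ρ (ψ 0 ω) ∂P : ℝ) : ℂ),
    Lp.coeFn_const (p := 1) (μ := P) (∫ ω, ρ (ψ 0 ω) ∂P)] with ω h1 h2 h3
  rw [h1, h2, h3]
  simp

end IsMixingProcess

end

/-! ### Pointwise ergodic theorem in continuous time -/

section

namespace IsMixingProcess

variable {Ω : Type*} [MeasurableSpace Ω] {W : Type*} [NormedAddCommGroup W] [NormedSpace ℝ W]
  [CompleteSpace W] [SecondCountableTopology W] [MeasurableSpace W] [BorelSpace W]
  {P : Measure Ω} [IsProbabilityMeasure P] {ψ : ℝ → Ω → W} {ρ : W → ℝ}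

lemma measurable_uncurry_obs (h : IsMixingProcess P ψ) (hρ : Measurable ρ) :
    Measurable (Function.uncurry fun t ω => ρ (ψ t ω)) := hρ.comp h.measurable

lemma norm_average_obs_shift (h : IsMixingProcess P ψ) (hρ : Measurable ρ)
    (hi : Integrable (fun ω => ρ (ψ 0 ω)) P) (n : ℕ) (u m : ℝ) :
    ‖(n : ℝ)⁻¹ • (∑ j ∈ Finset.range n, h.obs hρ hi (j + u)) - Lp.const 1 P m‖ =
      ‖(n : ℝ)⁻¹ • (∑ j ∈ Finset.range n, h.obs hρ hi j) - Lp.const 1 P m‖ := by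
  have key : ∀ u : ℝ, ‖(n : ℝ)⁻¹ • (∑ j ∈ Finset.range n, h.obs hρ hi (j + u)) -
      Lp.const 1 P m‖ = ∫ ω, |(n : ℝ)⁻¹ * (∑ j : Fin n, ρ (ψ ((j : ℕ) + u) ω)) - m| ∂P := by
    intro u
    rw [L1.norm_eq_integral_norm]
    refine integral_congr_ae ?_
    have hall : ∀ᵐ ω ∂P, ∀ j : ℕ, h.obs hρ hi (j + u) ω = ρ (ψ (j + u) ω) :=
      ae_all_iff.2 fun j => h.coeFn_obs hρ hi (j + u)
    filter_upwards [hall, Lp.coeFn_sub ((n : ℝ)⁻¹ • (∑ j ∈ Finset.range n,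
        h.obs hρ hi (j + u))) (Lp.const 1 P m),
      Lp.coeFn_smul (n : ℝ)⁻¹ (∑ j ∈ Finset.range n, h.obs hρ hi (j + u)),
      Lp.coeFn_finsetSum (Finset.range n) (fun j : ℕ => h.obs hρ hi (j + u)),
      Lp.coeFn_const (p := 1) (μ := P) m] with ω h1 h2 h3 h4 h5
    rw [h2, Pi.sub_apply, h3, Pi.smul_apply, h4, Finset.sum_apply, h5,
      Fin.sum_univ_eq_sum_range (fun j => ρ (ψ ((j : ℕ) + u) ω)) n]
    simp [h1]
  have h0 := key 0
  simp only [add_zero] at h0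
  rw [key u, h0]
  have hm : Measurable fun x : Fin n → W => |(n : ℝ)⁻¹ * (∑ j, ρ (x j)) - m| := by
    refine Measurable.abs (Measurable.sub_const (Measurable.const_mul ?_ _) _)
    exact Finset.measurable_fun_sum _ fun j _ => hρ.comp (measurable_pi_apply j)
  exact ((h.stationary n (fun j => (j : ℕ)) u).comp hm).integral_eq

/-- The unit time integrals of the observable, as elements of `L¹`. -/
def blockLp (h : IsMixingProcess P ψ) (hρ : Measurable ρ)
    (hi : Integrable (fun ω => ρ (ψ 0 ω)) P) (j : ℕ) : Lp ℝ 1 P :=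
  ∫ t in (j : ℝ)..(j + 1), h.obs hρ hi t

/-- The unit time integrals of the observable. -/
def block (ψ : ℝ → Ω → W) (ρ : W → ℝ) (j : ℕ) (ω : Ω) : ℝ :=
  ∫ t in (j : ℝ)..(j + 1), ρ (ψ t ω)

lemma coeFn_blockLp (h : IsMixingProcess P ψ) (hρ : Measurable ρ)
    (hi : Integrable (fun ω => ρ (ψ 0 ω)) P) (j : ℕ) :
    h.blockLp hρ hi j =ᵐ[P] block ψ ρ j :=
  coeFn_intervalIntegral_Lp (h.measurable_uncurry_obs hρ) (h.continuous_obs hρ hi)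
    (h.coeFn_obs hρ hi) (by linarith)

lemma measurable_block (h : IsMixingProcess P ψ) (hρ : Measurable ρ) (j : ℕ) :
    Measurable (block ψ ρ j) := by
  have h1 : StronglyMeasurable fun ω => ∫ t in Ioc (j : ℝ) (j + 1), ρ (ψ t ω) :=
    StronglyMeasurable.integral_prod_left (h.measurable_uncurry_obs hρ).stronglyMeasurable
  have h2 : block ψ ρ j = fun ω => ∫ t in Ioc (j : ℝ) (j + 1), ρ (ψ t ω) :=
    funext fun ω => intervalIntegral.integral_of_le (by linarith)
  rw [h2]
  exact h1.measurable

lemma integrable_block (h : IsMixingProcess P ψ) (hρ : Measurable ρ)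
    (hi : Integrable (fun ω => ρ (ψ 0 ω)) P) (j : ℕ) : Integrable (block ψ ρ j) P :=
  (L1.integrable_coeFn _).congr (h.coeFn_blockLp hρ hi j)

/-- The average of the block integrals is the mean over `u ∈ [0, 1]` of the discrete averages
started at `u`. By stationarity all of these are equally far from the constant. -/
lemma norm_average_blockLp_le (h : IsMixingProcess P ψ) (hρ : Measurable ρ)
    (hi : Integrable (fun ω => ρ (ψ 0 ω)) P) (n : ℕ) (m : ℝ) :
    ‖(n : ℝ)⁻¹ • (∑ j ∈ Finset.range n, h.blockLp hρ hi j) - Lp.const 1 P m‖ ≤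
      ‖(n : ℝ)⁻¹ • (∑ j ∈ Finset.range n, h.obs hρ hi j) - Lp.const 1 P m‖ := by
  have hc := h.continuous_obs hρ hi
  have hc' : ∀ j : ℕ, Continuous fun u : ℝ => h.obs hρ hi (j + u) := fun j => by fun_prop
  have h1 : ∀ j : ℕ, h.blockLp hρ hi j = ∫ u in (0 : ℝ)..1, h.obs hρ hi (j + u) := by
    intro j
    rw [blockLp, intervalIntegral.integral_comp_add_left (fun t => h.obs hρ hi t) (j : ℝ), add_zero]
  have h2 : (n : ℝ)⁻¹ • (∑ j ∈ Finset.range n, h.blockLp hρ hi j) - Lp.const 1 P m =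
      ∫ u in (0 : ℝ)..1, ((n : ℝ)⁻¹ • (∑ j ∈ Finset.range n, h.obs hρ hi (j + u)) -
        Lp.const 1 P m) := by
    have hs : Continuous fun u : ℝ => ∑ j ∈ Finset.range n, h.obs hρ hi (j + u) :=
      continuous_finsetSum _ fun j _ => hc' j
    have hs' : Continuous fun u : ℝ => (n : ℝ)⁻¹ • ∑ j ∈ Finset.range n, h.obs hρ hi (j + u) :=
      by exact Continuous.const_smul hs ((n : ℝ)⁻¹)
    rw [intervalIntegral.integral_sub (hs'.intervalIntegrable _ _)
      (continuous_const.intervalIntegrable _ _), intervalIntegral.integral_smul,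
      intervalIntegral.integral_finsetSum fun j _ => (hc' j).intervalIntegrable _ _]
    simp [h1]
  rw [h2]
  refine (intervalIntegral.norm_integral_le_of_norm_le_const fun u _ =>
    (h.norm_average_obs_shift hρ hi n u m).le).trans (by simp)

lemma continuous_charFun_L1 : Continuous fun p : Lp ℝ 1 P => ∫ ω, Complex.exp (p ω * Complex.I) ∂P := by
  have hi : ∀ p : Lp ℝ 1 P, Integrable (fun ω => Complex.exp (p ω * Complex.I)) P := fun p =>
    Integrable.of_bound (Complex.continuous_exp.comp_aestronglyMeasurable
      ((Complex.continuous_ofReal.comp_aestronglyMeasurable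
        (Lp.aestronglyMeasurable p)).mul_const _)) 1
      (ae_of_all _ fun ω => (Complex.norm_exp_ofReal_mul_I _).le)
  refine LipschitzWith.continuous (K := 1) (LipschitzWith.of_dist_le_mul fun p q => ?_)
  rw [NNReal.coe_one, one_mul, dist_eq_norm, dist_eq_norm, ← integral_sub (hi p) (hi q),
    L1.norm_eq_integral_norm]
  refine (norm_integral_le_integral_norm _).trans ?_
  refine integral_mono_ae ((hi p).sub (hi q)).norm (L1.integrable_coeFn _).norm ?_
  filter_upwards [Lp.coeFn_sub p q] with ω hω
  rw [hω, Pi.sub_apply, Real.norm_eq_abs]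
  exact norm_trig_sub_le (ContinuousLinearMap.id ℝ ℝ) (p ω) (q ω)

/-- The closed span of the pairs formed by an observable and its translate by one unit of time. -/
def shiftGraph (h : IsMixingProcess P ψ) (hρ : Measurable ρ)
    (hi : Integrable (fun ω => ρ (ψ 0 ω)) P) : Submodule ℝ (Lp ℝ 1 P × Lp ℝ 1 P) :=
  (Submodule.span ℝ (range fun t => (h.obs hρ hi t, h.obs hρ hi (t + 1)))).topologicalClosure

/-- For finite combinations this is stationarity of `ψ`, and it survives closure because the
characteristic function is Lipschitz in the `L¹` norm. Time integrals lie in the closure, so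
stationarity of the block integrals follows without discretising them. -/
lemma charFun_eq_of_mem_shiftGraph (h : IsMixingProcess P ψ) (hρ : Measurable ρ)
    (hi : Integrable (fun ω => ρ (ψ 0 ω)) P) {p : Lp ℝ 1 P × Lp ℝ 1 P}
    (hp : p ∈ h.shiftGraph hρ hi) :
    ∫ ω, Complex.exp (p.1 ω * Complex.I) ∂P = ∫ ω, Complex.exp (p.2 ω * Complex.I) ∂P := by
  have hcl : IsClosed {p : Lp ℝ 1 P × Lp ℝ 1 P | ∫ ω, Complex.exp (p.1 ω * Complex.I) ∂P =
      ∫ ω, Complex.exp (p.2 ω * Complex.I) ∂P} :=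
    isClosed_eq (continuous_charFun_L1.comp continuous_fst)
      (continuous_charFun_L1.comp continuous_snd)
  refine closure_minimal ?_ hcl (SetLike.mem_coe.2 hp)
  intro p hp
  obtain ⟨n, a, g, rfl⟩ := Submodule.mem_span_set'.1 hp
  choose t ht using fun i => (g i).2
  have hfst : ∀ x : Fin n → Lp ℝ 1 P, (fun ω => (∑ i, a i • x i : Lp ℝ 1 P) ω) =ᵐ[P]
      fun ω => ∑ i, a i * x i ω := by
    intro x
    have hall : ∀ᵐ ω ∂P, ∀ i, (a i • x i : Lp ℝ 1 P) ω = a i * x i ω :=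
      ae_all_iff.2 fun i => Lp.coeFn_smul (a i) (x i)
    filter_upwards [hall, Lp.coeFn_finsetSum Finset.univ fun i => a i • x i] with ω h1 h2
    rw [h2, Finset.sum_apply]
    exact Finset.sum_congr rfl fun i _ => h1 i
  have key : ∀ r : ℝ, ∫ ω, Complex.exp ((∑ i, a i • h.obs hρ hi (t i + r) : Lp ℝ 1 P) ω *
      Complex.I) ∂P = ∫ ω, Complex.exp ((∑ i, a i * ρ (ψ (t i) ω) : ℝ) * Complex.I) ∂P := by
    intro r
    have h1 : ∀ᵐ ω ∂P, ∀ i, h.obs hρ hi (t i + r) ω = ρ (ψ (t i + r) ω) :=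
      ae_all_iff.2 fun i => h.coeFn_obs hρ hi (t i + r)
    have hme : Measurable fun x : Fin n → W =>
        Complex.exp ((∑ i, a i * ρ (x i) : ℝ) * Complex.I) := by
      refine Complex.measurable_exp.comp (Measurable.mul_const (Complex.measurable_ofReal.comp ?_) _)
      exact Finset.measurable_fun_sum _ fun i _ => (hρ.comp (measurable_pi_apply i)).const_mul _
    refine (integral_congr_ae ?_).trans ((h.stationary n t r).comp hme).integral_eq
    filter_upwards [hfst fun i => h.obs hρ hi (t i + r), h1] with ω h2 h3
    rw [h2]
    simp [h3]
  have e1 : (∑ i, a i • (g i : Lp ℝ 1 P × Lp ℝ 1 P)).1 = ∑ i, a i • h.obs hρ hi (t i + 0) := by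
    rw [Prod.fst_sum]
    exact Finset.sum_congr rfl fun i _ => by rw [← ht i, add_zero]; rfl
  have e2 : (∑ i, a i • (g i : Lp ℝ 1 P × Lp ℝ 1 P)).2 = ∑ i, a i • h.obs hρ hi (t i + 1) := by
    rw [Prod.snd_sum]
    exact Finset.sum_congr rfl fun i _ => by rw [← ht i]; rfl
  change ∫ ω, Complex.exp ((∑ i, a i • (g i : Lp ℝ 1 P × Lp ℝ 1 P)).1 ω * Complex.I) ∂P =
    ∫ ω, Complex.exp ((∑ i, a i • (g i : Lp ℝ 1 P × Lp ℝ 1 P)).2 ω * Complex.I) ∂P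
  rw [e1, e2, key, key]

lemma blockLp_mem_shiftGraph (h : IsMixingProcess P ψ) (hρ : Measurable ρ)
    (hi : Integrable (fun ω => ρ (ψ 0 ω)) P) (j : ℕ) :
    (h.blockLp hρ hi j, h.blockLp hρ hi (j + 1)) ∈ h.shiftGraph hρ hi := by
  have hc := h.continuous_obs hρ hi
  have hc' : Continuous fun t => h.obs hρ hi (t + 1) := by fun_prop
  have h1 : h.blockLp hρ hi (j + 1) = ∫ t in (j : ℝ)..(j + 1), h.obs hρ hi (t + 1) := by
    rw [blockLp, intervalIntegral.integral_comp_add_right (fun t => h.obs hρ hi t)]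
    push_cast
    rfl
  rw [h1, blockLp, intervalIntegral.integral_of_le (by linarith),
    intervalIntegral.integral_of_le (by linarith),
    ← integral_pair hc.integrableOn_Ioc hc'.integrableOn_Ioc]
  refine integral_mem_of_isClosed (Submodule.isClosed_topologicalClosure _)
    (ae_of_all _ fun t => Submodule.le_topologicalClosure _ (Submodule.subset_span ⟨t, rfl⟩)) ?_
  exact hc.integrableOn_Ioc.prodMk hc'.integrableOn_Ioc

/-- The unit time integrals form a stationary sequence. -/
lemma map_block_shift (h : IsMixingProcess P ψ) (hρ : Measurable ρ)
    (hi : Integrable (fun ω => ρ (ψ 0 ω)) P) :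
    P.map (fun ω j => block ψ ρ (j + 1) ω) = P.map (fun ω j => block ψ ρ j ω) := by
  have hm : ∀ i : ℕ, Measurable fun ω => fun j => block ψ ρ (j + i) ω := fun i =>
    measurable_pi_lambda _ fun j => h.measurable_block hρ (j + i)
  have hm0 : Measurable fun ω => fun j => block ψ ρ j ω := hm 0
  rw [map_eq_iff_forall_finset_map_restrict_eq (hm 1).aemeasurable hm0.aemeasurable]
  intro I
  have hmI : ∀ i : ℕ, Measurable fun ω => I.restrict fun j => block ψ ρ (j + i) ω := fun i =>
    (Finset.measurable_restrict I).comp (hm i)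
  have hP : ∀ i : ℕ, IsProbabilityMeasure (P.map fun ω => I.restrict fun j => block ψ ρ (j + i) ω) :=
    fun i => Measure.isProbabilityMeasure_map (hmI i).aemeasurable
  have := hP 0
  have := hP 1
  refine Measure.ext_of_charFunDual (funext fun L => ?_)
  -- The characteristic functional of a finite marginal is the characteristic function of one linear
  -- combination of blocks, to which `charFun_eq_of_mem_shiftGraph` applies.
  have hcf : ∀ i : ℕ, charFunDual (P.map fun ω => I.restrict fun j => block ψ ρ (j + i) ω) L =
      ∫ ω, Complex.exp ((∑ j : I, L (Pi.single j 1) • h.blockLp hρ hi (j + i) : Lp ℝ 1 P) ω *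
        Complex.I) ∂P := by
    intro i
    rw [charFunDual_apply]
    change ∫ v, trig L v ∂_ = _
    rw [integral_map (hmI i).aemeasurable (continuous_trig L).aestronglyMeasurable]
    refine integral_congr_ae ?_
    have h1 : ∀ᵐ ω ∂P, ∀ j : I, (L (Pi.single j 1) • h.blockLp hρ hi (j + i) : Lp ℝ 1 P) ω =
        L (Pi.single j 1) * block ψ ρ (j + i) ω := ae_all_iff.2 fun j => by
      filter_upwards [Lp.coeFn_smul (L (Pi.single j 1)) (h.blockLp hρ hi (j + i)),
        h.coeFn_blockLp hρ hi (j + i)] with ω h1 h2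
      rw [h1, Pi.smul_apply, h2, smul_eq_mul]
    filter_upwards [h1, Lp.coeFn_finsetSum Finset.univ
      fun j : I => L (Pi.single j 1) • h.blockLp hρ hi (j + i)] with ω h1 h2
    rw [h2, Finset.sum_apply]
    simp only [h1]
    have hx : (I.restrict fun j => block ψ ρ (j + i) ω) =
        ∑ j : I, block ψ ρ (j + i) ω • (Pi.single j 1 : I → ℝ) := by
      ext k
      simp [Finset.sum_apply, Pi.single_apply]
    rw [hx, trig, map_sum]
    congr 3
    exact Finset.sum_congr rfl fun j _ => by rw [map_smul, smul_eq_mul, mul_comm]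
  have hmem : (∑ j : I, L (Pi.single j 1) • (h.blockLp hρ hi j, h.blockLp hρ hi (j + 1))) ∈
      h.shiftGraph hρ hi :=
    Submodule.sum_mem _ fun j _ => Submodule.smul_mem _ _ (h.blockLp_mem_shiftGraph hρ hi j)
  have := h.charFun_eq_of_mem_shiftGraph hρ hi hmem
  rw [Prod.fst_sum, Prod.snd_sum] at this
  rw [hcf 1]
  exact this.symm.trans (hcf 0).symm

/-- The averages of the unit time integrals converge almost surely. -/
lemma ae_tendsto_average_block (h : IsMixingProcess P ψ) (hρ : Measurable ρ)
    (hi : Integrable (fun ω => ρ (ψ 0 ω)) P) :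
    ∀ᵐ ω ∂P, Tendsto (fun n : ℕ => (n : ℝ)⁻¹ * ∑ j ∈ Finset.range n, block ψ ρ j ω) atTop
      (𝓝 (∫ ω, ρ (ψ 0 ω) ∂P)) := by
  set F : Ω → ℕ → ℝ := fun ω j => block ψ ρ j ω with hF
  have hFm : Measurable F := measurable_pi_lambda _ fun j => h.measurable_block hρ j
  -- No measure-preserving flow is available on `Ω`, so the discrete theorem is applied to the
  -- one-sided shift on sequence space, under the law of the block integrals.
  set T : (ℕ → ℝ) → ℕ → ℝ := fun s j => s (j + 1) with hT
  have hTm : Measurable T := measurable_pi_lambda _ fun j => measurable_pi_apply (j + 1)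
  have hμ : IsProbabilityMeasure (P.map F) := Measure.isProbabilityMeasure_map hFm.aemeasurable
  have hTp : MeasurePreserving T (P.map F) (P.map F) :=
    ⟨hTm, by rw [Measure.map_map hTm hFm]; exact h.map_block_shift hρ hi⟩
  have hiter : ∀ (j : ℕ) (s : ℕ → ℝ) (i : ℕ), T^[j] s i = s (i + j) := by
    intro j
    induction j with
    | zero => intro s i; rfl
    | succ j ih =>
      intro s i
      rw [Function.iterate_succ_apply, ih]
      rfl
  have hav : ∀ (n : ℕ) (s : ℕ → ℝ), birkhoffAverage ℝ T (fun s => s 0) n s =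
      (n : ℝ)⁻¹ * ∑ j ∈ Finset.range n, s j := by
    intro n s
    simp [birkhoffAverage, birkhoffSum, hiter]
  have hm0 : Measurable fun s : ℕ → ℝ => s 0 := measurable_pi_apply 0
  have hint : Integrable (fun s : ℕ → ℝ => s 0) (P.map F) := by
    rw [integrable_map_measure hm0.aestronglyMeasurable hFm.aemeasurable]
    exact h.integrable_block hρ hi 0
  have hmean : Tendsto (fun n => ∫ s, |birkhoffAverage ℝ T (fun s => s 0) n s -
      ∫ ω, ρ (ψ 0 ω) ∂P| ∂(P.map F)) atTop (𝓝 0) := by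
    refine squeeze_zero (fun n => integral_nonneg fun s => abs_nonneg _) (fun n => ?_)
      (h.tendsto_average_obs hρ hi)
    refine le_trans (le_of_eq ?_) (h.norm_average_blockLp_le hρ hi n _)
    have hme : Measurable fun s : ℕ → ℝ =>
        |(n : ℝ)⁻¹ * (∑ j ∈ Finset.range n, s j) - ∫ ω, ρ (ψ 0 ω) ∂P| :=
      (((Finset.measurable_fun_sum _ fun j _ => measurable_pi_apply j).const_mul _).sub_const _).abs
    simp_rw [hav]
    rw [integral_map hFm.aemeasurable hme.aestronglyMeasurable, L1.norm_eq_integral_norm]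
    refine integral_congr_ae ?_
    have hall : ∀ᵐ ω ∂P, ∀ j : ℕ, h.blockLp hρ hi j ω = block ψ ρ j ω :=
      ae_all_iff.2 fun j => h.coeFn_blockLp hρ hi j
    filter_upwards [hall, Lp.coeFn_sub ((n : ℝ)⁻¹ • (∑ j ∈ Finset.range n, h.blockLp hρ hi j))
        (Lp.const 1 P (∫ ω, ρ (ψ 0 ω) ∂P)),
      Lp.coeFn_smul (n : ℝ)⁻¹ (∑ j ∈ Finset.range n, h.blockLp hρ hi j),
      Lp.coeFn_finsetSum (Finset.range n) (fun j : ℕ => h.blockLp hρ hi j),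
      Lp.coeFn_const (p := 1) (μ := P) (∫ ω, ρ (ψ 0 ω) ∂P)] with ω h1 h2 h3 h4 h5
    rw [h2, Pi.sub_apply, h3, Pi.smul_apply, h4, Finset.sum_apply, h5]
    simp [h1, hF]
  have hae := ae_of_ae_map hFm.aemeasurable (ae_tendsto_birkhoffAverage hTp hm0 hint hmean)
  filter_upwards [hae] with ω hω
  simpa only [hav] using hω

lemma ae_intervalIntegrable (h : IsMixingProcess P ψ) (hρ : Measurable ρ)
    (hi : Integrable (fun ω => ρ (ψ 0 ω)) P) :
    ∀ᵐ ω ∂P, ∀ a b : ℝ, 0 ≤ a → 0 ≤ b → IntervalIntegrable (fun t => ρ (ψ t ω)) volume a b := by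
  have h1 : ∀ᵐ ω ∂P, ∀ N : ℕ, IntegrableOn (fun t => ρ (ψ t ω)) (Ioc 0 (N : ℝ)) :=
    ae_all_iff.2 fun N => (integrable_uncurry_of_continuous_Lp (h.measurable_uncurry_obs hρ)
      (h.continuous_obs hρ hi) (h.coeFn_obs hρ hi) 0 N).prod_left_ae
  filter_upwards [h1] with ω hω a b ha hb
  obtain ⟨N, hN⟩ := exists_nat_ge (max a b)
  rw [intervalIntegrable_iff]
  refine (hω N).mono_set fun x hx => ?_
  rw [uIoc, mem_Ioc] at hx
  exact ⟨lt_of_le_of_lt (le_min ha hb) hx.1, hx.2.trans hN⟩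

/-- The pointwise ergodic theorem for stationary mixing processes. -/
theorem ae_tendsto_time_average (h : IsMixingProcess P ψ) (hρ : Measurable ρ)
    (hi : Integrable (fun ω => ρ (ψ 0 ω)) P) :
    ∀ᵐ ω ∂P, (∀ T : ℝ, 0 < T → IntervalIntegrable (fun t => ρ (ψ t ω)) volume 0 T) ∧
      Tendsto (fun T : ℝ => (1 / T) * ∫ t in (0 : ℝ)..T, ρ (ψ t ω)) atTop
        (𝓝 (∫ ω', ρ (ψ 0 ω') ∂P)) := by
  have hi' : Integrable (fun ω => |ρ (ψ 0 ω)|) P := hi.abs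
  filter_upwards [h.ae_intervalIntegrable hρ hi, h.ae_tendsto_average_block hρ hi,
    h.ae_tendsto_average_block hρ.abs hi'] with ω hint hG hK
  refine ⟨fun T hT => hint 0 T le_rfl hT.le, ?_⟩
  set f : ℝ → ℝ := fun t => ρ (ψ t ω) with hf
  set m := ∫ ω', ρ (ψ 0 ω') ∂P
  set m' := ∫ ω', |ρ (ψ 0 ω')| ∂P
  have hsum : ∀ n : ℕ, ∑ j ∈ Finset.range n, block ψ ρ j ω = ∫ t in (0 : ℝ)..n, f t := by
    intro n
    have := intervalIntegral.sum_integral_adjacent_intervals (f := f) (μ := volume)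
      (a := fun k : ℕ => (k : ℝ)) (n := n)
      fun k _ => hint k (k + 1 : ℕ) (Nat.cast_nonneg _) (Nat.cast_nonneg _)
    rw [Nat.cast_zero] at this
    rw [← this]
    exact Finset.sum_congr rfl fun j _ => by rw [block]; push_cast; rfl
  -- A convergent sequence of averages has sublinear increments. This is used for `|ρ|`, to dominate
  -- the incomplete block between `⌊T⌋₊` and `T`.
  have hKinc : Tendsto (fun n : ℕ => (n : ℝ)⁻¹ * block ψ (fun x => |ρ x|) n ω) atTop (𝓝 0) := by
    have h1 := hK.comp (tendsto_add_atTop_nat 1)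
    have h2 : Tendsto (fun n : ℕ => ((n + 1 : ℕ) : ℝ) / (n : ℝ)) atTop (𝓝 1) := by
      have := (tendsto_inv_atTop_nhds_zero_nat (𝕜 := ℝ)).const_add 1
      rw [add_zero] at this
      refine this.congr' ?_
      filter_upwards [eventually_gt_atTop 0] with n hn
      have : (n : ℝ) ≠ 0 := by positivity
      push_cast
      field_simp
    have h3 := (h2.mul h1).sub hK
    rw [one_mul, sub_self] at h3
    refine h3.congr' ?_
    filter_upwards [eventually_gt_atTop 0] with n hn
    have : (n : ℝ) ≠ 0 := by positivity
    simp only [Function.comp_def, Finset.sum_range_succ]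
    push_cast
    have h' : (n : ℝ) + 1 ≠ 0 := by positivity
    field_simp
    ring
  have hfl : Tendsto (fun T : ℝ => ⌊T⌋₊) atTop atTop := tendsto_nat_floor_atTop
  have hmain : Tendsto (fun T : ℝ => ((⌊T⌋₊ : ℝ) / T) *
      ((⌊T⌋₊ : ℝ)⁻¹ * ∑ j ∈ Finset.range ⌊T⌋₊, block ψ ρ j ω)) atTop (𝓝 m) := by
    have := (tendsto_nat_floor_div_atTop (R := ℝ)).mul (hG.comp hfl)
    rwa [one_mul] at this
  have herr : Tendsto (fun T : ℝ => (1 / T) * (∫ t in (0 : ℝ)..T, f t) - ((⌊T⌋₊ : ℝ) / T) *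
      ((⌊T⌋₊ : ℝ)⁻¹ * ∑ j ∈ Finset.range ⌊T⌋₊, block ψ ρ j ω)) atTop (𝓝 0) := by
    refine squeeze_zero_norm' ?_ (hKinc.comp hfl)
    filter_upwards [eventually_ge_atTop 1] with T hT
    have hT0 : 0 < T := by linarith
    have hn0 : 0 < ⌊T⌋₊ := Nat.floor_pos.2 hT
    have hn : (0 : ℝ) < ⌊T⌋₊ := by exact_mod_cast hn0
    have hle : (⌊T⌋₊ : ℝ) ≤ T := Nat.floor_le hT0.le
    have hlt : T ≤ (⌊T⌋₊ : ℝ) + 1 := (Nat.lt_floor_add_one T).le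
    have h1 : (1 / T) * (∫ t in (0 : ℝ)..T, f t) - ((⌊T⌋₊ : ℝ) / T) *
        ((⌊T⌋₊ : ℝ)⁻¹ * ∑ j ∈ Finset.range ⌊T⌋₊, block ψ ρ j ω) =
        (1 / T) * ∫ t in (⌊T⌋₊ : ℝ)..T, f t := by
      rw [hsum, ← intervalIntegral.integral_add_adjacent_intervals
        (hint 0 ⌊T⌋₊ le_rfl hn.le) (hint ⌊T⌋₊ T hn.le hT0.le)]
      field_simp
      ring
    have h2 : |∫ t in (⌊T⌋₊ : ℝ)..T, f t| ≤ block ψ (fun x => |ρ x|) ⌊T⌋₊ ω := by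
      refine (intervalIntegral.abs_integral_le_integral_abs hle).trans ?_
      exact intervalIntegral.integral_mono_interval le_rfl hle hlt
        (ae_of_all _ fun t => abs_nonneg _)
        (hint ⌊T⌋₊ (⌊T⌋₊ + 1) hn.le (by positivity)).abs
    rw [h1, Real.norm_eq_abs, abs_mul, abs_of_pos (one_div_pos.2 hT0), Function.comp_apply]
    have h3 : 1 / T ≤ (⌊T⌋₊ : ℝ)⁻¹ := by
      rw [one_div]
      exact inv_anti₀ hn hle
    exact mul_le_mul h3 h2 (abs_nonneg _) (by positivity)
  have := herr.add hmain
  rw [zero_add] at this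
  exact this.congr fun T => by ring

end IsMixingProcess

end

section

/-! ### Second order properties of the noise -/

variable {Ω : Type*} [MeasurableSpace Ω] {P : Measure Ω} [IsProbabilityMeasure P] {H : ℝ}

/-- The covariance function of a normalized real fractional Brownian motion. -/
def fbmCov (H t s : ℝ) : ℝ := (1 / 2) * (|t| ^ (2 * H) + |s| ^ (2 * H) - |t - s| ^ (2 * H))

/-- The covariance of two increments of a fractional Brownian motion. -/
def fbmIncrCov (H t s t' s' : ℝ) : ℝ :=
  fbmCov H t t' - fbmCov H t s' - fbmCov H s t' + fbmCov H s s'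

/-- The terms depending on a single time cancel in the mixed difference; only powers of time
differences remain. -/
lemma fbmIncrCov_add (H t s t' s' r : ℝ) :
    fbmIncrCov H (t + r) (s + r) (t' + r) (s' + r) = fbmIncrCov H t s t' s' := by
  simp only [fbmIncrCov, fbmCov, add_sub_add_right_eq_sub]
  ring

lemma fbmIncrCov_self (hH : 0 < H) (t s : ℝ) : fbmIncrCov H t s t s = |t - s| ^ (2 * H) := by
  have h0 : (0 : ℝ) ^ (2 * H) = 0 := Real.zero_rpow (by positivity)
  simp only [fbmIncrCov, fbmCov, sub_self, abs_zero, h0, abs_sub_comm s t]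
  ring

lemma clm_complex_apply (m : ℂ →L[ℝ] ℝ) (z : ℂ) : m z = m 1 * z.re + m Complex.I * z.im := by
  conv_lhs => rw [← Complex.re_add_im z]
  have h : (z.re : ℂ) + z.im * Complex.I = z.re • (1 : ℂ) + z.im • Complex.I := by
    simp [Complex.real_smul]
  rw [h, map_add, map_smul, map_smul, smul_eq_mul, smul_eq_mul]
  ring

namespace IsFractionalBM

variable {X : ℝ → Ω → ℝ}

lemma memLp (h : IsFractionalBM H X P) (t : ℝ) : MemLp (X t) 2 P :=
  (h.gaussian.hasGaussianLaw_eval t).memLp_two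

end IsFractionalBM

namespace IsComplexFractionalBM

variable {b : ℝ → Ω → ℂ}

lemma re_eq (t : ℝ) : (fun ω => (b t ω).re) = fun ω => (√2)⁻¹ * (√2 * (b t ω).re) := by
  ext ω
  rw [inv_mul_cancel_left₀ (by positivity)]

lemma im_eq (t : ℝ) : (fun ω => (b t ω).im) = fun ω => (√2)⁻¹ * (√2 * (b t ω).im) := by
  ext ω
  rw [inv_mul_cancel_left₀ (by positivity)]

lemma memLp_re (h : IsComplexFractionalBM H b P) (t : ℝ) : MemLp (fun ω => (b t ω).re) 2 P := by
  rw [re_eq t]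
  exact (h.re.memLp t).const_mul _

lemma memLp_im (h : IsComplexFractionalBM H b P) (t : ℝ) : MemLp (fun ω => (b t ω).im) 2 P := by
  rw [im_eq t]
  exact (h.im.memLp t).const_mul _

lemma measurable_re (h : IsComplexFractionalBM H b P) (t : ℝ) :
    Measurable fun ω => (b t ω).re := by
  rw [re_eq t]
  exact (h.re.measurable t).const_mul _

lemma measurable_im (h : IsComplexFractionalBM H b P) (t : ℝ) :
    Measurable fun ω => (b t ω).im := by
  rw [im_eq t]
  exact (h.im.measurable t).const_mul _

lemma measurable (h : IsComplexFractionalBM H b P) (t : ℝ) : Measurable (b t) := by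
  have h1 : b t = fun ω => ((b t ω).re : ℂ) + (b t ω).im * Complex.I := by
    ext ω
    exact (Complex.re_add_im _).symm
  rw [h1]
  exact (Complex.measurable_ofReal.comp (h.measurable_re t)).add
    ((Complex.measurable_ofReal.comp (h.measurable_im t)).mul_const _)

lemma memLp (h : IsComplexFractionalBM H b P) (t : ℝ) : MemLp (b t) 2 P :=
  memLp_re_im_iff.1 ⟨h.memLp_re t, h.memLp_im t⟩

lemma integral_re (h : IsComplexFractionalBM H b P) (t : ℝ) : ∫ ω, (b t ω).re ∂P = 0 := by
  rw [re_eq t, integral_const_mul, h.re.mean t, mul_zero]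

lemma integral_im (h : IsComplexFractionalBM H b P) (t : ℝ) : ∫ ω, (b t ω).im ∂P = 0 := by
  rw [im_eq t, integral_const_mul, h.im.mean t, mul_zero]

lemma integral_re_mul_re (h : IsComplexFractionalBM H b P) (t s : ℝ) :
    ∫ ω, (b t ω).re * (b s ω).re ∂P = fbmCov H t s / 2 := by
  have h2 : √2 * √2 = 2 := Real.mul_self_sqrt (by norm_num)
  have h1 := h.re.cov t s
  have h3 : (fun ω => √2 * (b t ω).re * (√2 * (b s ω).re)) =
      fun ω => 2 * ((b t ω).re * (b s ω).re) := by
    ext ω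
    linear_combination ((b t ω).re * (b s ω).re) * h2
  rw [h3, integral_const_mul] at h1
  rw [fbmCov]
  linarith

lemma integral_im_mul_im (h : IsComplexFractionalBM H b P) (t s : ℝ) :
    ∫ ω, (b t ω).im * (b s ω).im ∂P = fbmCov H t s / 2 := by
  have h2 : √2 * √2 = 2 := Real.mul_self_sqrt (by norm_num)
  have h1 := h.im.cov t s
  have h3 : (fun ω => √2 * (b t ω).im * (√2 * (b s ω).im)) =
      fun ω => 2 * ((b t ω).im * (b s ω).im) := by
    ext ω
    linear_combination ((b t ω).im * (b s ω).im) * h2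
  rw [h3, integral_const_mul] at h1
  rw [fbmCov]
  linarith

lemma integral_re_mul_im (h : IsComplexFractionalBM H b P) (t s : ℝ) :
    ∫ ω, (b t ω).re * (b s ω).im ∂P = 0 := by
  have hi : IndepFun (fun ω => (b t ω).re) (fun ω => (b s ω).im) P :=
    h.indep.comp (measurable_pi_apply t) (measurable_pi_apply s)
  rw [hi.integral_fun_mul_eq_mul_integral (h.measurable_re t).aestronglyMeasurable
    (h.measurable_im s).aestronglyMeasurable, h.integral_re, zero_mul]

lemma integral_clm (h : IsComplexFractionalBM H b P) (m : ℂ →L[ℝ] ℝ) (t : ℝ) :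
    ∫ ω, m (b t ω) ∂P = 0 := by
  simp only [clm_complex_apply m (b t _)]
  rw [integral_add (((h.memLp_re t).integrable one_le_two).const_mul _)
    (((h.memLp_im t).integrable one_le_two).const_mul _), integral_const_mul, integral_const_mul,
    h.integral_re, h.integral_im, mul_zero, mul_zero, add_zero]

/-- Real and imaginary parts are independent and centred, so the cross terms vanish; each part
carries half of the covariance. -/
lemma integral_clm_mul_clm (h : IsComplexFractionalBM H b P) (m m' : ℂ →L[ℝ] ℝ) (t s : ℝ) :
    ∫ ω, m (b t ω) * m' (b s ω) ∂P =
      ((m 1 * m' 1 + m Complex.I * m' Complex.I) / 2) * fbmCov H t s := by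
  have hI : ∀ {f g : Ω → ℝ} (a : ℝ), MemLp f 2 P → MemLp g 2 P →
      Integrable (fun ω => a * (f ω * g ω)) P := fun a hf hg => (hf.integrable_mul hg).const_mul a
  have hadd : ∀ {f g : Ω → ℝ}, Integrable f P → Integrable g P →
      Integrable (fun ω => f ω + g ω) P := fun hf hg => hf.add hg
  have hexp : (fun ω => m (b t ω) * m' (b s ω)) = fun ω =>
      (m 1 * m' 1 * ((b t ω).re * (b s ω).re) +
        m Complex.I * m' Complex.I * ((b t ω).im * (b s ω).im)) +
      (m 1 * m' Complex.I * ((b t ω).re * (b s ω).im) +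
        m Complex.I * m' 1 * ((b s ω).re * (b t ω).im)) := by
    ext ω
    rw [clm_complex_apply m (b t ω), clm_complex_apply m' (b s ω)]
    ring
  have hrr := hI (m 1 * m' 1) (h.memLp_re t) (h.memLp_re s)
  have hii := hI (m Complex.I * m' Complex.I) (h.memLp_im t) (h.memLp_im s)
  have hri := hI (m 1 * m' Complex.I) (h.memLp_re t) (h.memLp_im s)
  have hir := hI (m Complex.I * m' 1) (h.memLp_re s) (h.memLp_im t)
  rw [hexp, integral_add (hadd hrr hii) (hadd hri hir), integral_add hrr hii, integral_add hri hir]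
  simp only [integral_const_mul]
  rw [h.integral_re_mul_re, h.integral_im_mul_im, h.integral_re_mul_im, h.integral_re_mul_im]
  ring

/-- The process as a curve in `L²`. -/
def curve (h : IsComplexFractionalBM H b P) (t : ℝ) : Lp ℂ 2 P := (h.memLp t).toLp

lemma coeFn_curve (h : IsComplexFractionalBM H b P) (t : ℝ) : h.curve t =ᵐ[P] b t :=
  MemLp.coeFn_toLp _

/-- A real linear functional of the process is Gaussian. -/
lemma hasGaussianLaw_sum (h : IsComplexFractionalBM H b P) (T : Finset ℝ) (c d : ℝ → ℝ) :
    HasGaussianLaw (fun ω => ∑ t ∈ T, (c t * (b t ω).re + d t * (b t ω).im)) P := by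
  have h1 : HasGaussianLaw (fun ω => ∑ t ∈ T, c t * (b t ω).re) P := by
    have := (h.re.gaussian.smul fun t => c t * (√2)⁻¹).hasGaussianLaw_fun_sum (I := T)
    refine this.congr (ae_of_all _ fun ω => Finset.sum_congr rfl fun t _ => ?_)
    rw [smul_eq_mul, mul_assoc, inv_mul_cancel_left₀ (by positivity)]
  have h2 : HasGaussianLaw (fun ω => ∑ t ∈ T, d t * (b t ω).im) P := by
    have := (h.im.gaussian.smul fun t => d t * (√2)⁻¹).hasGaussianLaw_fun_sum (I := T)
    refine this.congr (ae_of_all _ fun ω => Finset.sum_congr rfl fun t _ => ?_)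
    rw [smul_eq_mul, mul_assoc, inv_mul_cancel_left₀ (by positivity)]
  have hm : ∀ c : ℝ → ℝ, Measurable fun x : ℝ → ℝ => ∑ t ∈ T, c t * x t := fun c =>
    Finset.measurable_fun_sum _ fun t _ => (measurable_pi_apply t).const_mul _
  have hi : IndepFun (fun ω => ∑ t ∈ T, c t * (b t ω).re) (fun ω => ∑ t ∈ T, d t * (b t ω).im) P :=
    h.indep.comp (hm c) (hm d)
  refine (hi.hasGaussianLaw h1 h2).fun_add.congr (ae_of_all _ fun ω => ?_)
  exact Finset.sum_add_distrib.symm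

end IsComplexFractionalBM

lemma norm_sq_eq_re_im (z : Lp ℂ 2 P) :
    ‖z‖ ^ 2 = ‖Complex.reCLM.compLpL 2 P z‖ ^ 2 + ‖Complex.imCLM.compLpL 2 P z‖ ^ 2 := by
  have h : ∀ {E : Type} [NormedAddCommGroup E] [InnerProductSpace ℝ E] (f : Lp E 2 P),
      ‖f‖ ^ 2 = ∫ ω, ‖f ω‖ ^ 2 ∂P := fun f => by
    rw [← real_inner_self_eq_norm_sq, L2.inner_def]
    simp only [real_inner_self_eq_norm_sq]
  have hint : ∀ {E : Type} [NormedAddCommGroup E] (f : Lp E 2 P),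
      Integrable (fun ω => ‖f ω‖ ^ 2) P := fun f =>
    (memLp_two_iff_integrable_sq_norm (Lp.aestronglyMeasurable f)).1 (Lp.memLp f)
  rw [h, h, h, ← integral_add (hint _) (hint _)]
  refine integral_congr_ae ?_
  filter_upwards [Complex.reCLM.coeFn_compLpL (p := 2) z,
    Complex.imCLM.coeFn_compLpL (p := 2) z] with ω h1 h2
  rw [h1, h2, Complex.sq_norm, Complex.normSq_apply]
  simp [sq]

lemma inner_compLpL_toLp {f g : Ω → ℂ} (hf : MemLp f 2 P) (hg : MemLp g 2 P) (m m' : ℂ →L[ℝ] ℝ) :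
    ⟪m.compLpL 2 P hf.toLp, m'.compLpL 2 P hg.toLp⟫_ℝ = ∫ ω, m (f ω) * m' (g ω) ∂P := by
  rw [L2.inner_def]
  refine integral_congr_ae ?_
  filter_upwards [m.coeFn_compLpL (p := 2) hf.toLp, m'.coeFn_compLpL (p := 2) hg.toLp,
    hf.coeFn_toLp, hg.coeFn_toLp] with ω h1 h2 h3 h4
  rw [h1, h2, h3, h4, RCLike.inner_apply, conj_trivial, mul_comm]

namespace IsComplexFractionalBM

variable {b : ℝ → Ω → ℂ}

/-- The real and imaginary increments each have variance `|t - s|^{2H} / 2`, so the bound is in fact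
an equality, with constant `1`. -/
lemma isHolderCurve (h : IsComplexFractionalBM H b P) (hH : 0 < H) :
    IsHolderCurve 1 H h.curve := by
  intro t s
  have hk : ∀ m : ℂ →L[ℝ] ℝ, ‖m.compLpL 2 P (h.curve t - h.curve s)‖ ^ 2 =
      ((m 1 * m 1 + m Complex.I * m Complex.I) / 2) * |t - s| ^ (2 * H) := by
    intro m
    have hc : ∀ t s, ⟪m.compLpL 2 P (h.curve t), m.compLpL 2 P (h.curve s)⟫_ℝ =
        ((m 1 * m 1 + m Complex.I * m Complex.I) / 2) * fbmCov H t s := fun t s =>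
      (inner_compLpL_toLp _ _ _ _).trans (h.integral_clm_mul_clm _ _ _ _)
    rw [← real_inner_self_eq_norm_sq, map_sub, inner_sub_left, inner_sub_right, inner_sub_right,
      hc, hc, hc, hc, ← fbmIncrCov_self hH, fbmIncrCov]
    ring
  have h1 : ‖h.curve t - h.curve s‖ ^ 2 = (|t - s| ^ H) ^ 2 := by
    rw [norm_sq_eq_re_im, hk, hk, ← Real.rpow_natCast (|t - s| ^ H) 2, ← Real.rpow_mul (abs_nonneg _)]
    simp only [Complex.reCLM_apply, Complex.imCLM_apply, Complex.one_re, Complex.one_im,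
      Complex.I_re, Complex.I_im]
    rw [show 2 * H = H * (2 : ℕ) by push_cast; ring]
    ring
  rw [one_mul]
  exact ((sq_eq_sq₀ (norm_nonneg _) (by positivity)).1 h1).le

end IsComplexFractionalBM

end

/-! ### Asymptotic decorrelation and the Gaussian space of the noise -/

section

variable {Ω : Type*} [MeasurableSpace Ω] {P : Measure Ω} [IsProbabilityMeasure P] {H : ℝ}

lemma Mode.neg_neg (k : Mode) : -(-k) = k := Subtype.ext (_root_.neg_neg k.1)

lemma Mode.neg_ne (k : Mode) : -k ≠ k := by
  intro h
  refine k.2 (funext fun i => ?_)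
  have h1 : -k.1 = k.1 := congrArg Subtype.val h
  have h2 : -(k.1 i) = k.1 i := congrFun h1 i
  simp only [Pi.zero_apply]
  omega

/-- The lexicographically positive half plane. On it the coordinates are independent, and
conjugation recovers the rest. -/
lemma exists_half_modes : ∃ J : Set Mode, (∀ k ∈ J, -k ∉ J) ∧ ∀ k, k ∈ J ∨ -k ∈ J := by
  refine ⟨{k | 0 < k.1 0 ∨ (k.1 0 = 0 ∧ 0 < k.1 1)}, fun k hk hk' => ?_, fun k => ?_⟩
  · have h0 : (-k).1 0 = -(k.1 0) := rfl
    have h1 : (-k).1 1 = -(k.1 1) := rfl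
    simp only [mem_ofPred_eq, h0, h1] at hk hk'
    omega
  · have h0 : (-k).1 0 = -(k.1 0) := rfl
    have h1 : (-k).1 1 = -(k.1 1) := rfl
    have h2 : ¬(k.1 0 = 0 ∧ k.1 1 = 0) := fun h =>
      k.2 (funext fun i => by fin_cases i <;> simp [h.1, h.2])
    simp only [mem_ofPred_eq, h0, h1]
    omega

lemma tendsto_sub_of_tendsto_deriv_zero {f f' : ℝ → ℝ} (hf : ∀ t, 0 < t → HasDerivAt f (f' t) t)
    (hf' : Tendsto f' atTop (𝓝 0)) (a : ℝ) :
    Tendsto (fun t => f t - f (t - a)) atTop (𝓝 0) := by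
  rw [Metric.tendsto_atTop]
  intro ε hε
  obtain ⟨N, hN⟩ := Metric.tendsto_atTop.1 hf' (ε / (|a| + 1)) (by positivity)
  refine ⟨max N 1 + |a|, fun t ht => ?_⟩
  have hb : ∀ x ∈ Icc (t - |a|) (t + |a|), 0 < x ∧ N ≤ x := fun x hx => by
    have h1 := le_max_left N 1
    have h2 := le_max_right N 1
    constructor <;> linarith [hx.1]
  have := (convex_Icc (t - |a|) (t + |a|)).norm_image_sub_le_of_norm_hasDerivWithin_le
    (f := f) (f' := f') (C := ε / (|a| + 1)) (x := t - a) (y := t)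
    (fun x hx => (hf x (hb x hx).1).hasDerivWithinAt)
    (fun x hx => by simpa [dist_eq_norm] using (hN x (hb x hx).2).le)
    ⟨by linarith [le_abs_self a], by linarith [neg_abs_le a]⟩
    ⟨by linarith [abs_nonneg a], by linarith [abs_nonneg a]⟩
  rw [dist_zero_right]
  refine this.trans_lt ?_
  rw [sub_sub_cancel, Real.norm_eq_abs, div_mul_eq_mul_div, div_lt_iff₀ (by positivity)]
  nlinarith [abs_nonneg a]

/-- The expression is half a second difference of `|t|^{2H}`, whose second derivative is of order
`t^{2H-2}` and vanishes at infinity because `H < 1`. The mean value inequality is used twice, once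
for each difference. -/
lemma tendsto_fbmCov_sub (hH : H ∈ Ioo (0 : ℝ) 1) (r s : ℝ) :
    Tendsto (fun t => fbmCov H t s - fbmCov H (t - r) s) atTop (𝓝 0) := by
  set p := 2 * H
  have hp : p < 2 := by have := hH.2; simp only [p]; linarith
  have hd : ∀ q t : ℝ, 0 < t → HasDerivAt (fun x : ℝ => |x| ^ q) (q * |t| ^ (q - 1)) t := by
    intro q t ht
    have := Real.hasDerivAt_rpow_const (p := q) (Or.inl ht.ne')
    rw [abs_of_pos ht]
    refine this.congr_of_eventuallyEq ?_
    filter_upwards [eventually_gt_nhds ht] with x hx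
    rw [abs_of_pos hx]
  have h2 : Tendsto (fun t : ℝ => p * ((p - 1) * |t| ^ (p - 1 - 1))) atTop (𝓝 0) := by
    have h := tendsto_rpow_neg_atTop (y := 2 - p) (by linarith)
    have h' := (h.const_mul (p - 1)).const_mul p
    rw [mul_zero, mul_zero] at h'
    refine h'.congr' ?_
    filter_upwards [eventually_gt_atTop 0] with t ht
    rw [abs_of_pos ht]
    ring_nf
  have h1 : Tendsto (fun t : ℝ => p * |t| ^ (p - 1) - p * |t - r| ^ (p - 1)) atTop (𝓝 0) :=
    tendsto_sub_of_tendsto_deriv_zero (f := fun t => p * |t| ^ (p - 1))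
      (fun t ht => (hd (p - 1) t ht).const_mul p) h2 r
  set g : ℝ → ℝ := fun t => |t| ^ p - |t - r| ^ p
  have hg : Tendsto (fun t => g t - g (t - s)) atTop (𝓝 0) := by
    -- The shift by `|r|` keeps both `t` and `t - r` away from the singularity of the power at `0`.
    have h3 := tendsto_sub_of_tendsto_deriv_zero (f := fun t => g (t + |r|))
      (f' := fun t => p * |(t + |r|)| ^ (p - 1) - p * |(t + |r| - r)| ^ (p - 1)) (fun t ht => by
        have ha := (hd p (t + |r|) (by positivity)).comp_add_const t |r|
        have hb := (hd p (t + |r| - r) (by linarith [le_abs_self r])).comp_sub_const (t + |r|) r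
        exact ha.sub (hb.comp_add_const t |r|))
      (h1.comp (tendsto_atTop_add_const_right _ |r| tendsto_id)) s
    refine (h3.comp (tendsto_atTop_add_const_right _ (-|r|) tendsto_id)).congr fun t => ?_
    simp only [Function.comp_apply, id, g]
    ring_nf
  have := hg.const_mul (1 / 2)
  rw [mul_zero] at this
  refine this.congr fun t => ?_
  simp only [fbmCov, g, p]
  rw [sub_right_comm t r s]
  ring

lemma integral_norm_le_norm_L2 (p : Lp ℝ 2 P) : ∫ ω, ‖p ω‖ ∂P ≤ ‖p‖ := by
  rw [Lp.norm_def, integral_norm_eq_lintegral_enorm (Lp.aestronglyMeasurable _),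
    ← eLpNorm_one_eq_lintegral_enorm]
  exact ENNReal.toReal_mono (Lp.memLp p).2.ne
    (eLpNorm_le_eLpNorm_of_exponent_le one_le_two (Lp.aestronglyMeasurable _))

lemma continuous_charFun_L2 : Continuous fun p : Lp ℝ 2 P => ∫ ω, Complex.exp (p ω * Complex.I) ∂P := by
  have hi : ∀ p : Lp ℝ 2 P, Integrable (fun ω => Complex.exp (p ω * Complex.I)) P := fun p =>
    Integrable.of_bound (Complex.continuous_exp.comp_aestronglyMeasurable
      ((Complex.continuous_ofReal.comp_aestronglyMeasurable
        (Lp.aestronglyMeasurable p)).mul_const _)) 1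
      (ae_of_all _ fun ω => (Complex.norm_exp_ofReal_mul_I _).le)
  refine LipschitzWith.continuous (K := 1) (LipschitzWith.of_dist_le_mul fun p q => ?_)
  rw [NNReal.coe_one, one_mul, dist_eq_norm, dist_eq_norm, ← integral_sub (hi p) (hi q)]
  refine (norm_integral_le_integral_norm _).trans (le_trans ?_ (integral_norm_le_norm_L2 (p - q)))
  refine integral_mono_ae ((hi p).sub (hi q)).norm ((Lp.memLp _).integrable one_le_two).norm ?_
  filter_upwards [Lp.coeFn_sub p q] with ω hω
  rw [hω, Pi.sub_apply, Real.norm_eq_abs]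
  exact norm_trig_sub_le (ContinuousLinearMap.id ℝ ℝ) (p ω) (q ω)

namespace IsInfiniteDimFractionalBM

variable {β : Mode → ℝ → Ω → ℂ}

/-- The coordinates of the noise as curves in `L²`. -/
def curve (h : IsInfiniteDimFractionalBM H β P) (k : Mode) : ℝ → Lp ℂ 2 P :=
  (h.complexFBM k).curve

lemma coeFn_curve (h : IsInfiniteDimFractionalBM H β P) (k : Mode) (t : ℝ) :
    h.curve k t =ᵐ[P] β k t := (h.complexFBM k).coeFn_curve t

lemma isHolderCurve (h : IsInfiniteDimFractionalBM H β P) (hH : 0 < H) (k : Mode) :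
    IsHolderCurve 1 H (h.curve k) := (h.complexFBM k).isHolderCurve hH

lemma compLpL_curve_neg (h : IsInfiniteDimFractionalBM H β P) (m : ℂ →L[ℝ] ℝ) (k : Mode) (t : ℝ) :
    m.compLpL 2 P (h.curve (-k) t) =
      (m.comp (Complex.conjCLE : ℂ →L[ℝ] ℂ)).compLpL 2 P (h.curve k t) := by
  refine Lp.ext ?_
  filter_upwards [m.coeFn_compLpL (p := 2) (h.curve (-k) t),
    (m.comp (Complex.conjCLE : ℂ →L[ℝ] ℂ)).coeFn_compLpL (p := 2) (h.curve k t),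
    h.coeFn_curve (-k) t, h.coeFn_curve k t, h.conj k t] with ω h1 h2 h3 h4 h5
  rw [h1, h2, h3, h4, h5]
  rfl

lemma indepFun (h : IsInfiniteDimFractionalBM H β P) {k l : Mode} (hkl : l ≠ k) (hkl' : l ≠ -k) :
    IndepFun (fun ω t => β k t ω) (fun ω t => β l t ω) P := by
  have hlk : -l ≠ k := fun h' => hkl' (by rw [← h', Mode.neg_neg])
  have := h.indep {k, l} (by
    rintro j (rfl | rfl) (h' | h')
    · exact Mode.neg_ne _ h'
    · exact hkl' h'.symm
    · exact hlk h'
    · exact Mode.neg_ne _ h')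
  exact this.indepFun (i := ⟨k, by simp⟩) (j := ⟨l, by simp⟩) fun h' => hkl (congrArg Subtype.val h').symm

/-- Modes `k` and `-k` are conjugate and all other pairs are independent, so every joint covariance
is a multiple of the single function `fbmCov`. -/
lemma exists_inner_curve (h : IsInfiniteDimFractionalBM H β P) (m m' : ℂ →L[ℝ] ℝ) (k l : Mode) :
    ∃ a : ℝ, ∀ t s, ⟪m.compLpL 2 P (h.curve k t), m'.compLpL 2 P (h.curve l s)⟫_ℝ =
      a * fbmCov H t s := by
  have hk : ∀ m' : ℂ →L[ℝ] ℝ, ∃ a : ℝ, ∀ t s,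
      ⟪m.compLpL 2 P (h.curve k t), m'.compLpL 2 P (h.curve k s)⟫_ℝ = a * fbmCov H t s :=
    fun m' => ⟨_, fun t s => (inner_compLpL_toLp ((h.complexFBM k).memLp t)
      ((h.complexFBM k).memLp s) m m').trans ((h.complexFBM k).integral_clm_mul_clm m m' t s)⟩
  by_cases h1 : l = k
  · rw [h1]
    exact hk m'
  by_cases h2 : l = -k
  · rw [h2]
    simp only [h.compLpL_curve_neg]
    exact hk _
  refine ⟨0, fun t s => (inner_compLpL_toLp ((h.complexFBM k).memLp t)
    ((h.complexFBM l).memLp s) m m').trans ?_⟩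
  have hi : IndepFun (fun ω => m (β k t ω)) (fun ω => m' (β l s ω)) P :=
    (h.indepFun h1 h2).comp (m.continuous.measurable.comp (measurable_pi_apply t))
      (m'.continuous.measurable.comp (measurable_pi_apply s))
  rw [hi.integral_fun_mul_eq_mul_integral
    (m.continuous.measurable.comp ((h.complexFBM k).measurable t)).aestronglyMeasurable
    (m'.continuous.measurable.comp ((h.complexFBM l).measurable s)).aestronglyMeasurable,
    (h.complexFBM k).integral_clm, zero_mul, zero_mul]

lemma inner_increments_shift (h : IsInfiniteDimFractionalBM H β P) (m m' : ℂ →L[ℝ] ℝ) (k l : Mode)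
    (t s r q d : ℝ) :
    ⟪m.compLpL 2 P (h.curve k (t + d) - h.curve k (t + d - r)),
      m'.compLpL 2 P (h.curve l (s + d) - h.curve l (s + d - q))⟫_ℝ =
    ⟪m.compLpL 2 P (h.curve k t - h.curve k (t - r)),
      m'.compLpL 2 P (h.curve l s - h.curve l (s - q))⟫_ℝ := by
  obtain ⟨a, ha⟩ := h.exists_inner_curve m m' k l
  have hinc : ∀ t t' s s', ⟪m.compLpL 2 P (h.curve k t - h.curve k t'),
      m'.compLpL 2 P (h.curve l s - h.curve l s')⟫_ℝ = a * fbmIncrCov H t t' s s' := by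
    intro t t' s s'
    rw [map_sub, map_sub, inner_sub_left, inner_sub_right, inner_sub_right, ha, ha, ha, ha,
      fbmIncrCov]
    ring
  rw [hinc, hinc, add_sub_right_comm, add_sub_right_comm, fbmIncrCov_add]

lemma tendsto_inner_increments (h : IsInfiniteDimFractionalBM H β P) (hH : H ∈ Ioo (0 : ℝ) 1)
    (m m' : ℂ →L[ℝ] ℝ) (k l : Mode) (r s : ℝ) :
    Tendsto (fun t => ⟪m.compLpL 2 P (h.curve k t - h.curve k (t - r)),
      m'.compLpL 2 P (h.curve l s)⟫_ℝ) atTop (𝓝 0) := by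
  obtain ⟨a, ha⟩ := h.exists_inner_curve m m' k l
  have := (tendsto_fbmCov_sub hH r s).const_mul a
  rw [mul_zero] at this
  refine this.congr fun t => ?_
  rw [map_sub, inner_sub_left, ha, ha]
  ring

/-- The closed real span of the noise in `L²`. -/
def gaussianSpace (h : IsInfiniteDimFractionalBM H β P) : Submodule ℝ (Lp ℝ 2 P) :=
  (Submodule.span ℝ {Z | ∃ (m : ℂ →L[ℝ] ℝ) (k : Mode) (t : ℝ),
    Z = m.compLpL 2 P (h.curve k t)}).topologicalClosure

/-- A sum of independent Gaussian contributions, one for each mode, is Gaussian; it is centred, so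
its variance is the squared `L²` norm. -/
lemma charFun_sum (h : IsInfiniteDimFractionalBM H β P) {J : Set Mode} (hJ : ∀ k ∈ J, -k ∉ J)
    (F : Finset J) (T : Finset ℝ) (c d : J → ℝ → ℝ) (Z : Lp ℝ 2 P)
    (hZ : Z =ᵐ[P] fun ω => ∑ k ∈ F, ∑ t ∈ T, (c k t * (β k t ω).re + d k t * (β k t ω).im)) :
    ∫ ω, Complex.exp (Z ω * Complex.I) ∂P = Complex.exp (-(‖Z‖ ^ 2 / 2 : ℝ)) := by
  set g : J → (ℝ → ℂ) → ℝ := fun k x => ∑ t ∈ T, (c k t * (x t).re + d k t * (x t).im)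
  have hgm : ∀ k, Measurable (g k) := fun k => Finset.measurable_fun_sum _ fun t _ =>
    ((Complex.measurable_re.comp (measurable_pi_apply t)).const_mul _).add
      ((Complex.measurable_im.comp (measurable_pi_apply t)).const_mul _)
  have hG : HasGaussianLaw (fun ω => ∑ k : F, g k (fun t => β k.1 t ω)) P := by
    refine (iIndepFun.hasGaussianLaw (X := fun (k : F) ω => g k (fun t => β k.1 t ω))
      (fun k => (h.complexFBM k.1).hasGaussianLaw_sum T (c k) (d k)) ?_).fun_sum
    exact ((h.indep J hJ).precomp (g := fun k : F => k.1) Subtype.val_injective).comp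
      (fun k : F => g k.1) fun k => hgm k.1
  have hG' : HasGaussianLaw Z P := hG.congr (by
    filter_upwards [hZ] with ω hω
    rw [hω, ← Finset.sum_coe_sort F])
  have hmean : ∫ ω, Z ω ∂P = 0 := by
    rw [integral_congr_ae hZ]
    have hi : ∀ k t, Integrable (fun ω => c k t * (β k t ω).re + d k t * (β k t ω).im) P :=
      fun k t => ((((h.complexFBM k).memLp_re t).integrable one_le_two).const_mul _).add
        ((((h.complexFBM k).memLp_im t).integrable one_le_two).const_mul _)
    rw [integral_finsetSum _ fun k _ => integrable_finsetSum _ fun t _ => hi k t]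
    refine Finset.sum_eq_zero fun k _ => ?_
    rw [integral_finsetSum _ fun t _ => hi k t]
    refine Finset.sum_eq_zero fun t _ => ?_
    rw [integral_add ((((h.complexFBM k).memLp_re t).integrable one_le_two).const_mul _)
      ((((h.complexFBM k).memLp_im t).integrable one_le_two).const_mul _), integral_const_mul,
      integral_const_mul, (h.complexFBM k).integral_re, (h.complexFBM k).integral_im]
    simp
  have hvar : Var[Z; P] = ‖Z‖ ^ 2 := by
    rw [variance_of_integral_eq_zero hG'.aemeasurable hmean, ← real_inner_self_eq_norm_sq,
      L2.inner_def]
    exact integral_congr_ae (ae_of_all _ fun ω => by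
      simp only [RCLike.inner_apply, conj_trivial, sq])
  have h1 := hG'.charFunDual_map_eq_fun (ContinuousLinearMap.id ℝ ℝ)
  simp only [ContinuousLinearMap.id_apply] at h1
  have h2 : charFunDual (P.map Z) (ContinuousLinearMap.id ℝ ℝ) =
      ∫ ω, Complex.exp (Z ω * Complex.I) ∂P := by
    rw [charFunDual_apply, integral_map hG'.aemeasurable (by fun_prop)]
    rfl
  rw [← h2, h1, hmean]
  change Complex.exp (_ - (Var[Z; P] : ℂ) / 2) = _
  rw [hvar]
  congr 1
  push_cast
  ring

/-- Both sides are continuous in `L²`, so it suffices to treat the span. There, conjugate modes are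
first eliminated, leaving a combination of independent coordinates indexed by a half plane. -/
lemma charFun_gaussianSpace (h : IsInfiniteDimFractionalBM H β P) {Z : Lp ℝ 2 P}
    (hZ : Z ∈ h.gaussianSpace) :
    ∫ ω, Complex.exp (Z ω * Complex.I) ∂P = Complex.exp (-(‖Z‖ ^ 2 / 2 : ℝ)) := by
  have hcl : IsClosed {Z : Lp ℝ 2 P | ∫ ω, Complex.exp (Z ω * Complex.I) ∂P =
      Complex.exp (-(‖Z‖ ^ 2 / 2 : ℝ))} :=
    isClosed_eq continuous_charFun_L2 (by fun_prop)
  refine closure_minimal ?_ hcl (SetLike.mem_coe.2 hZ)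
  intro Z hZ
  obtain ⟨J, hJ, hJ'⟩ := exists_half_modes
  set v : J × ℝ × Bool → Lp ℝ 2 P := fun i =>
    bif i.2.2 then Complex.reCLM.compLpL 2 P (h.curve i.1 i.2.1)
      else Complex.imCLM.compLpL 2 P (h.curve i.1 i.2.1) with hv
  have hvJ : ∀ (m : ℂ →L[ℝ] ℝ) (k : J) (t : ℝ), m.compLpL 2 P (h.curve k t) ∈
      Submodule.span ℝ (range v) := by
    intro m k t
    have : m.compLpL 2 P (h.curve k t) = m 1 • v (k, t, true) + m Complex.I • v (k, t, false) := by
      refine Lp.ext ?_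
      filter_upwards [m.coeFn_compLpL (p := 2) (h.curve k t),
        Complex.reCLM.coeFn_compLpL (p := 2) (h.curve k t),
        Complex.imCLM.coeFn_compLpL (p := 2) (h.curve k t),
        Lp.coeFn_add (m 1 • v (k, t, true)) (m Complex.I • v (k, t, false)),
        Lp.coeFn_smul (m 1) (v (k, t, true)), Lp.coeFn_smul (m Complex.I) (v (k, t, false))]
        with ω h1 h2 h3 h4 h5 h6
      rw [h1, h4, Pi.add_apply, h5, h6, Pi.smul_apply, Pi.smul_apply]
      simp only [hv, cond_true, cond_false]
      rw [h2, h3]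
      exact clm_complex_apply m _
    rw [this]
    exact Submodule.add_mem _
      (Submodule.smul_mem _ _ (Submodule.subset_span (mem_range_self _)))
      (Submodule.smul_mem _ _ (Submodule.subset_span (mem_range_self _)))
  have hZ' : Z ∈ Submodule.span ℝ (range v) := by
    refine Submodule.span_le.2 ?_ hZ
    rintro _ ⟨m, k, t, rfl⟩
    rcases hJ' k with hk | hk
    · exact hvJ m ⟨k, hk⟩ t
    · rw [← Mode.neg_neg k, h.compLpL_curve_neg]
      exact hvJ _ ⟨-k, hk⟩ t
  obtain ⟨c, rfl⟩ := Finsupp.mem_span_range_iff_exists_finsupp.1 hZ'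
  classical
  set F : Finset J := c.support.image fun i => i.1
  set T : Finset ℝ := c.support.image fun i => i.2.1
  have hsub : c.support ⊆ F ×ˢ T ×ˢ (Finset.univ : Finset Bool) := fun i hi => by
    simp only [Finset.mem_product, Finset.mem_univ, and_true]
    exact ⟨Finset.mem_image_of_mem (fun i => i.1) hi, Finset.mem_image_of_mem (fun i => i.2.1) hi⟩
  rw [Finsupp.sum_of_support_subset c hsub (fun i a => a • v i) fun i _ => zero_smul ℝ (v i)]
  refine h.charFun_sum hJ F T (fun k t => c (k, t, true)) (fun k t => c (k, t, false)) _ ?_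
  have h1 : ∀ᵐ ω ∂P, ∀ i : (F ×ˢ T ×ˢ (Finset.univ : Finset Bool) : Finset (J × ℝ × Bool)),
      (c i • v i : Lp ℝ 2 P) ω = c i * bif i.1.2.2 then (β i.1.1 i.1.2.1 ω).re
        else (β i.1.1 i.1.2.1 ω).im := by
    refine ae_all_iff.2 fun ⟨⟨k, t, b⟩, _⟩ => ?_
    cases b
    · filter_upwards [Lp.coeFn_smul (c (k, t, false)) (v (k, t, false)),
        Complex.imCLM.coeFn_compLpL (p := 2) (h.curve k t), h.coeFn_curve k t] with ω h1 h2 h3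
      rw [h1, Pi.smul_apply]
      simp only [hv, cond_false]
      rw [h2, h3]
      rfl
    · filter_upwards [Lp.coeFn_smul (c (k, t, true)) (v (k, t, true)),
        Complex.reCLM.coeFn_compLpL (p := 2) (h.curve k t), h.coeFn_curve k t] with ω h1 h2 h3
      rw [h1, Pi.smul_apply]
      simp only [hv, cond_true]
      rw [h2, h3]
      rfl
  filter_upwards [h1, Lp.coeFn_finsetSum (F ×ˢ T ×ˢ (Finset.univ : Finset Bool))
    fun i => c i • v i] with ω h1 h2
  have h3 : ∀ i ∈ F ×ˢ T ×ˢ (Finset.univ : Finset Bool), (c i • v i : Lp ℝ 2 P) ω =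
      c i * bif i.2.2 then (β i.1 i.2.1 ω).re else (β i.1 i.2.1 ω).im := fun i hi => h1 ⟨i, hi⟩
  rw [h2, Finset.sum_apply, Finset.sum_congr rfl h3, Finset.sum_product]
  refine Finset.sum_congr rfl fun k _ => ?_
  rw [Finset.sum_product]
  exact Finset.sum_congr rfl fun t _ => by rw [Fintype.sum_bool]; rfl

end IsInfiniteDimFractionalBM

end

section

/-! ### Orthogonal series -/

section OrthogonalSeries

variable {𝕜 E F ι T : Type*} [RCLike 𝕜] [NormedAddCommGroup E] [InnerProductSpace 𝕜 E]
  [CompleteSpace E] [NormedAddCommGroup F] {G : ι → Type*} [∀ i, NormedAddCommGroup (G i)]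
  [∀ i, InnerProductSpace 𝕜 (G i)] {U : ∀ i, G i →ₗᵢ[𝕜] E} {M : ι → ℝ} {l : Filter T}

lemma OrthogonalFamily.norm_tsum_sub_sum_le (hU : OrthogonalFamily 𝕜 G U) {f : ∀ i, G i}
    (hM : Summable fun i => M i ^ 2) (hf : ∀ i, ‖f i‖ ≤ M i) {s : Finset ι} {δ : ℝ} (hδ : 0 ≤ δ)
    (hs : ∀ t : Finset ι, Disjoint t s → ∑ i ∈ t, M i ^ 2 ≤ δ ^ 2) :
    ‖∑' i, U i (f i) - ∑ i ∈ s, U i (f i)‖ ≤ δ := by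
  classical
  have hsq : ∀ i, ‖f i‖ ^ 2 ≤ M i ^ 2 := fun i => pow_le_pow_left₀ (norm_nonneg _) (hf i) 2
  have hsum : Summable fun i => U i (f i) := (hU.summable_iff_norm_sq_summable f).2
    (hM.of_nonneg_of_le (fun i => by positivity) hsq)
  have h1 : Tendsto (fun t : Finset ι => ‖∑ i ∈ t, U i (f i) - ∑ i ∈ s, U i (f i)‖) atTop
      (𝓝 ‖∑' i, U i (f i) - ∑ i ∈ s, U i (f i)‖) :=
    (Tendsto.sub_const hsum.hasSum _).norm
  refine le_of_tendsto h1 ?_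
  filter_upwards [eventually_ge_atTop s] with t ht
  refine abs_le_of_sq_le_sq' ?_ hδ |>.2
  rw [hU.norm_sq_sdiff_sum, Finset.sdiff_eq_empty_iff_subset.2 ht, Finset.sum_empty, add_zero]
  exact (Finset.sum_le_sum fun i _ => hsq i).trans (hs _ Finset.sdiff_disjoint)

/-- Dominated convergence for orthogonal series: by Pythagoras the tail is small uniformly in `t`,
and the remaining finite sum converges term by term. -/
lemma OrthogonalFamily.tendsto_map_tsum_zero (hU : OrthogonalFamily 𝕜 G U) (Φ : E →+ F) {C : ℝ}
    (hΦ : ∀ x, ‖Φ x‖ ≤ C * ‖x‖) {f : T → ∀ i, G i} (hM : Summable fun i => M i ^ 2)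
    (hf : ∀ᶠ t in l, ∀ i, ‖f t i‖ ≤ M i)
    (hlim : ∀ i, Tendsto (fun t => Φ (U i (f t i))) l (𝓝 0)) :
    Tendsto (fun t => Φ (∑' i, U i (f t i))) l (𝓝 0) := by
  rw [Metric.tendsto_nhds]
  intro ε hε
  set δ := ε / (2 * (|C| + 1)) with hδ
  have hδ0 : 0 < δ := by positivity
  obtain ⟨s, hs⟩ := summable_iff_vanishing_norm.1 hM (δ ^ 2) (by positivity)
  have h1 : Tendsto (fun t => ∑ i ∈ s, Φ (U i (f t i))) l (𝓝 0) := by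
    have := tendsto_finsetSum s fun i _ => hlim i
    simpa using this
  filter_upwards [hf, Metric.tendsto_nhds.1 h1 (ε / 2) (by positivity)] with t ht ht'
  rw [dist_zero_right] at ht' ⊢
  have h2 := OrthogonalFamily.norm_tsum_sub_sum_le hU hM ht hδ0.le fun t ht =>
    (le_abs_self _).trans (hs t ht).le
  have h3 : Φ (∑' i, U i (f t i)) = Φ (∑' i, U i (f t i) - ∑ i ∈ s, U i (f t i)) +
      ∑ i ∈ s, Φ (U i (f t i)) := by
    rw [map_sub, map_sum, sub_add_cancel]
  have h4 : ‖Φ (∑' i, U i (f t i) - ∑ i ∈ s, U i (f t i))‖ ≤ |C| * δ :=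
    (hΦ _).trans (mul_le_mul (le_abs_self C) h2 (norm_nonneg _) (abs_nonneg C))
  have h5 : (|C| + 1) * δ = ε / 2 := by rw [hδ]; field_simp
  rw [h3]
  refine (norm_add_le _ _).trans_lt ?_
  linarith

lemma OrthogonalFamily.tendsto_tsum (hU : OrthogonalFamily 𝕜 G U) {f : T → ∀ i, G i}
    {g : ∀ i, G i} (hM : Summable fun i => M i ^ 2) (hf : ∀ᶠ t in l, ∀ i, ‖f t i‖ ≤ M i)
    (hg : ∀ i, ‖g i‖ ≤ M i) (hlim : ∀ i, Tendsto (fun t => f t i) l (𝓝 (g i))) :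
    Tendsto (fun t => ∑' i, U i (f t i)) l (𝓝 (∑' i, U i (g i))) := by
  have hsum : ∀ {f : ∀ i, G i}, (∀ i, ‖f i‖ ≤ M i) → Summable fun i => U i (f i) := fun {f} hf =>
    (hU.summable_iff_norm_sq_summable f).2 (hM.of_nonneg_of_le (fun i => by positivity)
      fun i => pow_le_pow_left₀ (norm_nonneg _) (hf i) 2)
  -- The lemma is applied to `f t i - g i`, for which twice the original bound is a majorant.
  have hM' : Summable fun i => (2 * M i) ^ 2 := by
    simp only [mul_pow]
    exact hM.mul_left _
  have h := OrthogonalFamily.tendsto_map_tsum_zero hU (AddMonoidHom.id E) (C := 1)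
    (fun x => by simp) (f := fun t i => f t i - g i) hM' (l := l)
    (by
      filter_upwards [hf] with t ht i
      exact (norm_sub_le _ _).trans (by linarith [ht i, hg i]))
    (fun i => by
      have := (U i).continuous.tendsto 0 |>.comp (tendsto_sub_nhds_zero_iff.2 (hlim i))
      simpa [Function.comp_def] using this)
  refine tendsto_sub_nhds_zero_iff.1 (h.congr' ?_)
  filter_upwards [hf] with t ht
  rw [← (hsum ht).tsum_sub (hsum hg)]
  simp only [map_sub]
  rfl

end OrthogonalSeries

/-! ### The Fourier basis of the state space -/

lemma inner_smul_V (f g : V) (c : ℂ) : ⟪f, c • g⟫_ℂ = c * ⟪f, g⟫_ℂ := inner_smul_right f g c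

lemma coe_smul_V (c : ℝ) (f : V) : (c : ℂ) • f = c • f := Complex.coe_smul c f

/-- The one Fourier coefficient missing from the index set, that of the zero mode, vanishes because
elements of `V` have mean zero. -/
lemma eq_zero_of_inner_e {f : V} (hf : ∀ k, ⟪e k, f⟫_ℂ = 0) : f = 0 := by
  have h : ∀ n : Fin 2 → ℤ, ⟪fourierMode n, (f : L2Torus)⟫_ℂ = 0 := by
    intro n
    by_cases hn : n = 0
    · rw [hn, inner_fourierMode_zero]
      exact f.2
    · exact hf ⟨n, hn⟩
  have h2 : (UnitAddTorus.mFourierBasis (d := Fin 2)).repr (f : L2Torus) = 0 := by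
    ext n
    rw [HilbertBasis.repr_apply_apply, UnitAddTorus.coe_mFourierBasis]
    exact h n
  exact Subtype.ext ((LinearIsometryEquiv.map_eq_zero_iff _).1 h2)

/-- The Hilbert basis `e`. -/
def basisV : HilbertBasis Mode ℂ V :=
  HilbertBasis.mkOfOrthogonalEqBot orthonormal_e (by
    rw [Submodule.eq_bot_iff]
    intro f hf
    refine eq_zero_of_inner_e fun k => ?_
    exact (Submodule.mem_orthogonal _ _).1 hf _ (Submodule.subset_span (mem_range_self k)))

lemma basisV_apply (k : Mode) : basisV k = e k := by
  rw [basisV, HilbertBasis.coe_mkOfOrthogonalEqBot]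

lemma ext_inner_e {f g : V} (h : ∀ k, ⟪e k, f⟫_ℂ = ⟪e k, g⟫_ℂ) : f = g := by
  rw [← sub_eq_zero]
  exact eq_zero_of_inner_e fun k => by rw [inner_sub_right, h, sub_self]

lemma hasSum_e (f : V) : HasSum (fun k => ⟪e k, f⟫_ℂ • e k) f := by
  have := basisV.hasSum_repr f
  simpa only [HilbertBasis.repr_apply_apply, basisV_apply] using this

lemma dense_span_e : Dense (Submodule.span ℂ (range e) : Set V) := by
  have h := basisV.dense_span
  rw [show (⇑basisV : Mode → V) = e from funext basisV_apply] at h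
  exact Submodule.dense_iff_topologicalClosure_eq_top.2 h

lemma summable_norm_inner_e_sq (f : V) : Summable fun k => ‖⟪e k, f⟫_ℂ‖ ^ 2 :=
  orthonormal_e.inner_products_summable f

instance : SecondCountableTopology V := by
  have h1 : TopologicalSpace.IsSeparable (range e) := (countable_range e).isSeparable
  have h2 := (h1.span (R := ℂ)).closure
  rw [dense_span_e.closure_eq, TopologicalSpace.isSeparable_univ_iff] at h2
  exact UniformSpace.secondCountable_of_separable V

/-! ### Diagonal operators and the semigroup -/

lemma summable_diag {a : Mode → ℂ} {f : V} (h : Summable fun k => ‖a k * ⟪e k, f⟫_ℂ‖ ^ 2) :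
    Summable fun k => (a k * ⟪e k, f⟫_ℂ) • e k := by
  have := (orthonormal_e.orthogonalFamily.summable_iff_norm_sq_summable
    (fun k => a k * ⟪e k, f⟫_ℂ)).2 h
  simpa using this

lemma inner_tsum_e {c : Mode → ℂ} (h : Summable fun k => c k • e k) (l : Mode) :
    ⟪e l, ∑' k, c k • e k⟫_ℂ = c l := by
  have h1 := h.hasSum.mapL (innerSL ℂ (e l))
  have h2 : HasSum (fun k => innerSL ℂ (e l) (c k • e k)) (c l) := by
    have : (fun k => innerSL ℂ (e l) (c k • e k)) = fun k => if k = l then c l else 0 := by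
      ext k
      rw [innerSL_apply_apply, inner_smul_V, orthonormal_iff_ite.1 orthonormal_e l k]
      by_cases hkl : k = l
      · simp [hkl]
      · simp [hkl, Ne.symm hkl]
    rw [this]
    exact hasSum_ite_eq l (c l)
  exact h1.unique h2

variable {ν c : ℝ} {α : Mode → ℝ}

/-- With `max t 0` the diagonal operators are contractions at every real time; negative times play
no role in the semigroup property. -/
lemma norm_exp_le_one (hν : 0 < ν) (hα : ∀ k, 0 ≤ α k) (t : ℝ) (k : Mode) :
    ‖(Real.exp (-(ν * α k * max t 0)) : ℂ)‖ ≤ 1 := by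
  rw [Complex.norm_real, Real.norm_eq_abs, abs_of_pos (Real.exp_pos _), Real.exp_le_one_iff]
  have := hα k
  have := le_max_right t 0
  simp only [neg_nonpos]
  positivity

lemma summable_semigroup (hν : 0 < ν) (hα : ∀ k, 0 ≤ α k) (t : ℝ) (f : V) :
    Summable fun k => ((Real.exp (-(ν * α k * max t 0)) : ℂ) * ⟪e k, f⟫_ℂ) • e k := by
  refine summable_diag ((summable_norm_inner_e_sq f).of_nonneg_of_le (fun k => by positivity)
    fun k => pow_le_pow_left₀ (norm_nonneg _) ?_ 2)
  rw [norm_mul]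
  exact mul_le_of_le_one_left (norm_nonneg _) (norm_exp_le_one hν hα t k)

lemma norm_tsum_semigroup_le (hν : 0 < ν) (hc : 0 ≤ c) (hα : ∀ k, c ≤ α k) (t : ℝ) (f : V) :
    ‖∑' k, ((Real.exp (-(ν * α k * max t 0)) : ℂ) * ⟪e k, f⟫_ℂ) • e k‖ ≤
      Real.exp (-(ν * c * max t 0)) * ‖f‖ := by
  have hα0 : ∀ k, 0 ≤ α k := fun k => hc.trans (hα k)
  have h1 : Tendsto (fun s : Finset Mode => ‖∑ k ∈ s,
      ((Real.exp (-(ν * α k * max t 0)) : ℂ) * ⟪e k, f⟫_ℂ) • e k‖) atTop (𝓝 _) :=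
    (summable_semigroup hν hα0 t f).hasSum.norm
  refine le_of_tendsto h1 (Eventually.of_forall fun s => ?_)
  refine abs_le_of_sq_le_sq' ?_ (by positivity) |>.2
  have h2 := orthonormal_e.orthogonalFamily.norm_sum
    (fun k => (Real.exp (-(ν * α k * max t 0)) : ℂ) * ⟪e k, f⟫_ℂ) s
  simp only [LinearIsometry.toSpanSingleton_apply] at h2
  rw [h2, mul_pow]
  calc ∑ k ∈ s, ‖(Real.exp (-(ν * α k * max t 0)) : ℂ) * ⟪e k, f⟫_ℂ‖ ^ 2
      ≤ ∑ k ∈ s, Real.exp (-(ν * c * max t 0)) ^ 2 * ‖⟪e k, f⟫_ℂ‖ ^ 2 := by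
        refine Finset.sum_le_sum fun k _ => ?_
        rw [norm_mul, mul_pow, Complex.norm_real, Real.norm_eq_abs, abs_of_pos (Real.exp_pos _)]
        have := hα k
        have := le_max_right t 0
        gcongr
    _ = Real.exp (-(ν * c * max t 0)) ^ 2 * ∑ k ∈ s, ‖⟪e k, f⟫_ℂ‖ ^ 2 := by rw [Finset.mul_sum]
    _ ≤ _ := by gcongr; exact orthonormal_e.sum_inner_products_le f

/-- The diagonal semigroup `e_k ↦ exp (-ν α_k t) e_k`. -/
def semigroupV (hν : 0 < ν) (hα : ∀ k, 0 ≤ α k) (t : ℝ) : V →L[ℂ] V :=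
  LinearMap.mkContinuous
    { toFun := fun f => ∑' k, ((Real.exp (-(ν * α k * max t 0)) : ℂ) * ⟪e k, f⟫_ℂ) • e k
      map_add' := fun f g => by
        rw [← (summable_semigroup hν hα t f).tsum_add (summable_semigroup hν hα t g)]
        refine tsum_congr fun k => ?_
        rw [inner_add_right, mul_add, add_smul]
      map_smul' := fun c f => by
        rw [RingHom.id_apply, ← (summable_semigroup hν hα t f).tsum_const_smul c]
        refine tsum_congr fun k => ?_
        rw [inner_smul_V, smul_smul]
        ring_nf } 1
    fun f => (norm_tsum_semigroup_le hν le_rfl hα t f).trans (by simp)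

lemma semigroupV_apply (hν : 0 < ν) (hα : ∀ k, 0 ≤ α k) (t : ℝ) (f : V) :
    semigroupV hν hα t f =
      ∑' k, ((Real.exp (-(ν * α k * max t 0)) : ℂ) * ⟪e k, f⟫_ℂ) • e k := rfl

lemma inner_semigroupV (hν : 0 < ν) (hα : ∀ k, 0 ≤ α k) (t : ℝ) (f : V) (k : Mode) :
    ⟪e k, semigroupV hν hα t f⟫_ℂ = (Real.exp (-(ν * α k * max t 0)) : ℂ) * ⟪e k, f⟫_ℂ := by
  rw [semigroupV_apply, inner_tsum_e (summable_semigroup hν hα t f)]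

lemma norm_semigroupV_le (hν : 0 < ν) (hα : ∀ k, 0 ≤ α k) (hc : 0 ≤ c) (hcα : ∀ k, c ≤ α k)
    {t : ℝ} (ht : 0 ≤ t) (f : V) :
    ‖semigroupV hν hα t f‖ ≤ Real.exp (-(ν * c * t)) * ‖f‖ := by
  have := norm_tsum_semigroup_le hν hc hcα t f
  rw [← semigroupV_apply hν hα] at this
  rwa [max_eq_left ht] at this

lemma mem_graph_smul_opA {f g : V} : (f, g) ∈ ((ν : ℂ) • opA α).graph ↔
    f ∈ domainA α ∧ ∀ k, ⟪e k, g⟫_ℂ = -(ν * α k : ℂ) * ⟪e k, f⟫_ℂ := by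
  have hin : ∀ f : domainA α, ∀ k, ⟪e k, (ν : ℂ) • opA α f⟫_ℂ = -(ν * α k : ℂ) * ⟪e k, (f : V)⟫_ℂ := by
    intro f k
    refine (inner_smul_V _ _ _).trans ?_
    change (ν : ℂ) * ⟪e k, ∑' k, (-(α k : ℂ) * ⟪e k, (f : V)⟫_ℂ) • e k⟫_ℂ = _
    rw [inner_tsum_e (summable_A f.2)]
    ring
  rw [LinearPMap.mem_graph_iff]
  constructor
  · rintro ⟨y, hy1, hy2⟩
    simp only at hy1 hy2
    rw [← hy1, ← hy2]
    exact ⟨y.2, hin y⟩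
  · rintro ⟨hf, hg⟩
    refine ⟨⟨f, hf⟩, rfl, ext_inner_e fun k => ?_⟩
    exact (hin ⟨f, hf⟩ k).trans (hg k).symm

lemma tendsto_exp_slope (κ : ℝ) :
    Tendsto (fun h : ℝ => h⁻¹ * (Real.exp (-(κ * max h 0)) - 1)) (𝓝[>] 0) (𝓝 (-κ)) := by
  have h1 : HasDerivAt (fun h : ℝ => Real.exp (-(κ * h))) (-κ) 0 := by
    have := ((hasDerivAt_id (0 : ℝ)).const_mul κ).neg.exp
    simpa using this
  have h2 := h1.tendsto_slope_zero_right
  refine h2.congr' ?_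
  filter_upwards [self_mem_nhdsWithin] with h hh
  rw [max_eq_left (mem_Ioi.1 hh).le]
  simp

lemma isSemigroupGeneratedBy_semigroupV (hν : 0 < ν) (hα : ∀ k, 0 ≤ α k) :
    IsSemigroupGeneratedBy (semigroupV hν hα) ((ν : ℂ) • opA α) where
  map_zero := by
    ext1 f
    refine ext_inner_e fun k => ?_
    rw [inner_semigroupV]
    simp
  map_add s t hs ht := by
    ext1 f
    refine ext_inner_e fun k => ?_
    rw [ContinuousLinearMap.comp_apply, inner_semigroupV, inner_semigroupV, inner_semigroupV,
      max_eq_left hs, max_eq_left ht, max_eq_left (add_nonneg hs ht), mul_add, neg_add,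
      Real.exp_add]
    push_cast
    ring
  continuousOn f := by
    refine Continuous.continuousOn (continuous_iff_continuousAt.2 fun s => ?_)
    have hb : ∀ t k, ‖(Real.exp (-(ν * α k * max t 0)) : ℂ) * ⟪e k, f⟫_ℂ‖ ≤ ‖⟪e k, f⟫_ℂ‖ :=
      fun t k => by
        rw [norm_mul]
        exact mul_le_of_le_one_left (norm_nonneg _) (norm_exp_le_one hν hα t k)
    have := OrthogonalFamily.tendsto_tsum orthonormal_e.orthogonalFamily
      (f := fun t k => (Real.exp (-(ν * α k * max t 0)) : ℂ) * ⟪e k, f⟫_ℂ)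
      (g := fun k => (Real.exp (-(ν * α k * max s 0)) : ℂ) * ⟪e k, f⟫_ℂ) (l := 𝓝 s)
      (summable_norm_inner_e_sq f) (Eventually.of_forall fun t k => hb t k) (hb s) fun k => by
        have : Continuous fun t : ℝ => (Real.exp (-(ν * α k * max t 0)) : ℂ) * ⟪e k, f⟫_ℂ := by
          fun_prop
        exact this.tendsto s
    exact this
  generator f g := by
    have hcoord : ∀ k (h : ℝ), ⟪e k, ((h⁻¹ : ℝ) : ℂ) • (semigroupV hν hα h f - f)⟫_ℂ =
        ((h⁻¹ * (Real.exp (-(ν * α k * max h 0)) - 1) : ℝ) : ℂ) * ⟪e k, f⟫_ℂ := by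
      intro k h
      rw [inner_smul_V, inner_sub_right, inner_semigroupV]
      push_cast
      ring
    have hlim : ∀ k, Tendsto (fun h : ℝ =>
        ((h⁻¹ * (Real.exp (-(ν * α k * max h 0)) - 1) : ℝ) : ℂ) * ⟪e k, f⟫_ℂ) (𝓝[>] 0)
        (𝓝 (-(ν * α k : ℂ) * ⟪e k, f⟫_ℂ)) := fun k => by
      have := ((Complex.continuous_ofReal.tendsto _).comp
        (tendsto_exp_slope (ν * α k))).mul_const ⟪e k, f⟫_ℂ
      simpa using this
    rw [mem_graph_smul_opA]
    constructor
    · rintro ⟨hf, hg⟩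
      have hM : Summable fun k => ‖-(ν * α k : ℂ) * ⟪e k, f⟫_ℂ‖ ^ 2 := by
        refine (Summable.mul_left (ν ^ 2) hf).congr fun k => ?_
        rw [norm_mul, norm_neg, norm_mul, Complex.norm_real, Complex.norm_real, mul_pow, mul_pow,
          Real.norm_eq_abs, Real.norm_eq_abs, sq_abs, sq_abs]
        ring
      -- By `0 ≤ 1 - e^{-x} ≤ x` the difference quotients are dominated by the limiting
      -- coefficients, which are square summable on the domain.
      have hb : ∀ᶠ h : ℝ in 𝓝[>] 0, ∀ k,
          ‖((h⁻¹ * (Real.exp (-(ν * α k * max h 0)) - 1) : ℝ) : ℂ) * ⟪e k, f⟫_ℂ‖ ≤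
            ‖-(ν * α k : ℂ) * ⟪e k, f⟫_ℂ‖ := by
        filter_upwards [self_mem_nhdsWithin] with h hh k
        have hh' : 0 < h := hh
        rw [norm_mul, norm_mul, norm_neg, ← Complex.ofReal_mul, Complex.norm_real,
          Complex.norm_real, max_eq_left hh'.le]
        refine mul_le_mul_of_nonneg_right ?_ (norm_nonneg _)
        have hκ : 0 ≤ ν * α k := mul_nonneg hν.le (hα k)
        have h1 : Real.exp (-(ν * α k * h)) ≤ 1 := Real.exp_le_one_iff.2 (by simp; positivity)
        have h2 := Real.add_one_le_exp (-(ν * α k * h))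
        rw [norm_mul, norm_inv, Real.norm_eq_abs, Real.norm_eq_abs, Real.norm_eq_abs,
          abs_of_pos hh', abs_of_nonneg hκ, abs_of_nonpos (by linarith), inv_mul_le_iff₀ hh']
        linarith
      have h1 := OrthogonalFamily.tendsto_tsum orthonormal_e.orthogonalFamily
        (f := fun h k => ((h⁻¹ * (Real.exp (-(ν * α k * max h 0)) - 1) : ℝ) : ℂ) * ⟪e k, f⟫_ℂ)
        (g := fun k => -(ν * α k : ℂ) * ⟪e k, f⟫_ℂ) (l := 𝓝[>] (0 : ℝ)) hM hb (fun k => le_rfl) hlim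
      simp only [LinearIsometry.toSpanSingleton_apply] at h1
      have h2 : ∑' k, (-(ν * α k : ℂ) * ⟪e k, f⟫_ℂ) • e k = g := by
        refine ((hasSum_e g).congr_fun ?_).tsum_eq
        intro k
        rw [hg k]
      rw [h2] at h1
      refine h1.congr fun h => ?_
      refine ((hasSum_e _).congr_fun fun k => ?_).tsum_eq
      rw [hcoord]
    · intro hg
      -- Conversely, a strong limit determines the coordinates of `g`; their square summability then
      -- puts `f` in the domain.
      have hg' : ∀ k, ⟪e k, g⟫_ℂ = -(ν * α k : ℂ) * ⟪e k, f⟫_ℂ := fun k => by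
        have h1 := ((innerSL ℂ (e k)).continuous.tendsto g).comp hg
        refine tendsto_nhds_unique h1 ((hlim k).congr fun h => ?_)
        exact (hcoord k h).symm
      refine ⟨?_, hg'⟩
      refine (Summable.mul_left (ν⁻¹ ^ 2) (summable_norm_inner_e_sq g)).congr fun k => ?_
      rw [hg' k, norm_mul, norm_neg, norm_mul, Complex.norm_real, Complex.norm_real, mul_pow,
        mul_pow, Real.norm_eq_abs, Real.norm_eq_abs, sq_abs, sq_abs]
      field_simp

/-- Eigenvectors of the generator evolve exponentially: `e^{ν α_k s} S(s) e_k` is continuous with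
vanishing right derivative, hence constant. The right derivative at `s` comes from the one at `0` by
the semigroup law. -/
lemma IsSemigroupGeneratedBy.apply_e {S : ℝ → V →L[ℂ] V}
    (hS : IsSemigroupGeneratedBy S ((ν : ℂ) • opA α)) (k : Mode) {t : ℝ} (ht : 0 ≤ t) :
    S t (e k) = (Real.exp (-(ν * α k * t)) : ℂ) • e k := by
  have hmem : (e k, (-(ν * α k : ℂ)) • e k) ∈ ((ν : ℂ) • opA α).graph := by
    rw [mem_graph_smul_opA]
    have hinn : ∀ l, ⟪e l, e k⟫_ℂ = if l = k then 1 else 0 := fun l =>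
      orthonormal_iff_ite.1 orthonormal_e l k
    constructor
    · refine summable_of_ne_finset_zero (s := {k}) fun l hl => ?_
      rw [hinn, if_neg (by simpa using hl)]
      simp
    · intro l
      rw [inner_smul_V, hinn]
      by_cases h : l = k
      · rw [h]
      · simp [h]
  have h0 := (hS.generator _ _).1 hmem
  set u : ℝ → V := fun s => S s (e k)
  have hu : ∀ s, 0 ≤ s → HasDerivWithinAt u ((-(ν * α k : ℂ)) • u s) (Ici s) s := by
    intro s hs
    rw [← hasDerivWithinAt_Ioi_iff_Ici, hasDerivWithinAt_iff_tendsto_slope' (by simp)]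
    have h1 := ((S s).continuous.tendsto _).comp h0
    have h2 : Tendsto (fun x : ℝ => x - s) (𝓝[>] s) (𝓝[>] 0) := by
      refine tendsto_nhdsWithin_iff.2 ⟨?_, ?_⟩
      · have : Tendsto (fun x : ℝ => x - s) (𝓝 s) (𝓝 (s - s)) :=
          (continuous_id.sub continuous_const).tendsto s
        rw [sub_self] at this
        exact this.mono_left nhdsWithin_le_nhds
      · filter_upwards [self_mem_nhdsWithin] with x hx
        exact sub_pos.2 (mem_Ioi.1 hx)
    have h3 := h1.comp h2
    rw [map_smul] at h3
    refine h3.congr' ?_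
    filter_upwards [self_mem_nhdsWithin] with x hx
    have hx' : s < x := hx
    simp only [Function.comp_apply, slope, vsub_eq_sub, u]
    rw [map_smul, map_sub, ← ContinuousLinearMap.comp_apply, ← hS.map_add s (x - s) hs
      (sub_nonneg.2 hx'.le), add_sub_cancel, coe_smul_V]
  set w : ℝ → V := fun s => Real.exp (ν * α k * s) • u s
  have hw : ∀ s, 0 ≤ s → HasDerivWithinAt w 0 (Ici s) s := by
    intro s hs
    have h1 : HasDerivAt (fun s : ℝ => Real.exp (ν * α k * s))
        (Real.exp (ν * α k * s) * (ν * α k)) s := by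
      have := ((hasDerivAt_id s).const_mul (ν * α k)).exp
      simpa using this
    have h2 := h1.hasDerivWithinAt.smul (hu s hs) (s := Ici s)
    have h3 : (-(ν * α k : ℂ)) • u s = (-(ν * α k)) • u s := by
      rw [← coe_smul_V]
      push_cast
      rfl
    have h4 : Real.exp (ν * α k * s) • (-(ν * α k : ℂ)) • u s +
        (Real.exp (ν * α k * s) * (ν * α k)) • u s = 0 := by
      rw [h3, smul_smul, ← add_smul]
      simp
    rw [h4] at h2
    exact h2
  have hwc : ContinuousOn w (Icc 0 t) :=
    (Continuous.continuousOn (f := fun s : ℝ => Real.exp (ν * α k * s)) (by fun_prop)).smul ((hS.continuousOn (e k)).mono Icc_subset_Ici_self)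
  have h3 := constant_of_has_deriv_right_zero hwc (fun x hx => hw x hx.1) t ⟨ht, le_rfl⟩
  simp only [w, u, hS.map_zero, mul_zero, Real.exp_zero, one_smul,
    ContinuousLinearMap.id_apply] at h3
  rw [coe_smul_V]
  nth_rewrite 2 [← h3]
  rw [smul_smul, ← Real.exp_add]
  simp

/-- Two such semigroups agree on the dense span of eigenvectors. Hence the existentially quantified
semigroup in `IsMildSolution` is always the diagonal one. -/
lemma IsSemigroupGeneratedBy.eq_semigroupV {S : ℝ → V →L[ℂ] V} (hν : 0 < ν) (hα : ∀ k, 0 ≤ α k)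
    (hS : IsSemigroupGeneratedBy S ((ν : ℂ) • opA α)) {t : ℝ} (ht : 0 ≤ t) :
    S t = semigroupV hν hα t := by
  refine ContinuousLinearMap.ext_on dense_span_e ?_
  rintro _ ⟨k, rfl⟩
  rw [hS.apply_e k ht, (isSemigroupGeneratedBy_semigroupV hν hα).apply_e k ht]

end

section

variable {Ω : Type*} [MeasurableSpace Ω] {P : Measure Ω} [IsProbabilityMeasure P] {H : ℝ}
  {E : Type*} [NormedAddCommGroup E] [InnerProductSpace ℂ E] [CompleteSpace E] [NormedSpace ℝ E]
  [IsScalarTower ℝ ℂ E] {u : Mode → E} (hu : Orthonormal ℂ u)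

/-! ### The stationary series as a curve in `L²(Ω, E)` -/

lemma norm_compLpL_toSpanSingleton (hu : Orthonormal ℂ u) (k : Mode) (z : Lp ℂ 2 P) :
    ‖(ContinuousLinearMap.toSpanSingleton ℂ (u k)).compLpL 2 P z‖ = ‖z‖ := by
  rw [Lp.norm_def, Lp.norm_def]
  congr 1
  refine eLpNorm_congr_norm_ae ?_
  filter_upwards [(ContinuousLinearMap.toSpanSingleton ℂ (u k)).coeFn_compLpL (p := 2) z] with ω h
  rw [h, ContinuousLinearMap.toSpanSingleton_apply, norm_smul, hu.1 k, mul_one]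

/-- The isometry `z ↦ z u_k` from `L²(Ω)` to `L²(Ω, E)`. -/
def modeEmb (P : Measure Ω) [IsProbabilityMeasure P] (hu : Orthonormal ℂ u) (k : Mode) : Lp ℂ 2 P →ₗᵢ[ℂ] Lp E 2 P where
  toLinearMap := ((ContinuousLinearMap.toSpanSingleton ℂ (u k)).compLpL 2 P).toLinearMap
  norm_map' := norm_compLpL_toSpanSingleton hu k

lemma coeFn_modeEmb (k : Mode) (z : Lp ℂ 2 P) : modeEmb P hu k z =ᵐ[P] fun ω => z ω • u k :=
  (ContinuousLinearMap.toSpanSingleton ℂ (u k)).coeFn_compLpL z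

lemma orthogonalFamily_modeEmb :
    OrthogonalFamily ℂ (fun _ : Mode => Lp ℂ 2 P) (modeEmb P hu) := by
  intro k l hkl z w
  rw [L2.inner_def]
  refine integral_eq_zero_of_ae ?_
  filter_upwards [coeFn_modeEmb hu k z, coeFn_modeEmb hu l w] with ω h1 h2
  rw [h1, h2, inner_smul_right, inner_smul_left, hu.2 hkl]
  simp

/-- `modeEmb` as a real continuous linear map. -/
def modeEmbR (P : Measure Ω) [IsProbabilityMeasure P] (hu : Orthonormal ℂ u) (k : Mode) : Lp ℂ 2 P →L[ℝ] Lp E 2 P :=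
  (modeEmb P hu k).toContinuousLinearMap.restrictScalars ℝ

lemma modeEmbR_apply (k : Mode) (z : Lp ℂ 2 P) : modeEmbR P hu k z = modeEmb P hu k z := rfl

/-- A real functional of the coefficient of `e_k`. -/
def modeFunctional (u : Mode → E) (L : StrongDual ℝ E) (k : Mode) : ℂ →L[ℝ] ℝ :=
  L.comp ((ContinuousLinearMap.toSpanSingleton ℂ (u k)).restrictScalars ℝ)

lemma compLpL_modeEmb (L : StrongDual ℝ E) (k : Mode) (z : Lp ℂ 2 P) :
    L.compLpL 2 P (modeEmb P hu k z) = (modeFunctional u L k).compLpL 2 P z := by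
  refine Lp.ext ?_
  filter_upwards [L.coeFn_compLpL (p := 2) (modeEmb P hu k z), coeFn_modeEmb hu k z,
    (modeFunctional u L k).coeFn_compLpL (p := 2) z] with ω h1 h2 h3
  rw [h1, h2, h3]
  rfl

/-- The bilinear form `(z, w) ↦ E (m z) (m' w)`. -/
def covForm (P : Measure Ω) [IsProbabilityMeasure P] (m m' : ℂ →L[ℝ] ℝ) :
    Lp ℂ 2 P →L[ℝ] Lp ℂ 2 P →L[ℝ] ℝ :=
  (isBoundedBilinearMap_inner (𝕜 := ℝ) (E := Lp ℝ 2 P)).toContinuousLinearMap.bilinearComp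
    (m.compLpL 2 P) (m'.compLpL 2 P)

lemma covForm_apply (m m' : ℂ →L[ℝ] ℝ) (z w : Lp ℂ 2 P) :
    covForm P m m' z w = ⟪m.compLpL 2 P z, m'.compLpL 2 P w⟫_ℝ := rfl

namespace IsInfiniteDimFractionalBM

variable {β : Mode → ℝ → Ω → ℂ} {a κ : Mode → ℝ}

/-- The series `∑ a_k (∫_{-∞}^t exp (-κ_k (t - s)) dβ_k(s)) e_k` in `L²(Ω, E)`. -/
def ouSeries (h : IsInfiniteDimFractionalBM H β P) (hu : Orthonormal ℂ u) (a κ : Mode → ℝ) (t : ℝ) : Lp E 2 P :=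
  ∑' k, modeEmb P hu k (a k • ouFilter (κ k) (h.curve k) t)

lemma norm_smul_ouFilter_le (h : IsInfiniteDimFractionalBM H β P) (hH : 0 < H)
    (hκ : ∀ k, 0 < κ k) (k : Mode) (t : ℝ) :
    ‖a k • ouFilter (κ k) (h.curve k) t‖ ≤ |a k * κ k ^ (-H)| * Real.Gamma (H + 1) := by
  rw [norm_smul, Real.norm_eq_abs, abs_mul, abs_of_nonneg (Real.rpow_nonneg (hκ k).le _), mul_assoc,
    mul_comm (κ k ^ (-H))]
  refine mul_le_mul_of_nonneg_left ?_ (abs_nonneg _)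
  simpa using (h.isHolderCurve hH k).norm_ouFilter_le (hκ k) hH t

lemma summable_bound (ha : Summable fun k => (a k * κ k ^ (-H)) ^ 2) :
    Summable fun k => (|a k * κ k ^ (-H)| * Real.Gamma (H + 1)) ^ 2 := by
  simp only [mul_pow _ (Real.Gamma _), sq_abs]
  exact ha.mul_right _

lemma hasSum_ouSeries (h : IsInfiniteDimFractionalBM H β P) (hH : 0 < H) (hκ : ∀ k, 0 < κ k)
    (ha : Summable fun k => (a k * κ k ^ (-H)) ^ 2) (t : ℝ) :
    HasSum (fun k => modeEmb P hu k (a k • ouFilter (κ k) (h.curve k) t)) (h.ouSeries hu a κ t) :=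
  (((orthogonalFamily_modeEmb hu).summable_iff_norm_sq_summable _).2
    ((summable_bound ha).of_nonneg_of_le (fun k => by positivity) fun k =>
      pow_le_pow_left₀ (norm_nonneg _) (h.norm_smul_ouFilter_le hH hκ k t) 2)).hasSum

lemma continuous_ouSeries (h : IsInfiniteDimFractionalBM H β P) (hH : 0 < H) (hκ : ∀ k, 0 < κ k)
    (ha : Summable fun k => (a k * κ k ^ (-H)) ^ 2) : Continuous (h.ouSeries hu a κ) :=
  continuous_iff_continuousAt.2 fun s => OrthogonalFamily.tendsto_tsum
    (orthogonalFamily_modeEmb (P := P) hu) (summable_bound ha)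
    (Eventually.of_forall fun t k => h.norm_smul_ouFilter_le hH hκ k t)
    (fun k => h.norm_smul_ouFilter_le hH hκ k s) fun k =>
      (((h.isHolderCurve hH k).continuous_ouFilter (hκ k) hH).const_smul (a k)).tendsto s

/-- The series is a limit of sums of Bochner integrals of the noise up to time `t`. Taking for `S`
functionals with Gaussian values, functions measurable for the past, or vectors killed
asymptotically gives Gaussianity, adaptedness and decorrelation. -/
lemma ouSeries_mem (h : IsInfiniteDimFractionalBM H β P) (hH : 0 < H) (hκ : ∀ k, 0 < κ k)
    (ha : Summable fun k => (a k * κ k ^ (-H)) ^ 2) {S : Submodule ℝ (Lp E 2 P)}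
    (hS : IsClosed (S : Set (Lp E 2 P))) {t : ℝ}
    (hmem : ∀ k, ∀ s ≤ t, modeEmb P hu k (h.curve k s) ∈ S) : h.ouSeries hu a κ t ∈ S := by
  have hk : ∀ k, modeEmb P hu k (a k • ouFilter (κ k) (h.curve k) t) ∈ S := by
    intro k
    rw [← modeEmbR_apply hu, map_smul]
    refine S.smul_mem _ ?_
    change ouFilter (κ k) (h.curve k) t ∈ S.comap (modeEmbR P hu k).toLinearMap
    exact (h.isHolderCurve hH k).ouFilter_mem (hκ k) hH
      (hS.preimage (modeEmbR P hu k).continuous) fun s hs => hmem k s hs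
  exact hS.mem_of_tendsto (h.hasSum_ouSeries hu hH hκ ha t)
    (Eventually.of_forall fun F => S.sum_mem fun k _ => hk k)

lemma compLpL_ouSeries_mem (h : IsInfiniteDimFractionalBM H β P) (hH : 0 < H) (hκ : ∀ k, 0 < κ k)
    (ha : Summable fun k => (a k * κ k ^ (-H)) ^ 2) (L : StrongDual ℝ E) (t : ℝ) :
    L.compLpL 2 P (h.ouSeries hu a κ t) ∈ h.gaussianSpace := by
  change _ ∈ h.gaussianSpace.comap (L.compLpL 2 P).toLinearMap
  refine h.ouSeries_mem hu hH hκ ha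
    ((Submodule.isClosed_topologicalClosure _).preimage (L.compLpL 2 P).continuous) fun k s _ => ?_
  change L.compLpL 2 P (modeEmb P hu k (h.curve k s)) ∈ h.gaussianSpace
  rw [compLpL_modeEmb]
  exact Submodule.le_topologicalClosure _ (Submodule.subset_span ⟨_, _, _, rfl⟩)

lemma map_ouSeries_congr (h : IsInfiniteDimFractionalBM H β P) (hH : 0 < H) (hκ : ∀ k, 0 < κ k)
    (ha : Summable fun k => (a k * κ k ^ (-H)) ^ 2) (Φ Φ' : StrongDual ℝ (Lp E 2 P)) {t t' : ℝ}
    (hΦ : ∀ k, Φ (modeEmb P hu k (a k • ouFilter (κ k) (h.curve k) t)) =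
      Φ' (modeEmb P hu k (a k • ouFilter (κ k) (h.curve k) t'))) :
    Φ (h.ouSeries hu a κ t) = Φ' (h.ouSeries hu a κ t') := by
  have h1 := (h.hasSum_ouSeries hu hH hκ ha t).mapL Φ
  have h2 := (h.hasSum_ouSeries hu hH hκ ha t').mapL Φ'
  refine h1.unique ?_
  simpa only [hΦ] using h2

/-- The series is expanded in one argument and then in the other, which reduces the claim to two
moving averages; these involve only increments, whose covariances are shift invariant. -/
lemma inner_ouSeries_shift (h : IsInfiniteDimFractionalBM H β P) (hH : 0 < H) (hκ : ∀ k, 0 < κ k)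
    (ha : Summable fun k => (a k * κ k ^ (-H)) ^ 2) (L L' : StrongDual ℝ E) (t s d : ℝ) :
    ⟪L.compLpL 2 P (h.ouSeries hu a κ (t + d)), L'.compLpL 2 P (h.ouSeries hu a κ (s + d))⟫_ℝ =
      ⟪L.compLpL 2 P (h.ouSeries hu a κ t), L'.compLpL 2 P (h.ouSeries hu a κ s)⟫_ℝ := by
  refine h.map_ouSeries_congr hu hH hκ ha
    ((innerSL ℝ (L.compLpL 2 P (h.ouSeries hu a κ (t + d)))).comp (L'.compLpL 2 P))
    ((innerSL ℝ (L.compLpL 2 P (h.ouSeries hu a κ t))).comp (L'.compLpL 2 P)) fun l => ?_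
  simp only [ContinuousLinearMap.comp_apply, innerSL_apply_apply]
  rw [real_inner_comm, real_inner_comm (L'.compLpL 2 P _)]
  refine h.map_ouSeries_congr hu hH hκ ha
    ((innerSL ℝ (L'.compLpL 2 P (modeEmb P hu l (a l • ouFilter (κ l) (h.curve l) (s + d))))).comp
      (L.compLpL 2 P))
    ((innerSL ℝ (L'.compLpL 2 P (modeEmb P hu l (a l • ouFilter (κ l) (h.curve l) s)))).comp
      (L.compLpL 2 P)) fun k => ?_
  simp only [ContinuousLinearMap.comp_apply, innerSL_apply_apply]
  rw [real_inner_comm, real_inner_comm (L.compLpL 2 P _)]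
  simp only [compLpL_modeEmb, map_smul, inner_smul_left, inner_smul_right]
  have := (h.isHolderCurve hH k).bilin_ouFilter_shift (h.isHolderCurve hH l) (hκ k) (hκ l) hH
    (covForm P (modeFunctional u L k) (modeFunctional u L' l)) t s d
    (fun r q => h.inner_increments_shift _ _ k l t s r q d)
  simp only [covForm_apply] at this
  rw [this]

lemma tendsto_inner_ouSeries (h : IsInfiniteDimFractionalBM H β P) (hH : H ∈ Ioo (0 : ℝ) 1)
    (hκ : ∀ k, 0 < κ k) (ha : Summable fun k => (a k * κ k ^ (-H)) ^ 2) (L L' : StrongDual ℝ E)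
    (s : ℝ) :
    Tendsto (fun t => ⟪L.compLpL 2 P (h.ouSeries hu a κ t), L'.compLpL 2 P (h.ouSeries hu a κ s)⟫_ℝ)
      atTop (𝓝 0) := by
  set w := L'.compLpL 2 P (h.ouSeries hu a κ s) with hw
  have hinc : ∀ k r, Tendsto (fun t => ⟪w, (modeFunctional u L k).compLpL 2 P
      (h.curve k t - h.curve k (t - r))⟫_ℝ) atTop (𝓝 0) := by
    intro k r
    set R : ℝ → StrongDual ℝ (Lp E 2 P) := fun t =>
      (innerSL ℝ ((modeFunctional u L k).compLpL 2 P (h.curve k t - h.curve k (t - r)))).comp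
        (L'.compLpL 2 P) with hR
    have hRb : ∀ t, ‖R t‖ ≤ ‖(modeFunctional u L k).compLpL 2 P‖ * (1 * |r| ^ H) *
        ‖L'.compLpL 2 P‖ := by
      intro t
      refine (ContinuousLinearMap.opNorm_comp_le _ _).trans ?_
      rw [innerSL_apply_norm]
      have h1 := h.isHolderCurve hH.1 k t (t - r)
      rw [sub_sub_cancel] at h1
      have h2 := ((modeFunctional u L k).compLpL 2 P).le_opNorm (h.curve k t - h.curve k (t - r))
      gcongr
      exact h2.trans (by gcongr)
    -- For a fixed mode and lag, pairing with the increment at time `t` is bounded uniformly in `t`,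
    -- so the vectors it kills in the limit form a closed subspace. This subspace contains the
    -- noise, hence also the series at time `s`.
    have hmem : h.ouSeries hu a κ s ∈ tendstoZeroSubmodule R atTop := by
      refine h.ouSeries_mem hu hH.1 hκ ha (isClosed_tendstoZeroSubmodule hRb) fun l q _ => ?_
      rw [mem_tendstoZeroSubmodule]
      refine (h.tendsto_inner_increments hH (modeFunctional u L k) (modeFunctional u L' l) k l r q).congr
        fun t => ?_
      simp only [hR, ContinuousLinearMap.comp_apply, innerSL_apply_apply, compLpL_modeEmb]
    rw [mem_tendstoZeroSubmodule] at hmem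
    refine hmem.congr fun t => ?_
    rw [hw, real_inner_comm]
    rfl
  -- From increments to a whole mode: paired with `w`, the mode is the moving average of a scalar
  -- Hölder curve with vanishing increments. The sum over modes is then handled by domination.
  have hmode : ∀ k, Tendsto (fun t => ⟪w, L.compLpL 2 P
      (modeEmb P hu k (a k • ouFilter (κ k) (h.curve k) t))⟫_ℝ) atTop (𝓝 0) := by
    intro k
    set Λ : StrongDual ℝ (Lp ℂ 2 P) := (innerSL ℝ w).comp ((modeFunctional u L k).compLpL 2 P)
    have h1 := ((h.isHolderCurve hH.1 k).comp_clm Λ).tendsto_ouFilter (hκ k) hH.1 fun r => by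
      refine (hinc k r).congr fun t => ?_
      change Λ _ = Λ _ - Λ _
      rw [map_sub]
    have h2 := h1.const_mul (a k)
    rw [mul_zero] at h2
    refine h2.congr fun t => ?_
    rw [compLpL_modeEmb, map_smul, inner_smul_right]
    congr 1
    exact ((h.isHolderCurve hH.1 k).map_ouFilter (hκ k) hH.1 Λ t).symm
  have hfin := OrthogonalFamily.tendsto_map_tsum_zero (orthogonalFamily_modeEmb (P := P) hu)
    ((innerSL ℝ w).comp (L.compLpL 2 P)).toLinearMap.toAddMonoidHom (l := atTop)
    (fun x => ((innerSL ℝ w).comp (L.compLpL 2 P)).le_opNorm x) (summable_bound ha)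
    (f := fun t k => a k • ouFilter (κ k) (h.curve k) t)
    (Eventually.of_forall fun t k => h.norm_smul_ouFilter_le hH.1 hκ k t) hmode
  refine hfin.congr fun t => ?_
  rw [real_inner_comm]
  rfl

end IsInfiniteDimFractionalBM

end

/-! ### Stationarity and mixing of the measurable version -/

section

variable {Ω : Type*} [MeasurableSpace Ω] {P : Measure Ω} [IsProbabilityMeasure P] {H : ℝ}
  {E : Type*} [NormedAddCommGroup E] [InnerProductSpace ℂ E] [CompleteSpace E] [NormedSpace ℝ E]
  [IsScalarTower ℝ ℂ E] [SecondCountableTopology E] [MeasurableSpace E] [BorelSpace E]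
  {u : Mode → E} {hu : Orthonormal ℂ u} {β : Mode → ℝ → Ω → ℂ} {a κ : Mode → ℝ} {Ψ : ℝ → Ω → E}

namespace IsInfiniteDimFractionalBM

lemma charFun_version (h : IsInfiniteDimFractionalBM H β P) (hH : 0 < H) (hκ : ∀ k, 0 < κ k)
    (ha : Summable fun k => (a k * κ k ^ (-H)) ^ 2) (hΨ : ∀ t, Ψ t =ᵐ[P] h.ouSeries hu a κ t)
    {n : ℕ} (L : Fin n → StrongDual ℝ E) (t : Fin n → ℝ) :
    ∫ ω, Complex.exp ((∑ i, L i (Ψ (t i) ω) : ℝ) * Complex.I) ∂P =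
      Complex.exp (-(‖∑ i, (L i).compLpL 2 P (h.ouSeries hu a κ (t i))‖ ^ 2 / 2 : ℝ)) := by
  rw [← h.charFun_gaussianSpace (h.gaussianSpace.sum_mem fun i _ =>
    h.compLpL_ouSeries_mem hu hH hκ ha (L i) (t i))]
  refine integral_congr_ae ?_
  have h1 : ∀ᵐ ω ∂P, ∀ i, (L i).compLpL 2 P (h.ouSeries hu a κ (t i)) ω = L i (Ψ (t i) ω) :=
    ae_all_iff.2 fun i => by
      filter_upwards [(L i).coeFn_compLpL (p := 2) (h.ouSeries hu a κ (t i)), hΨ (t i)]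
        with ω h1 h2
      rw [h1, h2]
  filter_upwards [h1, Lp.coeFn_finsetSum Finset.univ
    fun i => (L i).compLpL 2 P (h.ouSeries hu a κ (t i))] with ω h1 h2
  rw [h2, Finset.sum_apply]
  simp only [h1]

lemma norm_sum_compLpL_shift (h : IsInfiniteDimFractionalBM H β P) (hH : 0 < H)
    (hκ : ∀ k, 0 < κ k) (ha : Summable fun k => (a k * κ k ^ (-H)) ^ 2) {n : ℕ}
    (L : Fin n → StrongDual ℝ E) (t : Fin n → ℝ) (r : ℝ) :
    ‖∑ i, (L i).compLpL 2 P (h.ouSeries hu a κ (t i + r))‖ ^ 2 =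
      ‖∑ i, (L i).compLpL 2 P (h.ouSeries hu a κ (t i))‖ ^ 2 := by
  rw [← real_inner_self_eq_norm_sq, ← real_inner_self_eq_norm_sq, sum_inner, sum_inner]
  refine Finset.sum_congr rfl fun i _ => ?_
  rw [inner_sum, inner_sum]
  exact Finset.sum_congr rfl fun j _ => h.inner_ouSeries_shift hu hH hκ ha _ _ _ _ _

/-- A centred Gaussian law is determined by its covariances, and these are shift invariant. -/
lemma identDistrib_version (h : IsInfiniteDimFractionalBM H β P) (hH : 0 < H) (hκ : ∀ k, 0 < κ k)
    (ha : Summable fun k => (a k * κ k ^ (-H)) ^ 2) (hΨ : ∀ t, Ψ t =ᵐ[P] h.ouSeries hu a κ t)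
    (hm : ∀ t, Measurable (Ψ t)) (n : ℕ) (t : Fin n → ℝ) (r : ℝ) :
    IdentDistrib (fun ω i => Ψ (t i + r) ω) (fun ω i => Ψ (t i) ω) P P := by
  have hmt : ∀ t : Fin n → ℝ, Measurable fun ω i => Ψ (t i) ω := fun t =>
    measurable_pi_lambda _ fun i => hm (t i)
  have hm1 := hmt fun i => t i + r
  refine ⟨hm1.aemeasurable, (hmt t).aemeasurable, ?_⟩
  have hp1 : IsProbabilityMeasure (P.map fun ω i => Ψ (t i + r) ω) :=
    Measure.isProbabilityMeasure_map hm1.aemeasurable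
  have hp2 : IsProbabilityMeasure (P.map fun ω i => Ψ (t i) ω) :=
    Measure.isProbabilityMeasure_map (hmt t).aemeasurable
  refine Measure.ext_of_charFunDual (funext fun L => ?_)
  have hcf : ∀ t : Fin n → ℝ, charFunDual (P.map fun ω i => Ψ (t i) ω) L =
      Complex.exp (-(‖∑ i, (L.comp (ContinuousLinearMap.single ℝ (fun _ : Fin n => E) i)).compLpL 2 P
        (h.ouSeries hu a κ (t i))‖ ^ 2 / 2 : ℝ)) := by
    intro t
    rw [← h.charFun_version hH hκ ha hΨ, charFunDual_apply]
    change ∫ v, trig L v ∂_ = _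
    rw [integral_map (hmt t).aemeasurable (continuous_trig L).aestronglyMeasurable]
    refine integral_congr_ae (ae_of_all _ fun ω => ?_)
    change Complex.exp _ = Complex.exp _
    rw [← L.sum_comp_single]
  rw [hcf t, hcf fun i => t i + r, h.norm_sum_compLpL_shift hH hκ ha]

lemma isMixingProcess_version (h : IsInfiniteDimFractionalBM H β P) (hH : H ∈ Ioo (0 : ℝ) 1)
    (hκ : ∀ k, 0 < κ k) (ha : Summable fun k => (a k * κ k ^ (-H)) ^ 2)
    (hΨ : ∀ t, Ψ t =ᵐ[P] h.ouSeries hu a κ t) (hm : Measurable (Function.uncurry Ψ)) :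
    IsMixingProcess P Ψ where
  measurable := hm
  stationary := h.identDistrib_version hH.1 hκ ha hΨ fun t => hm.of_uncurry_left
  continuity L s := by
    have h1 : Tendsto (fun t => ‖L.compLpL 2 P (h.ouSeries hu a κ t - h.ouSeries hu a κ s)‖) (𝓝 s)
        (𝓝 0) := by
      have h2 := ((L.compLpL 2 P).continuous.tendsto 0).comp
        (tendsto_sub_nhds_zero_iff.2 ((h.continuous_ouSeries hu hH.1 hκ ha).tendsto s))
      rw [map_zero] at h2
      simpa using h2.norm
    refine squeeze_zero (fun t => integral_nonneg fun ω => norm_nonneg _) (fun t => ?_) h1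
    refine le_trans ?_ (integral_norm_le_norm_L2 _)
    have hmt : ∀ t, Measurable fun ω => trig L (Ψ t ω) := fun t =>
      (continuous_trig L).measurable.comp hm.of_uncurry_left
    refine integral_mono_ae ?_ ((Lp.memLp _).integrable one_le_two).norm ?_
    · refine Integrable.of_bound ((hmt t).sub (hmt s)).norm.aestronglyMeasurable 2
        (ae_of_all _ fun ω => ?_)
      rw [norm_norm]
      exact (norm_sub_le _ _).trans (by rw [norm_trig, norm_trig]; norm_num)
    · filter_upwards [L.coeFn_compLpL (p := 2) (h.ouSeries hu a κ t - h.ouSeries hu a κ s),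
        Lp.coeFn_sub (h.ouSeries hu a κ t) (h.ouSeries hu a κ s), hΨ t, hΨ s] with ω h2 h3 h4 h5
      rw [h2, h3, Pi.sub_apply, ← h4, ← h5, map_sub, Real.norm_eq_abs]
      exact norm_trig_sub_le L _ _
  mixing L := by
    set Z : ℝ → Lp ℝ 2 P := fun t => L.compLpL 2 P (h.ouSeries hu a κ t) with hZ
    have hZmem : ∀ t, Z t ∈ h.gaussianSpace := h.compLpL_ouSeries_mem hu hH.1 hκ ha L
    have hZv : ∀ t, ∀ᵐ ω ∂P, Z t ω = L (Ψ t ω) := fun t => by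
      filter_upwards [L.coeFn_compLpL (p := 2) (h.ouSeries hu a κ t), hΨ t] with ω h1 h2
      rw [hZ, h1, h2]
    have hmean : ∫ ω, trig L (Ψ 0 ω) ∂P = Complex.exp (-(‖Z 0‖ ^ 2 / 2 : ℝ)) := by
      rw [← h.charFun_gaussianSpace (hZmem 0)]
      refine integral_congr_ae ?_
      filter_upwards [hZv 0] with ω h1
      rw [h1, trig]
    have hnorm : ∀ d : ℝ, ‖Z d‖ ^ 2 = ‖Z 0‖ ^ 2 := fun d => by
      rw [← real_inner_self_eq_norm_sq, ← real_inner_self_eq_norm_sq]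
      have := h.inner_ouSeries_shift hu hH.1 hκ ha L L 0 0 d
      rwa [zero_add] at this
    -- The correlation is the characteristic function of the Gaussian variable `Z d - Z 0`, of
    -- variance `2 ‖Z 0‖² - 2 ⟪Z d, Z 0⟫`; decay of the covariance leaves the product of the two
    -- means.
    have hcorr : ∀ d : ℝ, ∫ ω, (starRingEnd ℂ) (trig L (Ψ 0 ω)) * trig L (Ψ d ω) ∂P =
        Complex.exp ((⟪Z d, Z 0⟫_ℝ - ‖Z 0‖ ^ 2 : ℝ)) := by
      intro d
      have h1 := h.charFun_gaussianSpace (h.gaussianSpace.sub_mem (hZmem d) (hZmem 0))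
      rw [norm_sub_sq_real, hnorm d] at h1
      have h2 : -((‖Z 0‖ ^ 2 - 2 * ⟪Z d, Z 0⟫_ℝ + ‖Z 0‖ ^ 2) / 2) = ⟪Z d, Z 0⟫_ℝ - ‖Z 0‖ ^ 2 := by
        ring
      rw [← Complex.ofReal_neg, h2] at h1
      rw [← h1]
      refine integral_congr_ae ?_
      filter_upwards [hZv 0, hZv d, Lp.coeFn_sub (Z d) (Z 0)] with ω h3 h4 h5
      rw [h5, Pi.sub_apply, h3, h4, conj_trig, trig, trig, ← Complex.exp_add]
      congr 1
      rw [neg_apply]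
      push_cast
      ring
    rw [hmean]
    simp only [hcorr]
    have hlim : Tendsto (fun d : ℕ => ⟪Z d, Z 0⟫_ℝ - ‖Z 0‖ ^ 2) atTop (𝓝 (0 - ‖Z 0‖ ^ 2)) :=
      ((h.tendsto_inner_ouSeries hu hH hκ ha L L 0).comp tendsto_natCast_atTop_atTop).sub_const _
    have h3 := (Complex.continuous_exp.tendsto _).comp ((Complex.continuous_ofReal.tendsto _).comp hlim)
    have h4 : (starRingEnd ℂ) (Complex.exp (-(‖Z 0‖ ^ 2 / 2 : ℝ))) *
        Complex.exp (-(‖Z 0‖ ^ 2 / 2 : ℝ)) = Complex.exp ((0 - ‖Z 0‖ ^ 2 : ℝ)) := by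
      rw [← Complex.exp_conj, ← Complex.exp_add, map_neg, Complex.conj_ofReal]
      congr 1
      push_cast
      ring
    rw [h4]
    exact h3

end IsInfiniteDimFractionalBM

end

section

/-! ### Wiener integrals and series -/

section Generic

variable {Ω : Type*} [MeasurableSpace Ω] {P : Measure Ω} {E : Type*} [NormedAddCommGroup E]

lemma eLpNorm_eq_ofReal_norm {f : Ω → E} {z : Lp E 2 P} (h : f =ᵐ[P] z) :
    eLpNorm f 2 P = ENNReal.ofReal ‖z‖ := by
  rw [eLpNorm_congr_ae h, Lp.norm_def, ENNReal.ofReal_toReal (Lp.eLpNorm_ne_top z)]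

lemma ae_eq_of_forall_exists_eLpNorm_sub_le {f g : Ω → E} (hf : AEStronglyMeasurable f P)
    (hg : AEStronglyMeasurable g P)
    (h : ∀ ε : ℝ, 0 < ε → ∃ s : Ω → E, AEStronglyMeasurable s P ∧
      eLpNorm (fun ω => s ω - f ω) 2 P ≤ ENNReal.ofReal ε ∧
      eLpNorm (fun ω => s ω - g ω) 2 P ≤ ENNReal.ofReal ε) : f =ᵐ[P] g := by
  have h0 : eLpNorm (g - f) 2 P = 0 := by
    refine le_antisymm (ENNReal.le_of_forall_pos_le_add fun ε hε _ => ?_) zero_le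
    obtain ⟨s, hs, h1, h2⟩ := h (ε / 2) (by positivity)
    have h3 : g - f = (fun ω => s ω - f ω) - fun ω => s ω - g ω := by
      ext ω
      simp
    rw [h3, zero_add]
    refine (eLpNorm_sub_le (hs.sub hf) (hs.sub hg) one_le_two).trans
      ((add_le_add h1 h2).trans ?_)
    rw [← ENNReal.ofReal_add (by positivity) (by positivity), add_halves, ENNReal.ofReal_coe_nnreal]
  have h4 := (eLpNorm_eq_zero_iff (hg.sub hf) two_ne_zero).1 h0
  filter_upwards [h4] with ω hω
  exact (sub_eq_zero.1 hω).symm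

lemma exists_uniform_partition {a c δ : ℝ} (hac : a ≤ c) (hδ : 0 < δ) :
    ∃ (n : ℕ) (p : ℕ → ℝ), Monotone p ∧ p 0 = a ∧ p n = c ∧
      ∀ i < n, p (i + 1) - p i < δ ∧ p i ∈ Icc (p i) (p (i + 1)) := by
  obtain ⟨n, hn⟩ := exists_nat_gt ((c - a) / δ)
  have hn0 : (0 : ℝ) < n := (div_nonneg (sub_nonneg.2 hac) hδ.le).trans_lt hn
  -- Truncation by `min i n` keeps the points at `c` beyond the last index, as global monotonicity
  -- requires.
  set p : ℕ → ℝ := fun i => a + (c - a) * ((min i n : ℕ) / n)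
  have hp : Monotone p := fun i j hij => by
    have : ((min i n : ℕ) : ℝ) ≤ (min j n : ℕ) := by exact_mod_cast min_le_min_right n hij
    have := sub_nonneg.2 hac
    simp only [p]
    gcongr
  refine ⟨n, p, hp, by simp [p], by simp [p, hn0.ne'], fun i hi => ⟨?_, le_rfl, hp i.le_succ⟩⟩
  simp only [p, min_eq_left hi.le, min_eq_left (Nat.succ_le_of_lt hi)]
  have h1 : a + (c - a) * ((i + 1 : ℕ) / n) - (a + (c - a) * (i / n)) = (c - a) / n := by
    push_cast
    field_simp
    ring
  rw [h1, div_lt_iff₀ hn0]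
  rwa [div_lt_iff₀ hδ, mul_comm] at hn

/-- A single Riemann-Stieltjes sum, on a partition fine enough for both definitions, is close to
both candidates. -/
lemma IsWienerIntegral.ae_eq {b : ℝ → Ω → ℂ} {f : ℝ → ℝ} {a c : ℝ} {Y Y' : Ω → ℂ}
    (hb : ∀ t, AEStronglyMeasurable (b t) P) (hac : a ≤ c) (h : IsWienerIntegral P f b a c Y)
    (h' : IsWienerIntegral P f b a c Y') : Y =ᵐ[P] Y' := by
  refine ae_eq_of_forall_exists_eLpNorm_sub_le h.1.1 h'.1.1 fun ε hε => ?_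
  obtain ⟨δ, hδ, h1⟩ := h.2 ε hε
  obtain ⟨δ', hδ', h2⟩ := h'.2 ε hε
  obtain ⟨n, p, hp, hp0, hpn, hpi⟩ := exists_uniform_partition hac (lt_min hδ hδ')
  refine ⟨_, ?_, h1 n p p hp hp0 hpn fun i hi => ⟨(hpi i hi).1.trans_le (min_le_left _ _),
    (hpi i hi).2⟩, h2 n p p hp hp0 hpn fun i hi => ⟨(hpi i hi).1.trans_le (min_le_right _ _),
    (hpi i hi).2⟩⟩
  exact Finset.aestronglyMeasurable_fun_sum _ fun i _ => ((hb _).sub (hb _)).const_mul _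

end Generic

variable {Ω : Type*} [MeasurableSpace Ω] {P : Measure Ω} [IsProbabilityMeasure P] {H : ℝ}

namespace IsComplexFractionalBM

variable {b : ℝ → Ω → ℂ}

lemma isWienerIntegral_stieltjes (h : IsComplexFractionalBM H b P) (hH : 0 < H) {f f' : ℝ → ℝ}
    (hf : ∀ s, HasDerivAt f (f' s) s) (hf' : Continuous f') {a c : ℝ} (hac : a ≤ c) {Y : Ω → ℂ}
    (hY : Y =ᵐ[P] (stieltjes f f' h.curve a c : Lp ℂ 2 P)) : IsWienerIntegral P f b a c Y := by
  refine ⟨(memLp_congr_ae hY).2 (Lp.memLp _), fun ε hε => ?_⟩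
  obtain ⟨M, hM⟩ := (isCompact_Icc (a := a) (b := c)).exists_bound_of_continuousOn hf'.continuousOn
  have hM0 : 0 ≤ M := (norm_nonneg _).trans (hM a ⟨le_rfl, hac⟩)
  set η := ε / (M * (c - a) + 1)
  have hden : 0 < M * (c - a) + 1 := by
    have := mul_nonneg hM0 (sub_nonneg.2 hac)
    positivity
  have hη : 0 < η := div_pos hε hden
  -- With mesh below `η ^ (1 / H)` the oscillation of the curve is at most `η`; the `+ 1` in the
  -- denominator of `η` covers the case `M * (c - a) = 0`.
  refine ⟨η ^ (1 / H), by positivity, fun n p ξ hp hp0 hpn hmesh => ?_⟩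
  have key := norm_sum_sub_stieltjes_le hf hf' ((h.isHolderCurve hH).continuous hH) hM
    (η := η) (fun s _ r _ hsr => by
      refine (h.isHolderCurve hH s r).trans ?_
      rw [one_mul]
      refine (Real.rpow_le_rpow (abs_nonneg _) hsr.le hH.le).trans ?_
      rw [← Real.rpow_mul hη.le, one_div_mul_cancel hH.ne', Real.rpow_one]) n p ξ hp hp0 hpn hmesh
  set z : Lp ℂ 2 P := (∑ i ∈ Finset.range n, f (ξ i) • (h.curve (p (i + 1)) - h.curve (p i))) -
    stieltjes f f' h.curve a c
  have hz : (fun ω => (∑ i ∈ Finset.range n, (f (ξ i) : ℂ) * (b (p (i + 1)) ω - b (p i) ω)) - Y ω)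
      =ᵐ[P] z := by
    have h1 : ∀ᵐ ω ∂P, ∀ i, (f (ξ i) • (h.curve (p (i + 1)) - h.curve (p i)) : Lp ℂ 2 P) ω =
        (f (ξ i) : ℂ) * (b (p (i + 1)) ω - b (p i) ω) := ae_all_iff.2 fun i => by
      filter_upwards [Lp.coeFn_smul (f (ξ i)) (h.curve (p (i + 1)) - h.curve (p i)),
        Lp.coeFn_sub (h.curve (p (i + 1))) (h.curve (p i)), h.coeFn_curve (p (i + 1)),
        h.coeFn_curve (p i)] with ω h1 h2 h3 h4
      rw [h1, Pi.smul_apply, h2, Pi.sub_apply, h3, h4, Complex.real_smul]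
    filter_upwards [h1, hY, Lp.coeFn_sub (∑ i ∈ Finset.range n,
      f (ξ i) • (h.curve (p (i + 1)) - h.curve (p i))) (stieltjes f f' h.curve a c),
      Lp.coeFn_finsetSum (Finset.range n)
        fun i => f (ξ i) • (h.curve (p (i + 1)) - h.curve (p i))] with ω h1 h2 h3 h4
    rw [h3, Pi.sub_apply, h4, Finset.sum_apply, h2]
    simp only [h1]
  rw [eLpNorm_eq_ofReal_norm hz]
  refine ENNReal.ofReal_le_ofReal (key.trans ?_)
  have h2 : M * η * (c - a) = ε * (M * (c - a) / (M * (c - a) + 1)) := by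
    simp only [η]
    ring
  rw [h2]
  exact mul_le_of_le_one_right hε.le ((div_le_one hden).2 (by linarith))

lemma isWienerIntegral_ouIntegral (h : IsComplexFractionalBM H b P) (hH : 0 < H) {κ a c : ℝ}
    (hac : a ≤ c) {Y : Ω → ℂ} (hY : Y =ᵐ[P] (ouIntegral κ h.curve a c : Lp ℂ 2 P)) :
    IsWienerIntegral P (fun s => Real.exp (-(κ * (c - s)))) b a c Y := by
  refine h.isWienerIntegral_stieltjes hH (f' := fun s => κ * Real.exp (-(κ * (c - s))))
    (fun s => ?_) (by fun_prop) hac hY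
  have h1 : HasDerivAt (fun s : ℝ => -(κ * (c - s))) κ s := by
    have h2 : HasDerivAt (fun s : ℝ => -κ * (c - s)) (-κ * -1) s :=
      ((hasDerivAt_id s).const_sub c).const_mul (-κ)
    simpa using h2
  have := h1.exp
  rwa [mul_comm] at this

/-- By `ouFilter_eq` the integral over `[a, c]` differs from the moving average at `c` by
`e^{-κ(c-a)}` times the moving average at `a`, whose norm is bounded uniformly in `a`. -/
lemma isWienerIntegralIic_ouFilter (h : IsComplexFractionalBM H b P) (hH : 0 < H) {κ c : ℝ}
    (hκ : 0 < κ) {Y : Ω → ℂ} (hY : Y =ᵐ[P] (ouFilter κ h.curve c : Lp ℂ 2 P)) :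
    IsWienerIntegralIic P (fun s => Real.exp (-(κ * (c - s)))) b c Y := by
  refine ⟨(memLp_congr_ae hY).2 (Lp.memLp _), fun a => (ouIntegral κ h.curve a c : Lp ℂ 2 P),
    fun a ha => h.isWienerIntegral_ouIntegral hH ha (ae_eq_refl _), ?_⟩
  have h1 : ∀ a, eLpNorm (fun ω => (ouIntegral κ h.curve a c : Lp ℂ 2 P) ω - Y ω) 2 P =
      ENNReal.ofReal ‖ouIntegral κ h.curve a c - ouFilter κ h.curve c‖ := fun a => by
    refine eLpNorm_eq_ofReal_norm ?_
    filter_upwards [hY, Lp.coeFn_sub (ouIntegral κ h.curve a c) (ouFilter κ h.curve c)]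
      with ω h1 h2
    rw [h1, h2, Pi.sub_apply]
  simp only [h1]
  rw [← ENNReal.ofReal_zero]
  refine ENNReal.tendsto_ofReal ?_
  have h2 : Tendsto (fun a => Real.exp (-(κ * (c - a))) * (1 * (Real.Gamma (H + 1) * κ ^ (-H))))
      atBot (𝓝 0) := by
    rw [← zero_mul (1 * (Real.Gamma (H + 1) * κ ^ (-H)))]
    refine Tendsto.mul_const _ (Real.tendsto_exp_neg_atTop_nhds_zero.comp ?_)
    exact (tendsto_atTop_add_const_left atBot c tendsto_neg_atBot_atTop).const_mul_atTop hκ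
  refine squeeze_zero' (Eventually.of_forall fun a => norm_nonneg _) ?_ h2
  filter_upwards [eventually_le_atBot c] with a ha
  rw [(h.isHolderCurve hH).ouFilter_eq hκ hH ha, sub_add_cancel_right, norm_neg, norm_smul,
    Real.norm_eq_abs, abs_of_pos (Real.exp_pos _)]
  gcongr
  exact (h.isHolderCurve hH).norm_ouFilter_le hκ hH a

end IsComplexFractionalBM

section Hilbert

variable {E : Type*} [NormedAddCommGroup E] [InnerProductSpace ℂ E] [CompleteSpace E]
  [NormedSpace ℝ E] [IsScalarTower ℝ ℂ E] {u : Mode → E} {hu : Orthonormal ℂ u}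

lemma tendsto_eLpNorm_sum_modeEmb {c : Mode → ℝ} {z : Mode → Lp ℂ 2 P} {Z : Lp E 2 P}
    (hZ : HasSum (fun k => modeEmb P hu k (c k • z k)) Z) {Y : Mode → Ω → ℂ} {W : Ω → E}
    (hY : ∀ k, Y k =ᵐ[P] z k) (hW : W =ᵐ[P] Z) :
    Tendsto (fun F : Finset Mode =>
      eLpNorm (fun ω => (∑ k ∈ F, ((c k : ℂ) * Y k ω) • u k) - W ω) 2 P) atTop (𝓝 0) := by
  have h1 : ∀ F : Finset Mode, eLpNorm (fun ω => (∑ k ∈ F, ((c k : ℂ) * Y k ω) • u k) - W ω) 2 P =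
      ENNReal.ofReal ‖(∑ k ∈ F, modeEmb P hu k (c k • z k)) - Z‖ := fun F => by
    refine eLpNorm_eq_ofReal_norm ?_
    have h2 : ∀ᵐ ω ∂P, ∀ k, modeEmb P hu k (c k • z k) ω = ((c k : ℂ) * Y k ω) • u k :=
      ae_all_iff.2 fun k => by
        filter_upwards [coeFn_modeEmb hu k (c k • z k), Lp.coeFn_smul (c k) (z k), hY k]
          with ω h1 h2 h3
        rw [h1, h2, Pi.smul_apply, h3, Complex.real_smul]
    filter_upwards [h2, hW, Lp.coeFn_sub (∑ k ∈ F, modeEmb P hu k (c k • z k)) Z,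
      Lp.coeFn_finsetSum F fun k => modeEmb P hu k (c k • z k)] with ω h2 h3 h4 h5
    rw [h4, Pi.sub_apply, h5, Finset.sum_apply, h3]
    simp only [h2]
  simp only [h1]
  rw [← ENNReal.ofReal_zero]
  exact ENNReal.tendsto_ofReal (tendsto_iff_norm_sub_tendsto_zero.1 hZ)

lemma compLpL_modeEmb_of_apply {T : E →L[ℂ] E} {k : Mode} {r : ℝ} (hT : T (u k) = (r : ℂ) • u k)
    (z : Lp ℂ 2 P) : T.compLpL 2 P (modeEmb P hu k z) = modeEmb P hu k (r • z) := by
  refine Lp.ext ?_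
  filter_upwards [T.coeFn_compLpL (p := 2) (modeEmb P hu k z), coeFn_modeEmb hu k z,
    coeFn_modeEmb hu k (r • z), Lp.coeFn_smul r z] with ω h1 h2 h3 h4
  rw [h1, h2, h3, h4, map_smul, hT, Pi.smul_apply, Complex.real_smul, smul_smul, mul_comm]

/-- Summed over modes, the Ornstein-Uhlenbeck identity becomes the mild equation. Convergence of the
convolution series is inherited from the stationary series at the two times. -/
lemma IsInfiniteDimFractionalBM.hasSum_ouIntegral {β : Mode → ℝ → Ω → ℂ} {a κ : Mode → ℝ}
    (h : IsInfiniteDimFractionalBM H β P) (hH : 0 < H) (hκ : ∀ k, 0 < κ k)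
    (ha : Summable fun k => (a k * κ k ^ (-H)) ^ 2) {s t : ℝ} (hst : s ≤ t) {T : E →L[ℂ] E}
    (hT : ∀ k, T (u k) = (Real.exp (-(κ k * (t - s))) : ℂ) • u k) :
    HasSum (fun k => modeEmb P hu k (a k • ouIntegral (κ k) (h.curve k) s t))
      (h.ouSeries hu a κ t - T.compLpL 2 P (h.ouSeries hu a κ s)) := by
  have h1 := (h.hasSum_ouSeries hu hH hκ ha t).sub
    ((h.hasSum_ouSeries hu hH hκ ha s).mapL (T.compLpL 2 P))
  refine h1.congr_fun fun k => ?_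
  rw [compLpL_modeEmb_of_apply (hT k), ← map_sub,
    (h.isHolderCurve hH k).ouFilter_eq (hκ k) hH hst, smul_add, smul_comm (a k),
    add_sub_cancel_left]

end Hilbert

/-! ### Uniqueness of the stochastic convolution -/

lemma IsSeriesL2.ae_eq {c : Mode → ℝ} {Y Y' : Mode → Ω → ℂ} {Z Z' : Ω → V}
    (hYm : ∀ k, AEStronglyMeasurable (Y k) P) (hY : ∀ k, Y k =ᵐ[P] Y' k)
    (h : IsSeriesL2 P c Y Z) (h' : IsSeriesL2 P c Y' Z') : Z =ᵐ[P] Z' := by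
  refine ae_eq_of_forall_exists_eLpNorm_sub_le h.1.1 h'.1.1 fun ε hε => ?_
  have hε' : 0 < ENNReal.ofReal ε := ENNReal.ofReal_pos.2 hε
  obtain ⟨F, h1, h2⟩ := ((h.2.eventually_lt_const hε').and (h'.2.eventually_lt_const hε')).exists
  refine ⟨_, ?_, h1.le, le_of_eq_of_le (eLpNorm_congr_ae ?_) h2.le⟩
  · exact Finset.aestronglyMeasurable_fun_sum _ fun k _ => ((hYm k).const_mul _).smul_const _
  · filter_upwards [ae_all_iff.2 hY] with ω hω
    simp only [hω]

lemma IsStochasticConvolution.ae_eq {ν : ℝ} {α lam : Mode → ℝ} {β : Mode → ℝ → Ω → ℂ}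
    (hβ : IsInfiniteDimFractionalBM H β P) {t : ℝ} (ht : 0 ≤ t) {Z Z' : Ω → V}
    (h : IsStochasticConvolution P H ν α lam β t Z)
    (h' : IsStochasticConvolution P H ν α lam β t Z') : Z =ᵐ[P] Z' := by
  obtain ⟨Y, hY, hZ⟩ := h
  obtain ⟨Y', hY', hZ'⟩ := h'
  exact hZ.ae_eq (fun k => (hY k).1.1) (fun k => (hY k).ae_eq
    (fun t => ((hβ.complexFBM k).measurable t).aestronglyMeasurable) ht (hY' k)) hZ'

end

/-! ### Adaptedness and the summability condition -/

section

variable {Ω : Type*} {mΩ : MeasurableSpace Ω} {P : Measure Ω} [IsProbabilityMeasure P] {H : ℝ}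
  {β : Mode → ℝ → Ω → ℂ}

section Hilbert

variable {E : Type*} [NormedAddCommGroup E] [InnerProductSpace ℂ E] [CompleteSpace E]
  [NormedSpace ℝ E] [IsScalarTower ℝ ℂ E] {u : Mode → E} (hu : Orthonormal ℂ u)

lemma IsInfiniteDimFractionalBM.naturalFiltration_le (h : IsInfiniteDimFractionalBM H β P) (t : ℝ) :
    naturalFiltration β t ≤ mΩ :=
  iSup_le fun k => iSup_le fun s => iSup_le fun _ => ((h.complexFBM k).measurable s).comap_le

lemma measurable_naturalFiltration (k : Mode) {s t : ℝ} (hst : s ≤ t) :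
    Measurable[naturalFiltration β t] (β k s) :=
  Measurable.mono (comap_measurable (β k s))
    (le_iSup_of_le k (le_iSup_of_le s (le_iSup_of_le hst le_rfl))) le_rfl

/-- Classes with a representative measurable for the past form a closed subspace of `L²`, and the
series at time `t` uses the noise up to `t` only. -/
lemma IsInfiniteDimFractionalBM.aestronglyMeasurable_ouSeries
    (h : IsInfiniteDimFractionalBM H β P) (hH : 0 < H) {a κ : Mode → ℝ} (hκ : ∀ k, 0 < κ k)
    (ha : Summable fun k => (a k * κ k ^ (-H)) ^ 2) (t : ℝ) :
    AEStronglyMeasurable[naturalFiltration β t] (h.ouSeries hu a κ t) P := by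
  rw [← mem_lpMeas_iff_aestronglyMeasurable (𝕜 := ℝ)]
  refine h.ouSeries_mem hu hH hκ ha
    (isClosed_aestronglyMeasurable (h.naturalFiltration_le t)) fun k s hs => ?_
  rw [mem_lpMeas_iff_aestronglyMeasurable]
  refine ⟨fun ω => β k s ω • u k,
    (measurable_naturalFiltration k hs).stronglyMeasurable.smul_const (u k), ?_⟩
  filter_upwards [coeFn_modeEmb hu k (h.curve k s), h.coeFn_curve k s] with ω h1 h2
  rw [h1, h2]

end Hilbert

/-- The powers of `ν` cancel, leaving `λ_k α_k^{-2H}`; the lower bound `α_k ≥ c` absorbs the factor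
`α_k^{2ε}`. -/
lemma summable_coefficients {lam α : Mode → ℝ} {c ν : ℝ} (hc : 0 < c) (hα : ∀ k, c ≤ α k)
    (hν : 0 < ν) (hlam : ∀ k, 0 ≤ lam k)
    (hsum : ∃ ε : ℝ, 0 < ε ∧ Summable fun k => lam k * α k ^ (2 * (ε - H))) :
    Summable fun k => (√(lam k) * ν ^ H * (ν * α k) ^ (-H)) ^ 2 := by
  obtain ⟨ε, hε, hs⟩ := hsum
  refine (hs.mul_left (c ^ (2 * ε))⁻¹).of_nonneg_of_le (fun k => by positivity) fun k => ?_
  have hα0 : 0 < α k := hc.trans_le (hα k)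
  have h1 : √(lam k) * ν ^ H * (ν * α k) ^ (-H) = √(lam k) * α k ^ (-H) := by
    rw [Real.mul_rpow hν.le hα0.le, mul_assoc, ← mul_assoc (ν ^ H), ← Real.rpow_add hν,
      add_neg_cancel, Real.rpow_zero, one_mul]
  have h2 : (α k ^ (-H)) ^ 2 = α k ^ (-(2 * H)) := by
    rw [← Real.rpow_natCast, ← Real.rpow_mul hα0.le]
    congr 1
    push_cast
    ring
  have h3 : α k ^ (2 * (ε - H)) = α k ^ (2 * ε) * α k ^ (-(2 * H)) := by
    rw [← Real.rpow_add hα0]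
    congr 1
    ring
  have h4 : c ^ (2 * ε) ≤ α k ^ (2 * ε) := Real.rpow_le_rpow hc.le (hα k) (by positivity)
  rw [h1, mul_pow, Real.sq_sqrt (hlam k), h2, h3, inv_mul_eq_div,
    le_div_iff₀ (Real.rpow_pos_of_pos hc _)]
  have h5 := mul_le_mul_of_nonneg_left h4 (mul_nonneg (hlam k) (Real.rpow_nonneg hα0.le (-(2 * H))))
  linarith

/-! ### Equality of laws from asymptotic coincidence -/

section AsymptoticallyEqual

variable {W : Type*} [NormedAddCommGroup W] [NormedSpace ℝ W] [CompleteSpace W]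
  [SecondCountableTopology W] [MeasurableSpace W] [BorelSpace W]

/-- Two random variables have the same law if they are embedded in two sequences with constant laws
whose difference tends to zero. -/
lemma identDistrib_of_tendsto_sub {X X' : Ω → W} {χ χ' : ℕ → Ω → W} (hX : Measurable X)
    (hX' : Measurable X') (hχ : ∀ N, IdentDistrib (χ N) X P P)
    (hχ' : ∀ N, IdentDistrib (χ' N) X' P P)
    (hlim : ∀ᵐ ω ∂P, Tendsto (fun N => χ N ω - χ' N ω) atTop (𝓝 0)) : IdentDistrib X X' P P := by
  refine ⟨hX.aemeasurable, hX'.aemeasurable, ?_⟩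
  have hp1 : IsProbabilityMeasure (P.map X) := Measure.isProbabilityMeasure_map hX.aemeasurable
  have hp2 : IsProbabilityMeasure (P.map X') := Measure.isProbabilityMeasure_map hX'.aemeasurable
  refine Measure.ext_of_charFunDual (funext fun L => ?_)
  have hcf : ∀ {X : Ω → W} {χ : ℕ → Ω → W}, Measurable X → (∀ N, IdentDistrib (χ N) X P P) →
      ∀ N, charFunDual (P.map X) L = ∫ ω, trig L (χ N ω) ∂P := by
    intro X χ hX hχ N
    rw [charFunDual_apply]
    change ∫ v, trig L v ∂_ = _
    rw [integral_map hX.aemeasurable (continuous_trig L).aestronglyMeasurable]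
    exact (((hχ N).comp (continuous_trig L).measurable).integral_eq).symm
  have hmt : ∀ {X : Ω → W} {χ : ℕ → Ω → W}, (∀ N, IdentDistrib (χ N) X P P) → ∀ N,
      AEStronglyMeasurable (fun ω => trig L (χ N ω)) P := fun hχ N =>
    ((continuous_trig L).measurable.comp_aemeasurable (hχ N).aemeasurable_fst).aestronglyMeasurable
  have hint : ∀ {X : Ω → W} {χ : ℕ → Ω → W}, (∀ N, IdentDistrib (χ N) X P P) → ∀ N,
      Integrable (fun ω => trig L (χ N ω)) P := fun hχ N =>
    Integrable.of_bound (hmt hχ N) 1 (ae_of_all _ fun ω => (norm_trig L _).le)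
  -- This integral tends to zero by dominated convergence, yet it does not depend on `N` because the
  -- laws are constant; hence it is zero.
  have hint0 : Tendsto (fun N : ℕ => ∫ ω, (trig L (χ N ω) - trig L (χ' N ω)) ∂P) atTop
      (𝓝 (∫ _, (0 : ℂ) ∂P)) := by
    refine tendsto_integral_of_dominated_convergence (fun _ => 2)
      (fun N => (hmt hχ N).sub (hmt hχ' N)) (integrable_const _)
      (fun N => ae_of_all _ fun ω => (norm_sub_le _ _).trans ?_) ?_
    · rw [norm_trig, norm_trig]
      norm_num
    · filter_upwards [hlim] with ω hω
      have h1 := ((L.continuous.tendsto 0).comp hω).norm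
      rw [map_zero, norm_zero] at h1
      refine squeeze_zero_norm (fun N => (norm_trig_sub_le L _ _).trans_eq ?_) h1
      rw [Function.comp_apply, map_sub, Real.norm_eq_abs]
  have hconst : ∀ N : ℕ, ∫ ω, (trig L (χ N ω) - trig L (χ' N ω)) ∂P =
      charFunDual (P.map X) L - charFunDual (P.map X') L := fun N => by
    rw [integral_sub (hint hχ N) (hint hχ' N), ← hcf hX hχ, ← hcf hX' hχ']
  simp only [hconst, integral_zero] at hint0
  exact sub_eq_zero.1 (tendsto_nhds_unique tendsto_const_nhds hint0)

end AsymptoticallyEqual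

/-! ### Existence and uniqueness of the stationary solution -/

section Solution

variable {ν c : ℝ} {α lam : Mode → ℝ} {ψ φ : ℝ → Ω → V}

/-- The stationary solution as a curve in `L²(Ω, V)`. -/
def stationaryCurve (hβ : IsInfiniteDimFractionalBM H β P) (ν : ℝ) (α lam : Mode → ℝ) (t : ℝ) :
    Lp V 2 P :=
  hβ.ouSeries orthonormal_e (fun k => √(lam k) * ν ^ H) (fun k => ν * α k) t

lemma isStationarySeries_of_version (hβ : IsInfiniteDimFractionalBM H β P) (hH : 0 < H)
    (hκ : ∀ k, 0 < ν * α k)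
    (ha : Summable fun k => (√(lam k) * ν ^ H * (ν * α k) ^ (-H)) ^ 2)
    (hψ : ∀ t, ψ t =ᵐ[P] stationaryCurve hβ ν α lam t) (t : ℝ) :
    IsStationarySeries P H ν α lam β t (ψ t) := by
  refine ⟨fun k => (ouFilter (ν * α k) (hβ.curve k) t : Lp ℂ 2 P), fun k => ?_,
    (memLp_congr_ae (hψ t)).2 (Lp.memLp _),
    tendsto_eLpNorm_sum_modeEmb (hβ.hasSum_ouSeries orthonormal_e hH hκ ha t)
      (fun k => ae_eq_refl _) (hψ t)⟩
  have h1 : (fun s : ℝ => Real.exp (-(t - s) * ν * α k)) =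
      fun s => Real.exp (-(ν * α k * (t - s))) := by
    ext s
    ring_nf
  rw [h1]
  exact (hβ.complexFBM k).isWienerIntegralIic_ouFilter hH (hκ k) (ae_eq_refl _)

/-- The remainder `ψ(t) - S(t) ψ(0)` is taken as the candidate convolution, so the mild equation
holds identically; the content is that this remainder is the series of Wiener integrals over `[0,
t]`. -/
lemma isStochasticConvolution_of_version (hβ : IsInfiniteDimFractionalBM H β P) (hH : 0 < H)
    (hν : 0 < ν) (hα : ∀ k, 0 < α k)
    (ha : Summable fun k => (√(lam k) * ν ^ H * (ν * α k) ^ (-H)) ^ 2)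
    (hψ : ∀ t, ψ t =ᵐ[P] stationaryCurve hβ ν α lam t) {t : ℝ} (ht : 0 ≤ t) :
    IsStochasticConvolution P H ν α lam β t
      (fun ω => ψ t ω - semigroupV hν (fun k => (hα k).le) t (ψ 0 ω)) := by
  set S := semigroupV hν (fun k => (hα k).le) t
  have hS : ∀ k, S (e k) = (Real.exp (-(ν * α k * (t - 0))) : ℂ) • e k := fun k => by
    rw [sub_zero]
    exact (isSemigroupGeneratedBy_semigroupV hν fun k => (hα k).le).apply_e k ht
  have hsum := hβ.hasSum_ouIntegral (hu := orthonormal_e) hH (fun k => mul_pos hν (hα k)) ha ht hS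
  have hv : (fun ω => ψ t ω - S (ψ 0 ω)) =ᵐ[P] (stationaryCurve hβ ν α lam t -
      S.compLpL 2 P (stationaryCurve hβ ν α lam 0) : Lp V 2 P) := by
    filter_upwards [hψ t, hψ 0, Lp.coeFn_sub (stationaryCurve hβ ν α lam t)
      (S.compLpL 2 P (stationaryCurve hβ ν α lam 0)),
      S.coeFn_compLpL (p := 2) (stationaryCurve hβ ν α lam 0)] with ω h1 h2 h3 h4
    rw [h3, Pi.sub_apply, h4, h1, h2]
  refine ⟨fun k => (ouIntegral (ν * α k) (hβ.curve k) 0 t : Lp ℂ 2 P), fun k => ?_,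
    (memLp_congr_ae hv).2 (Lp.memLp _),
    tendsto_eLpNorm_sum_modeEmb hsum (fun k => ae_eq_refl _) hv⟩
  have h1 : (fun s : ℝ => Real.exp (-(t - s) * ν * α k)) =
      fun s => Real.exp (-(ν * α k * (t - s))) := by
    ext s
    ring_nf
  rw [h1]
  exact (hβ.complexFBM k).isWienerIntegral_ouIntegral hH ht (ae_eq_refl _)

lemma isMildSolution_of_version (hβ : IsInfiniteDimFractionalBM H β P) (hH : 0 < H)
    (hν : 0 < ν) (hα : ∀ k, 0 < α k)
    (ha : Summable fun k => (√(lam k) * ν ^ H * (ν * α k) ^ (-H)) ^ 2)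
    (hψ : ∀ t, ψ t =ᵐ[P] stationaryCurve hβ ν α lam t) (hm : Measurable (Function.uncurry ψ)) :
    IsMildSolution P H ν α lam β ψ := fun _ _ =>
  ⟨hm.comp ((measurable_subtype_coe.comp measurable_fst).prodMk measurable_snd),
    semigroupV hν fun k => (hα k).le, isSemigroupGeneratedBy_semigroupV hν fun k => (hα k).le,
    fun _ ht => ⟨_, isStochasticConvolution_of_version hβ hH hν hα ha hψ ht.1,
      ae_of_all _ fun _ => (add_sub_cancel _ _).symm⟩⟩

lemma IsMildSolution.measurable (h : IsMildSolution P H ν α lam β φ) {t : ℝ} (ht : 0 ≤ t) :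
    Measurable (φ t) := by
  have h1 := (h (t + 1) (by positivity)).1
  exact h1.comp (measurable_const.prodMk measurable_id (f := fun _ : Ω =>
    (⟨t, ht, by linarith⟩ : Icc (0 : ℝ) (t + 1))))

/-- Driven by the same noise, the two stochastic convolutions agree almost surely and cancel; the
difference evolves under the semigroup, whose decay rate is the spectral gap `ν c`. -/
lemma IsMildSolution.norm_sub_le_exp_mul (hβ : IsInfiniteDimFractionalBM H β P) (hν : 0 < ν) (hc : 0 ≤ c)
    (hα : ∀ k, c ≤ α k) (hφ : IsMildSolution P H ν α lam β φ)
    (hψ : IsMildSolution P H ν α lam β ψ) {t : ℝ} (ht : 0 ≤ t) :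
    ∀ᵐ ω ∂P, ‖φ t ω - ψ t ω‖ ≤ Real.exp (-(ν * c * t)) * ‖φ 0 ω - ψ 0 ω‖ := by
  have hα0 : ∀ k, 0 ≤ α k := fun k => hc.trans (hα k)
  obtain ⟨-, S, hS, h1⟩ := hφ (t + 1) (by positivity)
  obtain ⟨-, S', hS', h2⟩ := hψ (t + 1) (by positivity)
  obtain ⟨Z, hZ, h3⟩ := h1 t ⟨ht, by linarith⟩
  obtain ⟨Z', hZ', h4⟩ := h2 t ⟨ht, by linarith⟩
  filter_upwards [h3, h4, hZ.ae_eq hβ ht hZ'] with ω h5 h6 h7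
  rw [h5, h6, h7, add_sub_add_right_eq_sub, hS.eq_semigroupV hν hα0 ht,
    hS'.eq_semigroupV hν hα0 ht, ← map_sub]
  exact norm_semigroupV_le hν hα0 hc hα ht _

/-- Shifting all times by an integer `N` leaves both laws unchanged, while the paths approach each
other exponentially fast. Integer shifts need only countably many null sets. -/
lemma IsMildSolution.sameDistribution (hβ : IsInfiniteDimFractionalBM H β P) (hν : 0 < ν)
    (hc : 0 < c) (hα : ∀ k, c ≤ α k) (hφ : IsMildSolution P H ν α lam β φ)
    (hψ : IsMildSolution P H ν α lam β ψ) (hφs : IsStrictlyStationary P φ)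
    (hψs : IsStrictlyStationary P ψ) : SameDistribution P φ ψ := by
  intro n t ht
  have hm : ∀ {χ : ℝ → Ω → V}, IsMildSolution P H ν α lam β χ →
      Measurable fun ω i => χ (t i) ω := fun h =>
    measurable_pi_lambda _ fun i => h.measurable (ht i)
  refine identDistrib_of_tendsto_sub (χ := fun (N : ℕ) ω i => φ (t i + N) ω)
    (χ' := fun (N : ℕ) ω i => ψ (t i + N) ω) (hm hφ) (hm hψ)
    (fun N => hφs n t N ht N.cast_nonneg) (fun N => hψs n t N ht N.cast_nonneg) ?_
  have hae : ∀ᵐ ω ∂P, ∀ (N : ℕ) (i : Fin n), ‖φ (t i + N) ω - ψ (t i + N) ω‖ ≤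
      Real.exp (-(ν * c * (t i + N))) * ‖φ 0 ω - ψ 0 ω‖ :=
    ae_all_iff.2 fun N => ae_all_iff.2 fun i =>
      hφ.norm_sub_le_exp_mul hβ hν hc.le hα hψ (add_nonneg (ht i) N.cast_nonneg)
  filter_upwards [hae] with ω hω
  refine tendsto_pi_nhds.2 fun i => ?_
  have hexp : Tendsto (fun N : ℕ => Real.exp (-(ν * c * (t i + N))) * ‖φ 0 ω - ψ 0 ω‖) atTop
      (𝓝 0) := by
    have h1 := (Real.tendsto_exp_neg_atTop_nhds_zero.comp
      ((tendsto_atTop_add_const_left atTop (t i) tendsto_natCast_atTop_atTop).const_mul_atTop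
        (mul_pos hν hc))).mul_const ‖φ 0 ω - ψ 0 ω‖
    rwa [zero_mul] at h1
  exact squeeze_zero_norm (fun N => hω N i) hexp

end Solution

end

end FractionalSPDE

end

theorem mainTheorem2 {Ω : Type*} [MeasurableSpace Ω] (P : Measure Ω) [IsProbabilityMeasure P]
    (H : ℝ) (hH : H ∈ Set.Ioo (0 : ℝ) 1) (ν : ℝ) (hν : 0 < ν)
    -- the eigenvalues of `-A`
    (c : ℝ) (hc : 0 < c) (α : Mode → ℝ) (hα_ge : ∀ k, c ≤ α k) (hα_symm : ∀ k, α (-k) = α k)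
    (hα_lim : Tendsto α cofinite atTop)
    -- the bounded operator `Q^{1/2}` with eigenvalues `√λ_k`
    (lam : Mode → ℝ) (hlam_nonneg : ∀ k, 0 ≤ lam k) (hlam_symm : ∀ k, lam (-k) = lam k)
    (Qhalf : V →L[ℂ] V) (hQ : ∀ k, Qhalf (e k) = ((√(lam k) : ℝ) : ℂ) • e k)
    -- the driving noise
    (β : Mode → ℝ → Ω → ℂ) (hβ : IsInfiniteDimFractionalBM H β P)
    (hsum : ∃ ε : ℝ, 0 < ε ∧ Summable fun k => lam k * α k ^ (2 * (ε - H))) :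
    ∃ ψ : ℝ → Ω → V,
      IsMildSolution P H ν α lam β ψ ∧
      IsStrictlyStationary P ψ ∧
      IsErgodic P ψ ∧
      IsAdapted P β ψ ∧
      (∀ t : ℝ, IsStationarySeries P H ν α lam β t (ψ t)) ∧
      (∀ φ : ℝ → Ω → V, IsMildSolution P H ν α lam β φ → IsStrictlyStationary P φ →
        IsAdapted P β φ → SameDistribution P φ ψ) := by
  have hα0 : ∀ k, 0 < α k := fun k => hc.trans_le (hα_ge k)
  have hκ : ∀ k, 0 < ν * α k := fun k => mul_pos hν (hα0 k)
  have ha := summable_coefficients (H := H) hc hα_ge hν hlam_nonneg hsum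
  -- One version on all of `ℝ` serves every claim: beyond joint measurability, only the almost sure
  -- class of `ψ t` at each fixed time matters.
  obtain ⟨ψ, hψm, hψ⟩ := exists_jointly_measurable_version
    (x := stationaryCurve hβ ν α lam)
    (hβ.continuous_ouSeries orthonormal_e hH.1 hκ ha).stronglyMeasurable
  have hmix : IsMixingProcess P ψ := hβ.isMixingProcess_version hH hκ ha hψ hψm.measurable
  have hmild : IsMildSolution P H ν α lam β ψ :=
    isMildSolution_of_version hβ hH.1 hν hα0 ha hψ hψm.measurable
  have hstat : IsStrictlyStationary P ψ := fun n t r _ _ => hmix.stationary n t r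
  refine ⟨ψ, hmild, hstat, fun ρ hρ hi => hmix.ae_tendsto_time_average hρ hi, fun t _ => ?_,
    isStationarySeries_of_version hβ hH.1 hκ ha hψ, fun φ hφ hφs _ =>
      hφ.sameDistribution hβ hν hc hα_ge hmild hφs hstat⟩
  exact (hβ.aestronglyMeasurable_ouSeries orthonormal_e hH.1 hκ ha t).congr (hψ t).symm
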